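/- Let $n\ge 3$ and let $(M^n,g)$ be a connected, complete, smooth Riemannian manifold which is locally conformally flat, that is, every point has an open neighbourhood $U$ with a smooth function $u:U\to\mathbb R$ such that the Riemann tensor of $e^{u}g$ vanishes on $U$. Suppose that $(M^n,g)$ is quasi-Einstein: there are a smooth function $f:M\to\mathbb R$ and constants $\mu,\lambda\in\mathbb R$ with $$\mathrm{Ric}+\nabla^2 f-\mu\,df\otimes df=\lambda g .$$ (i) If $\mu=\frac1{2-n}$, then $g$ is globally conformal to a metric of constant curvature: there are a smooth function $u:M\to\mathbb R$ and a constant $K\in\mathbb R$ such that the (not necessarily complete) metric $e^{u}g$ has constant sectional curvature $K$. (ii) If $\mu\neq\frac1{2-n}$, then around every point $p$ with $df_p\neq 0$ the manifold is locally a warped product whose $(n-1)$-dimensional fibers are the level sets of $f$ and have constant sectional curvature: there are an open interval $(a,b)$, a connected open set $V\subset\mathbb R^{n-1}$ with a smooth Riemannian metric $h$ of constant sectional curvature, a smooth function $w:(a,b)\to(0,\infty)$, and a diffeomorphism $\Phi$ from $(a,b)\times V$ onto an open neighbourhood of $p$ in $M$, such that $\Phi^*g=dt^2+w(t)^2h$,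 and, for all $(t,y),(t',y')\in(a,b)\times V$, $f(\Phi(t,y))=f(\Phi(t',y'))$ if and only if $t=t'$. (The case $\mu=0$ is that of locally conformally flat gradient Ricci solitons.) -/

import Mathlib

open scoped Manifold ContDiff Bundle

noncomputable section

namespace QuasiEinstein

/-! ### Riemannian geometry of a coordinate metric

`G y` is the matrix `(g_{ij})` of a metric at the point `y` of a coordinate domain in `ℝ^ι`. -/

section Coordinates

variable {ι : Type*} [Fintype ι] [DecidableEq ι]

/-- The partial derivative `∂ₖ F` at `y`. -/
def pd (k : ι) (F : EuclideanSpace ℝ ι → ℝ) (y : EuclideanSpace ℝ ι) : ℝ :=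
  fderiv ℝ F y (EuclideanSpace.single k 1)

/-- The Christoffel symbol `Γ^k_{ij}` of the Levi-Civita connection of `G`. -/
def christoffel (G : EuclideanSpace ℝ ι → Matrix ι ι ℝ) (k i j : ι)
    (y : EuclideanSpace ℝ ι) : ℝ :=
  (1 / 2 : ℝ) * ∑ l, (G y)⁻¹ k l *
    (pd i (fun z => G z j l) y + pd j (fun z => G z i l) y - pd l (fun z => G z i j) y)

/-- The component `R^d_{abc}` of the curvature tensor
`Riem(X,Y)Z = ∇_Y ∇_X Z - ∇_X ∇_Y Z + ∇_{[X,Y]} Z`, that is, the coefficient of `∂_d` in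
`Riem(∂_a, ∂_b) ∂_c`. -/
def riemannUp (G : EuclideanSpace ℝ ι → Matrix ι ι ℝ) (d a b c : ι)
    (y : EuclideanSpace ℝ ι) : ℝ :=
  pd b (christoffel G d a c) y - pd a (christoffel G d b c) y
    + ∑ e, (christoffel G e a c y * christoffel G d b e y
      - christoffel G e b c y * christoffel G d a e y)

/-- `R_{abcd} = g_{de} R^e_{abc}`. With this convention `R_{abcd} v^a w^b v^c w^d` is positive
on round spheres. -/
def riemann (G : EuclideanSpace ℝ ι → Matrix ι ι ℝ) (a b c d : ι)
    (y : EuclideanSpace ℝ ι) : ℝ :=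
  ∑ e, G y d e * riemannUp G e a b c y

/-- The Ricci tensor `R_{ac} = g^{bd} R_{abcd}`. -/
def ricci (G : EuclideanSpace ℝ ι → Matrix ι ι ℝ) (a c : ι) (y : EuclideanSpace ℝ ι) : ℝ :=
  ∑ b, ∑ d, (G y)⁻¹ b d * riemann G a b c d y

/-- The Hessian `∇²_{ij} F = ∂_i ∂_j F - Γ^k_{ij} ∂_k F`. -/
def hessian (G : EuclideanSpace ℝ ι → Matrix ι ι ℝ) (F : EuclideanSpace ℝ ι → ℝ) (i j : ι)
    (y : EuclideanSpace ℝ ι) : ℝ :=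
  pd i (pd j F) y - ∑ k, christoffel G k i j y * pd k F y

/-- The sectional curvatures of `G` at `y` are all equal to `K`:
`Riem(v,w,v,w) = K (|v|²|w|² - ⟨v,w⟩²)` for all `v`, `w`. -/
def HasSectionalCurvatureAt (G : EuclideanSpace ℝ ι → Matrix ι ι ℝ) (K : ℝ)
    (y : EuclideanSpace ℝ ι) : Prop :=
  ∀ v w : ι → ℝ,
    ∑ a, ∑ b, ∑ c, ∑ d, riemann G a b c d y * v a * w b * v c * w d
      = K * ((∑ i, ∑ j, G y i j * v i * v j) * (∑ i, ∑ j, G y i j * w i * w j)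
          - (∑ i, ∑ j, G y i j * v i * w j) ^ 2)

end Coordinates

/-! ### Riemannian geometry of a manifold, in charts -/

section Manifold

variable {n : ℕ} {M : Type*} [TopologicalSpace M] [ChartedSpace (EuclideanSpace ℝ (Fin n)) M]

/-- The coordinate matrix of a field `g` of bilinear forms on the tangent spaces of `M`
in the chart `e`. -/
def coordMetric (g : ∀ x : M, TangentSpace (𝓡 n) x → TangentSpace (𝓡 n) x → ℝ)
    (e : OpenPartialHomeomorph M (EuclideanSpace ℝ (Fin n))) (y : EuclideanSpace ℝ (Fin n)) :
    Matrix (Fin n) (Fin n) ℝ :=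
  Matrix.of fun i j => g (e.symm y)
    (mfderiv (𝓡 n) (𝓡 n) e.symm y
      (EuclideanSpace.single i 1 : EuclideanSpace ℝ (Fin n)))
    (mfderiv (𝓡 n) (𝓡 n) e.symm y
      (EuclideanSpace.single j 1 : EuclideanSpace ℝ (Fin n)))

/-- The conformal metric `e^u g`. -/
def conformalMetric (u : M → ℝ)
    (g : ∀ x : M, TangentSpace (𝓡 n) x → TangentSpace (𝓡 n) x → ℝ) :
    ∀ x : M, TangentSpace (𝓡 n) x → TangentSpace (𝓡 n) x → ℝ :=
  fun x v w => Real.exp (u x) * g x v w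

/-- The equation `Ric + ∇²f - μ df ⊗ df = λ g`, in all smooth charts. -/
def IsQuasiEinstein (g : ∀ x : M, TangentSpace (𝓡 n) x → TangentSpace (𝓡 n) x → ℝ)
    (f : M → ℝ) (μ lam : ℝ) : Prop :=
  ∀ e ∈ IsManifold.maximalAtlas (𝓡 n) ∞ M, ∀ y ∈ e.target, ∀ i j : Fin n,
    ricci (coordMetric g e) i j y + hessian (coordMetric g e) (f ∘ e.symm) i j y
      - μ * (pd i (f ∘ e.symm) y * pd j (f ∘ e.symm) y)
      = lam * coordMetric g e y i j

/-- The Riemann tensor of `g` vanishes on `U`. -/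
def IsFlatOn (g : ∀ x : M, TangentSpace (𝓡 n) x → TangentSpace (𝓡 n) x → ℝ)
    (U : Set M) : Prop :=
  ∀ e ∈ IsManifold.maximalAtlas (𝓡 n) ∞ M, ∀ y ∈ e.target, e.symm y ∈ U →
    ∀ a b c d : Fin n, riemann (coordMetric g e) a b c d y = 0

/-- Around every point some conformal metric `e^u g` is flat. -/
def IsLocallyConformallyFlat
    (g : ∀ x : M, TangentSpace (𝓡 n) x → TangentSpace (𝓡 n) x → ℝ) : Prop :=
  ∀ p : M, ∃ (U : Set M) (u : M → ℝ), IsOpen U ∧ p ∈ U ∧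
    ContMDiffOn (𝓡 n) 𝓘(ℝ, ℝ) ∞ u U ∧ IsFlatOn (conformalMetric u g) U

/-- `g` has constant sectional curvature `K`. -/
def HasConstantCurvature (g : ∀ x : M, TangentSpace (𝓡 n) x → TangentSpace (𝓡 n) x → ℝ)
    (K : ℝ) : Prop :=
  ∀ e ∈ IsManifold.maximalAtlas (𝓡 n) ∞ M, ∀ y ∈ e.target,
    HasSectionalCurvatureAt (coordMetric g e) K y

/-- Around `p`, the metric `g` is a warped product `dt² + w(t)² h` over an interval, whose fibers
are the level sets of `f` and have constant sectional curvature. Here `Φ` is a diffeomorphism of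
`(a, b) × V` onto an open neighbourhood of `p`, the fiber is a connected open subset `V` of
`ℝ^(n-1)` with a Riemannian metric `h` of constant sectional curvature `K`, and two points of the
neighbourhood lie on the same fiber exactly if `f` takes the same value at them. -/
def IsLocallyWarpedProductAt
    (g : ∀ x : M, TangentSpace (𝓡 n) x → TangentSpace (𝓡 n) x → ℝ)
    (f : M → ℝ) (p : M) : Prop :=
  ∃ (Φ : OpenPartialHomeomorph (ℝ × EuclideanSpace ℝ (Fin (n - 1))) M)
    (a b : ℝ) (V : Set (EuclideanSpace ℝ (Fin (n - 1)))) (w : ℝ → ℝ)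
    (h : EuclideanSpace ℝ (Fin (n - 1)) → Matrix (Fin (n - 1)) (Fin (n - 1)) ℝ) (K : ℝ),
    IsOpen V ∧ IsConnected V ∧ Φ.source = Set.Ioo a b ×ˢ V ∧ p ∈ Φ.target ∧
    ContMDiffOn 𝓘(ℝ, ℝ × EuclideanSpace ℝ (Fin (n - 1))) (𝓡 n) ∞ Φ Φ.source ∧
    ContMDiffOn (𝓡 n) 𝓘(ℝ, ℝ × EuclideanSpace ℝ (Fin (n - 1))) ∞ Φ.symm Φ.target ∧
    ContDiffOn ℝ ∞ w (Set.Ioo a b) ∧ (∀ t ∈ Set.Ioo a b, 0 < w t) ∧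
    (∀ i j, ContDiffOn ℝ ∞ (fun y => h y i j) V) ∧ (∀ y ∈ V, (h y).PosDef) ∧
    (∀ y ∈ V, HasSectionalCurvatureAt h K y) ∧
    (∀ x ∈ Φ.source, ∀ X Y : ℝ × EuclideanSpace ℝ (Fin (n - 1)),
      g (Φ x)
        (mfderiv 𝓘(ℝ, ℝ × EuclideanSpace ℝ (Fin (n - 1))) (𝓡 n) Φ x X)
        (mfderiv 𝓘(ℝ, ℝ × EuclideanSpace ℝ (Fin (n - 1))) (𝓡 n) Φ x Y)
        = X.1 * Y.1 + w x.1 ^ 2 * ∑ i, ∑ j, h x.2 i j * X.2 i * Y.2 j) ∧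
    (∀ x ∈ Φ.source, ∀ x' ∈ Φ.source, f (Φ x) = f (Φ x') ↔ x.1 = x'.1)

/-- The Riemannian metric of a Riemannian manifold, as a field of bilinear forms. -/
def metricTensor (n : ℕ) (M : Type*) [TopologicalSpace M]
    [ChartedSpace (EuclideanSpace ℝ (Fin n)) M]
    [Bundle.RiemannianBundle (fun x : M => TangentSpace (𝓡 n) x)] :
    ∀ x : M, TangentSpace (𝓡 n) x → TangentSpace (𝓡 n) x → ℝ :=
  fun _ v w => inner ℝ v w

end Manifold

end QuasiEinstein

end

noncomputable section

namespace QuasiEinstein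

set_option linter.unusedSectionVars false
set_option synthInstance.maxHeartbeats 400000

/-! ### Inverse function theorem and composition operators on spaces of continuous functions. -/

section Analysis

open Set Filter Topology MeasureTheory

universe u

/-! Near any point there are coordinates in which `g = v⁻²⟨·,·⟩`
(`IsLocallyConformallyFlat.exists_chart`). Multiplied by `v`, the quasi-Einstein equation then says
that `v ∇²f + dv ⊗ df + df ⊗ dv + (n-2) ∇²v - μ v df ⊗ df`, with flat derivatives, is a multiple `s`
of the identity (`isFlatQuasiEinstein_of_ricci`). Differentiating and antisymmetrizing cancels the
third derivatives, and the equation itself removes `∇²f`. What remains is a Codazzi-type identity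
(`IsFlatQuasiEinstein.codazzi`): `(1 + μ(n-2)) (v_ik f_j - v_ij f_k) = δ_ij τ_k - δ_ik τ_j` with `τ
= ds - μ s df`. The factor on the left vanishes exactly for `μ = 1/(2-n)`, which separates the two
cases.

If it vanishes, then `τ = 0`, and `z = v exp(f/(n-2))` has Hessian `C • 1` with `C` constant
(`IsFlatQuasiEinstein.exists_const`). Hence `z⁻²⟨·,·⟩ = exp(-2f/(n-2)) g` has constant curvature
`2zC - |∇z|²`. The conformal factor is globally defined, and connectedness makes the local curvature
constants agree.

If it does not vanish, linear algebra at the points with `df ≠ 0` gives `∇²v = α • 1 + β df ⊗ df`.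
It follows that the level sets of `f` are totally umbilic, and that the `g`-norm of `df`, the
principal curvature and the ambient curvature of the tangent planes are constant along them
(`IsFlatQuasiEinstein.exists_isUmbilicFoliation` and the lemmas on `IsUmbilicFoliation`). The flow
of the unit gradient therefore carries level sets to level sets and scales their metrics by a
function of the flow time alone (`IsFlowBox.metric_eq`). The Gauss equation shows that the fibre has
constant curvature.

A single Gauss equation, `IsUmbilic.riemann_eq`, serves three maps: the identity (curvature of a
conformally flat metric), chart transitions, and parametrized level sets. The analytic input is a
smooth flow, obtained from the inverse function theorem in `C([0,1], E)`, and the Frobenius theorem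
for linear total systems, which produces flat coordinates. -/

/-- The inverse function theorem with a smooth inverse on the whole target. -/
theorem exists_openPartialHomeomorph_of_contDiffOn {E F : Type*} [NormedAddCommGroup E]
    [NormedSpace ℝ E] [CompleteSpace E] [NormedAddCommGroup F] [NormedSpace ℝ F]
    {f : E → F} {U : Set E} (hU : IsOpen U) (hf : ContDiffOn ℝ ∞ f U) {a : E} (ha : a ∈ U)
    (f' : E ≃L[ℝ] F) (hf' : HasFDerivAt f (f' : E →L[ℝ] F) a) :
    ∃ Θ : OpenPartialHomeomorph E F, a ∈ Θ.source ∧ Θ.source ⊆ U ∧ (∀ x, Θ x = f x) ∧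
      ContDiffOn ℝ ∞ Θ.symm Θ.target ∧
      ∀ x ∈ Θ.source, ∃ L : E ≃L[ℝ] F, HasFDerivAt f (L : E →L[ℝ] F) x := by
  have hfa : ContDiffAt ℝ ∞ f a := hf.contDiffAt (hU.mem_nhds ha)
  set Θ₀ := hfa.toOpenPartialHomeomorph f hf' (by simp) with hΘ₀
  have hcont : ContinuousOn (fderiv ℝ f) U := hf.continuousOn_fderiv_of_isOpen hU (by simp)
  -- Invertible operators form an open set, so cutting down to the points with invertible derivative
  -- keeps the domain open and makes the inverse smooth on the whole target, not just at the image
  -- of `a`.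
  set s : Set E := U ∩ fderiv ℝ f ⁻¹' range ((↑) : (E ≃L[ℝ] F) → E →L[ℝ] F) with hs
  have hsopen : IsOpen s := hcont.isOpen_inter_preimage hU (ContinuousLinearEquiv.isOpen)
  have hder : ∀ x ∈ s, ∃ L : E ≃L[ℝ] F, HasFDerivAt f (L : E →L[ℝ] F) x := by
    rintro x ⟨hxU, L, hL⟩
    refine ⟨L, ?_⟩
    rw [hL]
    exact ((hf.contDiffAt (hU.mem_nhds hxU)).differentiableAt (by simp)).hasFDerivAt
  refine ⟨Θ₀.restrOpen s hsopen, ?_, ?_, fun x => rfl, ?_, ?_⟩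
  · rw [OpenPartialHomeomorph.restrOpen_source]
    exact ⟨hfa.mem_toOpenPartialHomeomorph_source hf' (by simp), ha, f', hf'.fderiv.symm⟩
  · rw [OpenPartialHomeomorph.restrOpen_source]
    exact fun x hx => hx.2.1
  · intro y hy
    apply ContDiffAt.contDiffWithinAt
    have hy' := (Θ₀.restrOpen s hsopen).map_target hy
    rw [OpenPartialHomeomorph.restrOpen_source] at hy'
    obtain ⟨L, hL⟩ := hder _ hy'.2
    exact (Θ₀.restrOpen s hsopen).contDiffAt_symm hy hL
      (hf.contDiffAt (hU.mem_nhds hy'.2.1))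
  · intro x hx
    rw [OpenPartialHomeomorph.restrOpen_source] at hx
    exact hder x hx.2

variable {K : Type u} [TopologicalSpace K] [CompactSpace K]

/-- A continuous bilinear map, applied pointwise to continuous functions. -/
def pointwiseBilin (K : Type u) [TopologicalSpace K] [CompactSpace K]
    {A E F : Type u} [NormedAddCommGroup A] [NormedSpace ℝ A] [NormedAddCommGroup E]
    [NormedSpace ℝ E] [NormedAddCommGroup F] [NormedSpace ℝ F] (B : A →L[ℝ] E →L[ℝ] F) :
    C(K, A) →L[ℝ] C(K, E) →L[ℝ] C(K, F) :=
  LinearMap.mkContinuous₂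
    (LinearMap.mk₂ ℝ (fun (α : C(K, A)) (γ : C(K, E)) =>
        (⟨fun t => B (α t) (γ t), by fun_prop⟩ : C(K, F)))
      (fun _ _ _ => by ext; simp) (fun _ _ _ => by ext; simp) (fun _ _ _ => by ext; simp)
      (fun _ _ _ => by ext; simp))
    ‖B‖ (fun α γ => by
      refine (ContinuousMap.norm_le _ (by positivity)).2 fun t => ?_
      refine (B.le_opNorm₂ (α t) (γ t)).trans ?_
      gcongr
      exacts [α.norm_coe_le_norm t, γ.norm_coe_le_norm t])

theorem pointwiseBilin_apply {A E F : Type u} [NormedAddCommGroup A] [NormedSpace ℝ A]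
    [NormedAddCommGroup E] [NormedSpace ℝ E]
    [NormedAddCommGroup F] [NormedSpace ℝ F] (B : A →L[ℝ] E →L[ℝ] F) (α : C(K, A)) (γ : C(K, E))
    (t : K) : pointwiseBilin K B α γ t = B (α t) (γ t) := rfl

instance normedAddCommGroupContinuousMapCLM {E F : Type u} [NormedAddCommGroup E]
    [NormedSpace ℝ E] [NormedAddCommGroup F] [NormedSpace ℝ F] :
    NormedAddCommGroup C(K, E →L[ℝ] F) := inferInstance

/-- The remainder is estimated for each `t` by the mean value inequality on the segment from `γ t`
to `γ t + v t`. The estimate is uniform in `t` because postcomposition with `fderiv ℝ X` is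
continuous for the sup norm. -/
theorem hasFDerivAt_comp_continuousMap {E F : Type u} [NormedAddCommGroup E] [NormedSpace ℝ E]
    [NormedAddCommGroup F] [NormedSpace ℝ F] (X : C(E, F)) (hX : ContDiff ℝ 1 X) (γ : C(K, E)) :
    HasFDerivAt (fun γ : C(K, E) => X.comp γ)
      (pointwiseBilin K (ContinuousLinearMap.id ℝ (E →L[ℝ] F))
        ((⟨fderiv ℝ X, hX.continuous_fderiv (by simp)⟩ : C(E, E →L[ℝ] F)).comp γ)) γ := by
  set D : C(E, E →L[ℝ] F) := ⟨fderiv ℝ X, hX.continuous_fderiv (by simp)⟩ with hD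
  rw [hasFDerivAt_iff_isLittleO_nhds_zero, Asymptotics.isLittleO_iff]
  intro ε hε
  have hc : ContinuousAt (fun γ : C(K, E) => D.comp γ) γ :=
    (ContinuousMap.continuous_postcomp D).continuousAt
  obtain ⟨δ, hδ, hclose⟩ := Metric.continuousAt_iff.1 hc ε hε
  filter_upwards [Metric.ball_mem_nhds (0 : C(K, E)) hδ] with v hv
  rw [mem_ball_zero_iff] at hv
  refine (ContinuousMap.norm_le _ (by positivity)).2 fun t => ?_
  have hseg : ∀ x ∈ segment ℝ (γ t) (γ t + v t),
      ‖fderiv ℝ X x - fderiv ℝ X (γ t)‖ ≤ ε := by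
    rw [segment_eq_image']
    rintro x ⟨s, hs, rfl⟩
    have hlt : dist (γ + s • v) γ < δ := by
      rw [dist_eq_norm, add_sub_cancel_left, norm_smul, Real.norm_of_nonneg hs.1]
      exact (mul_le_of_le_one_left (norm_nonneg _) hs.2).trans_lt hv
    have h1 := hclose hlt
    rw [dist_eq_norm] at h1
    have h2 := (D.comp (γ + s • v) - D.comp γ).norm_coe_le_norm t
    have h3 := h2.trans h1.le
    simpa [hD] using h3
  have := (convex_segment (𝕜 := ℝ) (γ t) (γ t + v t)).norm_image_sub_le_of_norm_hasFDerivWithin_le'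
    (f := X) (f' := fderiv ℝ X) (φ := fderiv ℝ X (γ t)) (C := ε)
    (fun x _ => ((hX.differentiable (by simp)) x).hasFDerivAt.hasFDerivWithinAt) hseg
    (left_mem_segment ℝ _ _) (right_mem_segment ℝ _ _)
  rw [add_sub_cancel_left] at this
  have h4 : ‖X (γ t + v t) - X (γ t) - fderiv ℝ X (γ t) (v t)‖ ≤ ε * ‖v‖ :=
    this.trans (mul_le_mul_of_nonneg_left (v.norm_coe_le_norm t) hε.le)
  simpa [pointwiseBilin_apply, hD] using h4

/-- The derivative of postcomposition with `X` is built from postcomposition with `fderiv ℝ X`, a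
map of one order less into another target. For this reason `F` stays quantified inside the
induction. -/
theorem contDiff_nat_comp_continuousMap {E : Type u} [NormedAddCommGroup E] [NormedSpace ℝ E]
    (n : ℕ) : ∀ {F : Type u} [NormedAddCommGroup F] [NormedSpace ℝ F] (X : C(E, F)),
      ContDiff ℝ n X → ContDiff ℝ n (fun γ : C(K, E) => X.comp γ) := by
  induction n with
  | zero =>
    intro F _ _ X hX
    exact contDiff_zero.2 (ContinuousMap.continuous_postcomp _)
  | succ n ih =>
    intro F _ _ X hX
    have hX1 : ContDiff ℝ 1 X := hX.of_le (by exact_mod_cast Nat.le_add_left 1 n)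
    have hD : ContDiff ℝ n (fderiv ℝ X) := hX.fderiv_right (by push_cast; rfl)
    rw [show ((n + 1 : ℕ) : WithTop ℕ∞) = (n : WithTop ℕ∞) + 1 by push_cast; rfl,
      contDiff_succ_iff_hasFDerivAt]
    refine ⟨_, ?_, fun γ => hasFDerivAt_comp_continuousMap X hX1 γ⟩
    exact (pointwiseBilin K (ContinuousLinearMap.id ℝ (E →L[ℝ] F))).contDiff.comp
      (ih ⟨fderiv ℝ X, hX1.continuous_fderiv (by simp)⟩ hD)

/-- Composition with a smooth map is a smooth operator on continuous functions. -/
theorem contDiff_comp_continuousMap {E F : Type u} [NormedAddCommGroup E] [NormedSpace ℝ E]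
    [NormedAddCommGroup F] [NormedSpace ℝ F] (X : C(E, F)) (hX : ContDiff ℝ ∞ X) :
    ContDiff ℝ ∞ (fun γ : C(K, E) => X.comp γ) := by
  rw [contDiff_infty]
  intro n
  exact contDiff_nat_comp_continuousMap n X (hX.of_le (by exact_mod_cast le_top))

end Analysis

/-! ### Smooth dependence of ordinary differential equations on parameters. -/

section ODE

open Set Filter Topology MeasureTheory unitInterval

variable {E : Type} [NormedAddCommGroup E]

/-- The constant extension to the real line of a continuous function on the unit interval. -/
def extendUnit (γ : C(I, E)) (s : ℝ) : E := γ (projIcc 0 1 zero_le_one s)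

theorem continuous_extendUnit (γ : C(I, E)) : Continuous (extendUnit γ) :=
  γ.continuous.comp continuous_projIcc

theorem extendUnit_coe (γ : C(I, E)) (t : I) : extendUnit γ t = γ t := by
  simp [extendUnit]

theorem norm_extendUnit_le (γ : C(I, E)) (s : ℝ) : ‖extendUnit γ s‖ ≤ ‖γ‖ :=
  γ.norm_coe_le_norm _

variable [NormedSpace ℝ E]

/-- The primitive `t ↦ ∫₀ᵗ γ` as a continuous linear operator. -/
def primitive (E : Type) [NormedAddCommGroup E] [NormedSpace ℝ E] : C(I, E) →L[ℝ] C(I, E) :=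
  LinearMap.mkContinuous
    { toFun := fun γ => ⟨fun t => ∫ s in (0 : ℝ)..t, extendUnit γ s, by
        have := intervalIntegral.continuous_primitive
          (fun a b => (continuous_extendUnit γ).intervalIntegrable (μ := volume) a b) 0
        exact this.comp continuous_subtype_val⟩
      map_add' := fun γ δ => by
        ext t
        exact intervalIntegral.integral_add ((continuous_extendUnit γ).intervalIntegrable _ _)
          ((continuous_extendUnit δ).intervalIntegrable _ _)
      map_smul' := fun c γ => by
        ext t
        exact intervalIntegral.integral_smul c (extendUnit γ) }
    1 (fun γ => by
      rw [one_mul]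
      refine (ContinuousMap.norm_le _ (norm_nonneg _)).2 fun t => ?_
      refine (intervalIntegral.norm_integral_le_of_norm_le_const
        (fun s _ => norm_extendUnit_le γ s)).trans ?_
      rw [sub_zero, abs_of_nonneg t.2.1]
      exact mul_le_of_le_one_right (norm_nonneg _) t.2.2)

/-- A function equal to a constant plus a primitive solves the corresponding differential
equation. -/
theorem exists_hasDerivAt_of_eq_primitive [CompleteSpace E] {β α : C(I, E)} {x₀ : E}
    (h : ∀ t, β t = x₀ + primitive E α t) :
    ∃ y : ℝ → E, y 0 = x₀ ∧ (∀ t : I, y t = β t) ∧ ∀ s, HasDerivAt y (extendUnit α s) s := by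
  refine ⟨fun s => x₀ + ∫ r in (0 : ℝ)..s, extendUnit α r, by simp, fun t => (h t).symm,
    fun s => ?_⟩
  exact (((continuous_extendUnit α).integral_hasStrictDerivAt 0 s).hasDerivAt).const_add x₀

variable {P : Type} [NormedAddCommGroup P] [NormedSpace ℝ P]

/-- The pair of a constant and a continuous function, as a continuous linear map. -/
def constProd (P E : Type) [NormedAddCommGroup P] [NormedSpace ℝ P] [NormedAddCommGroup E]
    [NormedSpace ℝ E] : P × C(I, E) →L[ℝ] C(I, P × E) :=
  LinearMap.mkContinuous
    { toFun := fun q => ⟨fun t => (q.1, q.2 t), by fun_prop⟩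
      map_add' := fun _ _ => by ext <;> simp
      map_smul' := fun _ _ => by ext <;> simp }
    1 (fun q => by
      rw [one_mul]
      refine (ContinuousMap.norm_le _ (norm_nonneg _)).2 fun t => ?_
      exact max_le (le_max_left _ _) ((q.2.norm_coe_le_norm t).trans (le_max_right _ _)))

/-- Smooth dependence on parameters for `γ' = F(p, γ)`, `γ(0) = x₀` on `[0,1]`, near a parameter
at which `F` vanishes. -/
theorem exists_contDiffOn_ode [CompleteSpace E] [CompleteSpace P] (F : C(P × E, E))
    (hF : ContDiff ℝ ∞ F) (p₀ : P) (h₀ : ∀ y, F (p₀, y) = 0) (x₀ : E) :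
    ∃ (U : Set P) (Y : P → C(I, E)), IsOpen U ∧ p₀ ∈ U ∧ ContDiffOn ℝ ∞ Y U ∧
      Y p₀ = ContinuousMap.const I x₀ ∧
      ∀ p ∈ U, Y p = ContinuousMap.const I x₀ + primitive E (F.comp (constProd P E (p, Y p))) := by
  set N : P × C(I, E) → C(I, E) := fun q => F.comp (constProd P E q) with hN
  have hNs : ContDiff ℝ ∞ N := (contDiff_comp_continuousMap F hF).comp (constProd P E).contDiff
  -- The solution for the parameter `p` is the `γ` with `Ψ (p, γ) = (p, 0)`. Keeping `p` as a
  -- component turns the implicit function theorem into the inverse function theorem.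
  set Ψ : P × C(I, E) → P × C(I, E) :=
    fun q => (q.1, q.2 - ContinuousMap.const I x₀ - primitive E (N q)) with hΨ
  have hΨs : ContDiff ℝ ∞ Ψ := by
    refine contDiff_fst.prodMk ((contDiff_snd.sub contDiff_const).sub ?_)
    exact (primitive E).contDiff.comp hNs
  set q₀ : P × C(I, E) := (p₀, ContinuousMap.const I x₀) with hq₀
  set L := fderiv ℝ N q₀ with hL
  have hLd : HasFDerivAt N L q₀ := (hNs.differentiable (by simp) q₀).hasFDerivAt
  -- As `F (p₀, ·) = 0`, the operator `N` vanishes identically on the slice `p = p₀`, so its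
  -- derivative depends on the parameter direction only. Thus the derivative of `Ψ` at `q₀` is the
  -- shear `(p, γ) ↦ (p, γ - S p)`, with an evident inverse and no smallness condition.
  have hL0 : ∀ γ, L (0, γ) = 0 := by
    intro γ
    have h1 : HasFDerivAt (fun γ : C(I, E) => N (p₀, γ))
        (L.comp (ContinuousLinearMap.inr ℝ P (C(I, E)))) (ContinuousMap.const I x₀) :=
      HasFDerivAt.comp (f := fun γ : C(I, E) => (p₀, γ)) (ContinuousMap.const I x₀) hLd
        (hasFDerivAt_prodMk_right p₀ _)
    have h2 : (fun γ : C(I, E) => N (p₀, γ)) = fun _ => 0 := by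
      ext γ t
      exact h₀ _
    rw [h2] at h1
    have h3 := h1.unique (hasFDerivAt_const (0 : C(I, E)) _)
    have := congrArg (fun A => A γ) h3
    simpa using this
  have hLv : ∀ p γ, L (p, γ) = L (p, 0) := by
    intro p γ
    rw [show ((p, γ) : P × C(I, E)) = (p, 0) + (0, γ) by simp, map_add, hL0, add_zero]
  set S : P →L[ℝ] C(I, E) :=
    (primitive E).comp (L.comp (ContinuousLinearMap.inl ℝ P (C(I, E)))) with hS
  have hSL : ∀ q, primitive E (L q) = S q.1 := by
    rintro ⟨p, γ⟩
    rw [hLv]; rfl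
  let Λ : (P × C(I, E)) ≃L[ℝ] (P × C(I, E)) :=
    ContinuousLinearEquiv.equivOfInverse
      ((ContinuousLinearMap.fst ℝ _ _).prod
        (ContinuousLinearMap.snd ℝ _ _ - S.comp (ContinuousLinearMap.fst ℝ _ _)))
      ((ContinuousLinearMap.fst ℝ _ _).prod
        (ContinuousLinearMap.snd ℝ _ _ + S.comp (ContinuousLinearMap.fst ℝ _ _)))
      (fun q => by simp) (fun q => by simp)
  have hΨd : HasFDerivAt Ψ (Λ : P × C(I, E) →L[ℝ] P × C(I, E)) q₀ := by
    have h1 : HasFDerivAt Ψ ((ContinuousLinearMap.fst ℝ P C(I, E)).prod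
        (ContinuousLinearMap.snd ℝ P C(I, E) - (primitive E).comp L)) q₀ := by
      refine hasFDerivAt_fst.prodMk ((hasFDerivAt_snd.sub_const _).sub ?_)
      exact (primitive E).hasFDerivAt.comp q₀ hLd
    convert h1 using 1
    refine ContinuousLinearMap.ext fun q => ?_
    exact Prod.ext rfl (by
      change q.2 - S q.1 = q.2 - primitive E (L q)
      rw [hSL])
  obtain ⟨Θ, hΘ₀, -, hΘ, hΘs, -⟩ := exists_openPartialHomeomorph_of_contDiffOn isOpen_univ
    hΨs.contDiffOn (mem_univ q₀) Λ hΨd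
  have hq : Θ q₀ = (p₀, 0) := by
    have hNq : N q₀ = 0 := by ext t; exact h₀ _
    rw [hΘ]
    simp only [hΨ, hNq, map_zero]
    simp [hq₀]
  set j : P → P × C(I, E) := fun p => (p, 0) with hj
  have hjc : Continuous j := by fun_prop
  have hjs : ContDiff ℝ ∞ j := contDiff_id.prodMk contDiff_const
  refine ⟨j ⁻¹' Θ.target, fun p => (Θ.symm (j p)).2, Θ.open_target.preimage hjc, ?_, ?_, ?_, ?_⟩
  · change (p₀, 0) ∈ Θ.target
    rw [← hq]
    exact Θ.map_source hΘ₀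
  · exact contDiff_snd.comp_contDiffOn (hΘs.comp hjs.contDiffOn (fun p hp => hp))
  · change (Θ.symm (p₀, 0)).2 = _
    rw [← hq, Θ.left_inv hΘ₀]
  · intro p hp
    have h1 : Ψ (Θ.symm (j p)) = j p := by rw [← hΘ]; exact Θ.right_inv hp
    have h2 : (Θ.symm (j p)).1 = p := congrArg Prod.fst h1
    have h3 : (Θ.symm (j p)).2 - ContinuousMap.const I x₀ - primitive E (N (Θ.symm (j p))) = 0 :=
      congrArg Prod.snd h1
    have h4 : ((p, (Θ.symm (j p)).2) : P × C(I, E)) = Θ.symm (j p) := Prod.ext h2.symm rfl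
    simp only [h4]
    rw [sub_sub, sub_eq_zero] at h3
    exact h3

/-- The derivative in the parameter satisfies the linearized equation. -/
theorem fderiv_ode_eq_primitive (F : C(P × E, E)) (hF : ContDiff ℝ ∞ F) {x₀ : E} {U : Set P}
    {Y : P → C(I, E)} (hU : IsOpen U) (hY : ContDiffOn ℝ ∞ Y U)
    (hYeq : ∀ p ∈ U,
      Y p = ContinuousMap.const I x₀ + primitive E (F.comp (constProd P E (p, Y p))))
    {p : P} (hp : p ∈ U) (v : P) :
    fderiv ℝ Y p v = primitive E
      ⟨fun s => fderiv ℝ F (p, Y p s) (v, fderiv ℝ Y p v s), by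
        have := hF.continuous_fderiv (by simp)
        fun_prop⟩ := by
  have hYd : HasFDerivAt Y (fderiv ℝ Y p) p :=
    ((hY.contDiffAt (hU.mem_nhds hp)).differentiableAt (by simp)).hasFDerivAt
  have hin : HasFDerivAt (fun p => (p, Y p))
      ((ContinuousLinearMap.id ℝ P).prod (fderiv ℝ Y p)) p := (hasFDerivAt_id p).prodMk hYd
  have hN := (hasFDerivAt_comp_continuousMap F (hF.of_le (by simp))
    (constProd P E (p, Y p))).comp p ((constProd P E).hasFDerivAt.comp p hin)
  have hR := ((primitive E).hasFDerivAt.comp p hN).const_add (ContinuousMap.const I x₀)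
  have hev : Y =ᶠ[𝓝 p] fun p => ContinuousMap.const I x₀ +
      primitive E (F.comp (constProd P E (p, Y p))) := by
    filter_upwards [hU.mem_nhds hp] with q hq using hYeq q hq
  have := hYd.unique (hR.congr_of_eventuallyEq hev)
  have h2 := congrArg (fun A => A v) this
  refine h2.trans ?_
  rfl

end ODE

/-! ### Local flows of vector fields and the Frobenius theorem. -/

section Flow

open Set Filter Topology MeasureTheory unitInterval

/-- A map smooth near a point agrees near that point with a compactly supported smooth map. -/
theorem exists_contDiff_eqOn_ball {E F : Type*} [NormedAddCommGroup E] [NormedSpace ℝ E]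
    [FiniteDimensional ℝ E] [NormedAddCommGroup F] [NormedSpace ℝ F] {X : E → F} {U : Set E}
    (hU : IsOpen U) (hX : ContDiffOn ℝ ∞ X U) {x₀ : E} (hx₀ : x₀ ∈ U) :
    ∃ (Y : E → F) (r : ℝ), 0 < r ∧ Metric.ball x₀ r ⊆ U ∧ ContDiff ℝ ∞ Y ∧ HasCompactSupport Y ∧
      EqOn Y X (Metric.ball x₀ r) := by
  obtain ⟨ρ, hρ, hball⟩ := Metric.isOpen_iff.1 hU x₀ hx₀
  let b : ContDiffBump x₀ := ⟨ρ / 4, ρ / 2, by positivity, by linarith⟩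
  have hts : tsupport b ⊆ U := by
    rw [b.tsupport_eq]
    exact (Metric.closedBall_subset_ball (by change ρ / 2 < ρ; linarith)).trans hball
  refine ⟨fun x => b x • X x, ρ / 4, by positivity,
    (Metric.ball_subset_ball (by linarith)).trans hball, ?_, ?_, ?_⟩
  · rw [contDiff_iff_contDiffAt]
    intro x
    by_cases hx : x ∈ U
    · exact b.contDiff.contDiffAt.smul (hX.contDiffAt (hU.mem_nhds hx))
    · have : (fun x => b x • X x) =ᶠ[𝓝 x] fun _ => 0 := by
        have h1 : (b : E → ℝ) =ᶠ[𝓝 x] 0 := notMem_tsupport_iff_eventuallyEq.1 fun h => hx (hts h)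
        filter_upwards [h1] with y hy
        simp [hy]
      exact contDiffAt_const.congr_of_eventuallyEq this
  · exact b.hasCompactSupport.smul_right
  · intro x hx
    have : b x = 1 := b.one_of_mem_closedBall (Metric.ball_subset_closedBall hx)
    simp [this]

variable {E F : Type} [NormedAddCommGroup E] [NormedSpace ℝ E] [FiniteDimensional ℝ E]
  [NormedAddCommGroup F] [NormedSpace ℝ F] [FiniteDimensional ℝ F]

/-- A smooth vector field has a smooth local flow. -/
theorem exists_contDiffOn_flow {X : E → E} {U : Set E} (hU : IsOpen U) (hX : ContDiffOn ℝ ∞ X U)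
    {x₀ : E} (hx₀ : x₀ ∈ U) :
    ∃ (Fl : ℝ × E → E) (W : Set (ℝ × E)), IsOpen W ∧ (0, x₀) ∈ W ∧ ContDiffOn ℝ ∞ Fl W ∧
      (∀ x, (0, x) ∈ W → Fl (0, x) = x) ∧
      ∀ q ∈ W, Fl q ∈ U ∧ HasDerivAt (fun s => Fl (s, q.2)) (X (Fl q)) q.1 := by
  have : CompleteSpace E := FiniteDimensional.complete ℝ E
  obtain ⟨Z, ρ, hρ, hρU, hZ, hZc, hZX⟩ := exists_contDiff_eqOn_ball hU hX hx₀
  -- The time `t` becomes a parameter: if `y' = t Z(x + y)` and `y(0) = 0`, then `x + y(s)` is the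
  -- flow of `x` at time `t s`. The field vanishes for `t = 0`, as smooth dependence requires, and
  -- the flow at time `t` is read off at `s = 1`.
  have hGs : ContDiff ℝ ∞ (fun q : (ℝ × E) × E => q.1.1 • Z (q.1.2 + q.2)) := by
    have : ContDiff ℝ ∞ (fun q : (ℝ × E) × E => Z (q.1.2 + q.2)) := hZ.comp (by fun_prop)
    have h2 : ContDiff ℝ ∞ (fun q : (ℝ × E) × E => q.1.1) := by fun_prop
    exact h2.smul this
  let G : C((ℝ × E) × E, E) := ⟨_, hGs.continuous⟩
  obtain ⟨U₁, Y, hU₁, hpU, hYs, hY₀, hY⟩ := exists_contDiffOn_ode G hGs (0, x₀)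
    (fun y => by change (0 : ℝ) • Z (x₀ + y) = 0; simp) 0
  obtain ⟨r, hr, ε, hε, hα⟩ :=
    (hZ.contDiffAt (x := x₀)).of_le (m := 1) (by simp)
      |>.exists_forall_mem_closedBall_exists_eq_forall_mem_Ioo_hasDerivAt 0
  set Fl : ℝ × E → E := fun q => q.2 + Y q 1 with hFl
  have hFls : ContDiffOn ℝ ∞ Fl U₁ := by
    refine contDiff_snd.contDiffOn.add ?_
    exact (ContinuousMap.evalCLM ℝ (1 : I)).contDiff.comp_contDiffOn hYs
  set W₁ : Set (ℝ × E) := U₁ ∩ (Ioo (-ε) ε ×ˢ Metric.ball x₀ r) with hW₁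
  have hW₁o : IsOpen W₁ := hU₁.inter (isOpen_Ioo.prod Metric.isOpen_ball)
  -- The construction treats each `t` separately and gives no differential equation in `t`.
  -- Comparison with a Picard–Lindelöf curve `α` supplies it: `s ↦ x + y(s)` and `s ↦ α(t s)` solve
  -- the same equation, whose field is Lipschitz by compact support.
  have key : ∀ x ∈ Metric.ball x₀ r, ∃ α : ℝ → E, α 0 = x ∧
      (∀ t ∈ Ioo (-ε) ε, HasDerivAt α (Z (α t)) t) ∧ ∀ t, (t, x) ∈ W₁ → Fl (t, x) = α t := by
    intro x hx
    obtain ⟨α, hα0, hαd⟩ := hα x (Metric.ball_subset_closedBall hx)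
    simp only [zero_sub, zero_add] at hαd
    refine ⟨α, hα0, hαd, fun t ht => ?_⟩
    obtain ⟨y, hy0, hyY, hyd⟩ := exists_hasDerivAt_of_eq_primitive
      (β := Y (t, x)) (x₀ := 0) (fun s => congrArg (fun γ : C(I, E) => γ s) (hY _ ht.1))
    have hcs : HasCompactSupport (fun z => t • Z z) := hZc.smul_left
    obtain ⟨K, hK⟩ := ContDiff.lipschitzWith_of_hasCompactSupport (n := ∞) (𝕂 := ℝ) hcs
      (contDiff_const.smul hZ) (by simp)
    have hts : ∀ s ∈ Icc (0 : ℝ) 1, t * s ∈ Ioo (-ε) ε := by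
      intro s hs
      have h1 : |t| < ε := abs_lt.2 ht.2.1
      have h2 : |t * s| < ε := by
        rw [abs_mul, abs_of_nonneg hs.1]
        exact (mul_le_of_le_one_right (abs_nonneg t) hs.2).trans_lt h1
      exact abs_lt.1 h2
    have hd1 : ∀ s ∈ Icc (0 : ℝ) 1, HasDerivAt (fun s => x + y s) (t • Z (x + y s)) s := by
      intro s hs
      have h1 := (hyd s).const_add x
      have h2 : extendUnit (G.comp (constProd (ℝ × E) E ((t, x), Y (t, x)))) s
          = t • Z (x + y s) := by
        have := extendUnit_coe (G.comp (constProd (ℝ × E) E ((t, x), Y (t, x)))) ⟨s, hs⟩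
        refine this.trans ?_
        change t • Z (x + Y (t, x) ⟨s, hs⟩) = _
        rw [← hyY]
      rwa [h2] at h1
    have hd2 : ∀ s ∈ Icc (0 : ℝ) 1, HasDerivAt (fun s => α (t * s)) (t • Z (α (t * s))) s := by
      intro s hs
      have h1 := (hαd _ (hts s hs)).scomp s ((hasDerivAt_id s).const_mul t)
      simp only [mul_one] at h1
      exact h1
    have heq := ODE_solution_unique (v := fun _ z => t • Z z) (a := 0) (b := 1) (fun _ => hK)
      (fun s hs => (hd1 s hs).continuousAt.continuousWithinAt)
      (fun s hs => (hd1 s (Ico_subset_Icc_self hs)).hasDerivWithinAt)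
      (fun s hs => (hd2 s hs).continuousAt.continuousWithinAt)
      (fun s hs => (hd2 s (Ico_subset_Icc_self hs)).hasDerivWithinAt)
      (by simp [hy0, hα0])
    have h1 := heq (right_mem_Icc.2 zero_le_one)
    simp only [mul_one] at h1
    have h2 : y 1 = Y (t, x) 1 := hyY 1
    rw [hFl, ← h1, h2]
  -- Where the flow stays in this ball, the cut-off field `Z` agrees with `X`.
  refine ⟨Fl, W₁ ∩ Fl ⁻¹' Metric.ball x₀ ρ, ?_, ?_, ?_, ?_, ?_⟩
  · exact (hFls.continuousOn.mono inter_subset_left).isOpen_inter_preimage hW₁o Metric.isOpen_ball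
  · refine ⟨⟨hpU, ⟨by simpa using hε, by simpa using hr⟩⟩, ?_⟩
    simp [hFl, hY₀, hρ]
  · exact hFls.mono fun q hq => hq.1.1
  · intro x hx
    obtain ⟨α, hα0, -, h⟩ := key x hx.1.2.2
    rw [h 0 hx.1, hα0]
  · rintro ⟨t, x⟩ hq
    refine ⟨hρU hq.2, ?_⟩
    obtain ⟨α, -, hαd, h⟩ := key x hq.1.2.2
    have hev : (fun s => Fl (s, x)) =ᶠ[𝓝 t] α := by
      have hc : ContinuousAt (fun s : ℝ => (s, x)) t := by fun_prop
      filter_upwards [hc.preimage_mem_nhds (hW₁o.mem_nhds hq.1)] with s hs using h s hs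
    have h1 := (hαd t hq.1.2.1).congr_of_eventuallyEq hev
    rwa [← h t hq.1, hZX hq.2] at h1

set_option maxHeartbeats 1000000 in
/-- The Frobenius theorem for linear total differential systems `Dy(x) u = A(x) u y(x)`. -/
theorem exists_contDiffOn_total_system {A : E → E →L[ℝ] F →L[ℝ] F} {Ω : Set E} (hΩ : IsOpen Ω)
    (hA : ContDiffOn ℝ ∞ A Ω) {x₀ : E} (hx₀ : x₀ ∈ Ω)
    (hint : ∀ x ∈ Ω, ∀ u v y, fderiv ℝ A x u v y + A x v (A x u y)
      = fderiv ℝ A x v u y + A x u (A x v y)) (y₀ : F) :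
    ∃ (W : Set E) (y : E → F), IsOpen W ∧ x₀ ∈ W ∧ W ⊆ Ω ∧ ContDiffOn ℝ ∞ y W ∧ y x₀ = y₀ ∧
      ∀ x ∈ W, ∀ u, fderiv ℝ y x u = A x u (y x) := by
  have : CompleteSpace E := FiniteDimensional.complete ℝ E
  have : CompleteSpace F := FiniteDimensional.complete ℝ F
  obtain ⟨B, ρ, hρ, hρΩ, hB, -, hBA⟩ := exists_contDiff_eqOn_ball hΩ hA hx₀
  -- The total system is solved along rays: with `p = x - x₀`, the curve `ξ' = p`, `η' = B(ξ) p η`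
  -- runs over the segment from `x₀` to `x`, and the value at `x` is `η(1)`. The field vanishes for
  -- `p = 0`.
  have hGs : ContDiff ℝ ∞ (fun q : E × (E × F) => (q.1, B q.2.1 q.1 q.2.2)) := by
    have h1 : ContDiff ℝ ∞ (fun q : E × (E × F) => B q.2.1) := hB.comp (by fun_prop)
    exact contDiff_fst.prodMk ((h1.clm_apply contDiff_fst).clm_apply (by fun_prop))
  let G : C(E × (E × F), E × F) := ⟨_, hGs.continuous⟩
  have hGd : ∀ p ξ η v ξ' η', fderiv ℝ G (p, (ξ, η)) (v, (ξ', η'))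
      = (v, fderiv ℝ B ξ ξ' p η + B ξ v η + B ξ p η') := by
    intro p ξ η v ξ' η'
    set π₁ : E × (E × F) →L[ℝ] E := ContinuousLinearMap.fst ℝ E (E × F)
    set π₂ : E × (E × F) →L[ℝ] E :=
      (ContinuousLinearMap.fst ℝ E F).comp (ContinuousLinearMap.snd ℝ E (E × F))
    set π₃ : E × (E × F) →L[ℝ] F :=
      (ContinuousLinearMap.snd ℝ E F).comp (ContinuousLinearMap.snd ℝ E (E × F))
    have hB1 : HasFDerivAt B (fderiv ℝ B (π₂ (p, (ξ, η)))) (π₂ (p, (ξ, η))) :=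
      (hB.differentiable (by simp) _).hasFDerivAt
    have h1 : HasFDerivAt (fun q : E × (E × F) => B (π₂ q))
        ((fderiv ℝ B (π₂ (p, (ξ, η)))).comp π₂) (p, (ξ, η)) :=
      HasFDerivAt.comp (g := B) (f := π₂) (p, (ξ, η)) hB1 π₂.hasFDerivAt
    have h3 := (π₁.hasFDerivAt (x := (p, (ξ, η)))).prodMk
      ((h1.clm_apply π₁.hasFDerivAt).clm_apply π₃.hasFDerivAt)
    refine (congrArg (fun D => D (v, (ξ', η'))) (HasFDerivAt.fderiv (f := G) h3)).trans ?_
    refine Prod.ext rfl ?_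
    change B ξ p η' + (B ξ v η + fderiv ℝ B ξ ξ' p η) = _
    abel_nf
  obtain ⟨U₁, Y, hU₁, hpU, hYs, hY₀, hY⟩ := exists_contDiffOn_ode G hGs 0
    (fun y => by change ((0 : E), B y.1 0 y.2) = _; simp) (x₀, y₀)
  set y : E → F := fun x => (Y (x - x₀) 1).2 with hy
  have hsub : ContDiff ℝ ∞ (fun x : E => x - x₀) := by fun_prop
  refine ⟨Metric.ball x₀ ρ ∩ (fun x => x - x₀) ⁻¹' U₁, y,
    Metric.isOpen_ball.inter (hU₁.preimage hsub.continuous), ⟨by simpa using hρ, by simpa using hpU⟩,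
    fun x hx => hρΩ hx.1, ?_, by simp [hy, hY₀], ?_⟩
  · have h1 : ContDiffOn ℝ ∞ (fun x => Y (x - x₀)) (Metric.ball x₀ ρ ∩ (fun x => x - x₀) ⁻¹' U₁) :=
      hYs.comp hsub.contDiffOn fun x hx => hx.2
    have h2 := ((ContinuousLinearMap.snd ℝ E F).comp
      (ContinuousMap.evalCLM ℝ (1 : I) : C(I, E × F) →L[ℝ] E × F)).contDiff (n := ∞)
    exact h2.comp_contDiffOn h1
  intro x hx v
  obtain ⟨p, hp⟩ : ∃ p, p = x - x₀ := ⟨_, rfl⟩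
  obtain ⟨hxb, hxU⟩ := hx
  change x - x₀ ∈ U₁ at hxU
  rw [← hp] at hxU
  have hxp : x₀ + p = x := by simp [hp]
  obtain ⟨z, hz0, hzY, hzd⟩ := exists_hasDerivAt_of_eq_primitive
    (β := Y p) (x₀ := (x₀, y₀)) (fun s => congrArg (fun γ : C(I, E × F) => γ s) (hY _ hxU))
  have hlin := fderiv_ode_eq_primitive G hGs hU₁ hYs hY hxU v
  obtain ⟨δ, hδ0, hδY, hδd⟩ := exists_hasDerivAt_of_eq_primitive
    (β := fderiv ℝ Y p v) (x₀ := 0)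
    (fun s => (congrArg (fun γ : C(I, E × F) => γ s) hlin).trans (zero_add _).symm)
  have hzd' : ∀ s ∈ Icc (0 : ℝ) 1, HasDerivAt z (p, B (z s).1 p (z s).2) s := by
    intro s hs
    have h1 := hzd s
    have h2 := extendUnit_coe (G.comp (constProd E (E × F) (p, Y p))) ⟨s, hs⟩
    have h3 : (G.comp (constProd E (E × F) (p, Y p))) ⟨s, hs⟩ = (p, B (z s).1 p (z s).2) := by
      change (p, B (Y p ⟨s, hs⟩).1 p (Y p ⟨s, hs⟩).2) = _
      rw [← hzY]
    change extendUnit _ s = _ at h2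
    rwa [h2, h3] at h1
  have hδd' : ∀ s ∈ Icc (0 : ℝ) 1, HasDerivAt δ (v, fderiv ℝ B (z s).1 (δ s).1 p (z s).2
      + B (z s).1 v (z s).2 + B (z s).1 p (δ s).2) s := by
    intro s hs
    have h1 := hδd s
    have h2 := extendUnit_coe (⟨fun s => fderiv ℝ G (p, Y p s) (v, fderiv ℝ Y p v s), by
        have := hGs.continuous_fderiv (by simp)
        fun_prop⟩ : C(I, E × F)) ⟨s, hs⟩
    change extendUnit _ s = fderiv ℝ G (p, Y p ⟨s, hs⟩) (v, fderiv ℝ Y p v ⟨s, hs⟩) at h2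
    rw [← hzY, ← hδY] at h2
    refine h1.congr_deriv (h2.trans (hGd p (z s).1 (z s).2 v (δ s).1 (δ s).2))
  have hzf : ∀ s ∈ Icc (0 : ℝ) 1, HasDerivAt (fun s => (z s).1) p s := fun s hs =>
    (ContinuousLinearMap.fst ℝ E F).hasFDerivAt.comp_hasDerivAt s (hzd' s hs)
  have hzs : ∀ s ∈ Icc (0 : ℝ) 1, HasDerivAt (fun s => (z s).2) (B (z s).1 p (z s).2) s :=
    fun s hs => (ContinuousLinearMap.snd ℝ E F).hasFDerivAt.comp_hasDerivAt s (hzd' s hs)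
  have hδf : ∀ s ∈ Icc (0 : ℝ) 1, HasDerivAt (fun s => (δ s).1) v s := fun s hs =>
    (ContinuousLinearMap.fst ℝ E F).hasFDerivAt.comp_hasDerivAt s (hδd' s hs)
  have hδs : ∀ s ∈ Icc (0 : ℝ) 1, HasDerivAt (fun s => (δ s).2)
      (fderiv ℝ B (z s).1 (δ s).1 p (z s).2 + B (z s).1 v (z s).2 + B (z s).1 p (δ s).2) s :=
    fun s hs => (ContinuousLinearMap.snd ℝ E F).hasFDerivAt.comp_hasDerivAt s (hδd' s hs)
  have hz1 : ∀ s ∈ Icc (0 : ℝ) 1, (z s).1 = x₀ + s • p := by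
    intro s hs
    have h1 : ∀ r ∈ Icc (0 : ℝ) 1, HasDerivAt (fun r => (z r).1 - r • p) 0 r := by
      intro r hr
      exact ((hzf r hr).sub ((hasDerivAt_id r).smul_const p)).congr_deriv (by simp)
    have h2 := constant_of_has_deriv_right_zero
      (fun r hr => (h1 r hr).continuousAt.continuousWithinAt)
      (fun r hr => (h1 r (Ico_subset_Icc_self hr)).hasDerivWithinAt) s hs
    simp only [hz0, zero_smul, sub_zero] at h2
    rw [← h2]; abel
  have hδ1 : ∀ s ∈ Icc (0 : ℝ) 1, (δ s).1 = s • v := by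
    intro s hs
    have h1 : ∀ r ∈ Icc (0 : ℝ) 1, HasDerivAt (fun r => (δ r).1 - r • v) 0 r := by
      intro r hr
      exact ((hδf r hr).sub ((hasDerivAt_id r).smul_const v)).congr_deriv (by simp)
    have h2 := constant_of_has_deriv_right_zero
      (fun r hr => (h1 r hr).continuousAt.continuousWithinAt)
      (fun r hr => (h1 r (Ico_subset_Icc_self hr)).hasDerivWithinAt) s hs
    simp only [hδ0, zero_smul, sub_zero, Prod.fst_zero] at h2
    rwa [sub_eq_zero] at h2
  have hmem : ∀ s ∈ Icc (0 : ℝ) 1, (z s).1 ∈ Metric.ball x₀ ρ := by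
    intro s hs
    rw [hz1 s hs, mem_ball_iff_norm, add_sub_cancel_left, norm_smul, Real.norm_of_nonneg hs.1]
    exact (mul_le_of_le_one_left (norm_nonneg _) hs.2).trans_lt (hp ▸ mem_ball_iff_norm.1 hxb)
  -- `δ` is the variation of the ray solution when `x` moves by `v`; the point with parameter `s`
  -- then moves by `s • v`. So `ζ` is the defect of the total system in direction `v`. By the
  -- integrability condition it solves `ζ' = B p ζ` with `ζ(0) = 0`, hence it vanishes.
  set ζ : ℝ → F := fun s => (δ s).2 - B (z s).1 (s • v) (z s).2 with hζ
  have hζd : ∀ s ∈ Icc (0 : ℝ) 1, HasDerivAt ζ (B (z s).1 p (ζ s)) s := by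
    intro s hs
    have hBz : HasDerivAt (fun s => B (z s).1) (fderiv ℝ B (z s).1 p) s :=
      HasFDerivAt.comp_hasDerivAt (f := fun s => (z s).1) s
        (hB.differentiable (by simp) _).hasFDerivAt (hzf s hs)
    have h1 := (hδs s hs).sub
      ((hBz.clm_apply ((hasDerivAt_id s).smul_const v)).clm_apply (hzs s hs))
    have hin := hint _ (hρΩ (hmem s hs)) (s • v) p (z s).2
    have hBe : fderiv ℝ B (z s).1 = fderiv ℝ A (z s).1 :=
      (hBA.eventuallyEq_of_mem (Metric.isOpen_ball.mem_nhds (hmem s hs))).fderiv_eq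
    have hBe' : B (z s).1 = A (z s).1 := hBA (hmem s hs)
    refine h1.congr_deriv ?_
    rw [hBe, hBe', hδ1 s hs]
    have e0 : ζ s = (δ s).2 - A (z s).1 (s • v) (z s).2 := by rw [← hBe']
    rw [e0, map_sub (A (z s).1 p)]
    simp only [id, one_smul, add_apply]
    rw [← sub_eq_zero] at hin ⊢
    rw [← hin]
    abel_nf
  have hbdd : ∃ C, ∀ s ∈ Icc (0 : ℝ) 1, ‖B (z s).1 p‖ ≤ C := by
    have hc : ContinuousOn (fun s => B (z s).1 p) (Icc 0 1) := by
      intro s hs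
      have h1 : ContinuousAt (fun s => (z s).1) s := (hzf s hs).continuousAt
      have h2 : ContinuousAt (fun s => B (z s).1) s := hB.continuous.continuousAt.comp h1
      exact (h2.clm_apply continuousAt_const).continuousWithinAt
    exact isCompact_Icc.exists_bound_of_continuousOn hc
  obtain ⟨C, hC⟩ := hbdd
  have hζ0 := eq_zero_of_abs_deriv_le_mul_abs_self_of_eq_zero_right (K := C)
    (fun s hs => (hζd s hs).continuousAt.continuousWithinAt)
    (fun s hs => (hζd s (Ico_subset_Icc_self hs)).hasDerivWithinAt)
    (by simp [hζ, hδ0])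
    (fun s hs => (ContinuousLinearMap.le_opNorm _ _).trans
      (mul_le_mul_of_nonneg_right (hC s (Ico_subset_Icc_self hs)) (norm_nonneg _)))
    1 (right_mem_Icc.2 zero_le_one)
  have hYd : HasFDerivAt Y (fderiv ℝ Y p) p :=
    ((hYs.contDiffAt (hU₁.mem_nhds hxU)).differentiableAt (by simp)).hasFDerivAt
  have hyd : HasFDerivAt y ((ContinuousLinearMap.snd ℝ E F).comp
      ((ContinuousMap.evalCLM ℝ (1 : I) : C(I, E × F) →L[ℝ] E × F).comp (fderiv ℝ Y p))) x := by
    have h1 : HasFDerivAt (fun x => Y (x - x₀)) (fderiv ℝ Y p) x :=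
      (HasFDerivAt.comp x (g := Y) (f := fun x => x - x₀) (hp ▸ hYd)
        ((hasFDerivAt_id x).sub_const x₀))
    exact ((ContinuousLinearMap.snd ℝ E F).comp
      (ContinuousMap.evalCLM ℝ (1 : I) : C(I, E × F) →L[ℝ] E × F)).hasFDerivAt.comp x h1
  rw [hyd.fderiv]
  have e0 : y x = (Y p 1).2 := by rw [hy, hp]
  rw [e0]
  change (fderiv ℝ Y p v 1).2 = A x v (Y p 1).2
  have e1 : δ 1 = fderiv ℝ Y p v 1 := hδY 1
  have e2 : z 1 = Y p 1 := hzY 1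
  have e3 : (z 1).1 = x := by rw [hz1 1 (right_mem_Icc.2 zero_le_one), one_smul, hxp]
  simp only [hζ, one_smul, e3, hBA hxb] at hζ0
  rw [← e1, ← e2, ← sub_eq_zero]
  exact hζ0

end Flow

/-! ### Calculus of partial derivatives. -/

section Partial

open Set Filter Topology

variable {ι : Type} [Fintype ι] [DecidableEq ι]
  {F : Type*} [NormedAddCommGroup F] [NormedSpace ℝ F]

/-- The partial derivative `∂ₖ σ` of a vector-valued map. -/
def dd (k : ι) (σ : EuclideanSpace ℝ ι → F) (y : EuclideanSpace ℝ ι) : F :=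
  fderiv ℝ σ y (EuclideanSpace.single k 1)

theorem pd_eq_dd (k : ι) (f : EuclideanSpace ℝ ι → ℝ) : pd k f = dd k f := rfl

theorem sum_smul_single (p : EuclideanSpace ℝ ι) :
    ∑ i, p i • (EuclideanSpace.single i (1 : ℝ) : EuclideanSpace ℝ ι) = p := by
  ext j
  simp [Finset.sum_apply, Pi.single_apply]

theorem clm_eq_sum (L : EuclideanSpace ℝ ι →L[ℝ] F) (p : EuclideanSpace ℝ ι) :
    L p = ∑ i, p i • L (EuclideanSpace.single i 1) := by
  conv_lhs => rw [← sum_smul_single p]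
  simp [map_sum]

theorem fderiv_eq_sum_dd (σ : EuclideanSpace ℝ ι → F) (x p : EuclideanSpace ℝ ι) :
    fderiv ℝ σ x p = ∑ i, p i • dd i σ x :=
  clm_eq_sum _ _

variable {Ω : Set (EuclideanSpace ℝ ι)}

theorem contDiffOn_dd (hΩ : IsOpen Ω) {σ : EuclideanSpace ℝ ι → F} (hσ : ContDiffOn ℝ ∞ σ Ω)
    (k : ι) : ContDiffOn ℝ ∞ (dd k σ) Ω :=
  (hσ.fderiv_of_isOpen hΩ (by simp)).clm_apply contDiffOn_const

theorem contDiffOn_pd (hΩ : IsOpen Ω) {f : EuclideanSpace ℝ ι → ℝ} (hf : ContDiffOn ℝ ∞ f Ω)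
    (k : ι) : ContDiffOn ℝ ∞ (pd k f) Ω := contDiffOn_dd hΩ hf k

theorem differentiableAt_of_contDiffOn {E F : Type*} [NormedAddCommGroup E] [NormedSpace ℝ E]
    [NormedAddCommGroup F] [NormedSpace ℝ F] {Ω : Set E} (hΩ : IsOpen Ω) {σ : E → F}
    (hσ : ContDiffOn ℝ ∞ σ Ω) {y : E} (hy : y ∈ Ω) : DifferentiableAt ℝ σ y :=
  (hσ.contDiffAt (hΩ.mem_nhds hy)).differentiableAt (by simp)

theorem dd_comm (hΩ : IsOpen Ω) {σ : EuclideanSpace ℝ ι → F} (hσ : ContDiffOn ℝ ∞ σ Ω)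
    {y : EuclideanSpace ℝ ι} (hy : y ∈ Ω) (i j : ι) : dd i (dd j σ) y = dd j (dd i σ) y := by
  have hd : DifferentiableAt ℝ (fderiv ℝ σ) y :=
    differentiableAt_of_contDiffOn hΩ (hσ.fderiv_of_isOpen hΩ (by simp)) hy
  have hsym : IsSymmSndFDerivAt ℝ σ y :=
    (hσ.contDiffAt (hΩ.mem_nhds hy)).isSymmSndFDerivAt (by
      simp only [minSmoothness_of_isRCLikeNormedField]
      exact WithTop.coe_le_coe.2 le_top)
  have h : ∀ a b : ι, dd a (dd b σ) y
      = fderiv ℝ (fderiv ℝ σ) y (EuclideanSpace.single a 1) (EuclideanSpace.single b 1) := by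
    intro a b
    unfold dd
    rw [fderiv_clm_apply hd (differentiableAt_const _)]
    simp
  rw [h, h]
  exact hsym _ _

theorem dd_congr_of_eqOn (hΩ : IsOpen Ω) {σ τ : EuclideanSpace ℝ ι → F} (h : EqOn σ τ Ω)
    {y : EuclideanSpace ℝ ι} (hy : y ∈ Ω) (k : ι) : dd k σ y = dd k τ y := by
  unfold dd
  rw [(h.eventuallyEq_of_mem (hΩ.mem_nhds hy)).fderiv_eq]

theorem pd_congr_of_eqOn (hΩ : IsOpen Ω) {f g : EuclideanSpace ℝ ι → ℝ} (h : EqOn f g Ω)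
    {y : EuclideanSpace ℝ ι} (hy : y ∈ Ω) (k : ι) : pd k f y = pd k g y :=
  dd_congr_of_eqOn hΩ h hy k

variable {y : EuclideanSpace ℝ ι} (k : ι)

theorem dd_add {σ τ : EuclideanSpace ℝ ι → F} (hσ : DifferentiableAt ℝ σ y)
    (hτ : DifferentiableAt ℝ τ y) : dd k (fun y => σ y + τ y) y = dd k σ y + dd k τ y := by
  unfold dd; rw [fderiv_fun_add hσ hτ]; simp

theorem dd_sub {σ τ : EuclideanSpace ℝ ι → F} (hσ : DifferentiableAt ℝ σ y)
    (hτ : DifferentiableAt ℝ τ y) : dd k (fun y => σ y - τ y) y = dd k σ y - dd k τ y := by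
  unfold dd; rw [fderiv_fun_sub hσ hτ]; simp

theorem dd_smul {c : EuclideanSpace ℝ ι → ℝ} {σ : EuclideanSpace ℝ ι → F}
    (hc : DifferentiableAt ℝ c y) (hσ : DifferentiableAt ℝ σ y) :
    dd k (fun y => c y • σ y) y = c y • dd k σ y + pd k c y • σ y := by
  unfold dd pd; rw [fderiv_fun_smul hc hσ]; simp

theorem dd_sum {κ : Type*} (s : Finset κ) {σ : κ → EuclideanSpace ℝ ι → F}
    (hσ : ∀ a ∈ s, DifferentiableAt ℝ (σ a) y) :
    dd k (fun y => ∑ a ∈ s, σ a y) y = ∑ a ∈ s, dd k (σ a) y := by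
  unfold dd; rw [fderiv_fun_sum hσ]; simp

theorem dd_const (c : F) : dd k (fun _ : EuclideanSpace ℝ ι => c) y = 0 := by
  unfold dd; simp

theorem pd_add {f g : EuclideanSpace ℝ ι → ℝ} (hf : DifferentiableAt ℝ f y)
    (hg : DifferentiableAt ℝ g y) : pd k (fun y => f y + g y) y = pd k f y + pd k g y :=
  dd_add k hf hg

theorem pd_sub {f g : EuclideanSpace ℝ ι → ℝ} (hf : DifferentiableAt ℝ f y)
    (hg : DifferentiableAt ℝ g y) : pd k (fun y => f y - g y) y = pd k f y - pd k g y :=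
  dd_sub k hf hg

theorem pd_mul {f g : EuclideanSpace ℝ ι → ℝ} (hf : DifferentiableAt ℝ f y)
    (hg : DifferentiableAt ℝ g y) :
    pd k (fun y => f y * g y) y = f y * pd k g y + pd k f y * g y :=
  dd_smul k hf hg

theorem pd_sum {κ : Type*} (s : Finset κ) {f : κ → EuclideanSpace ℝ ι → ℝ}
    (hf : ∀ a ∈ s, DifferentiableAt ℝ (f a) y) :
    pd k (fun y => ∑ a ∈ s, f a y) y = ∑ a ∈ s, pd k (f a) y :=
  dd_sum k s hf

theorem pd_const (c : ℝ) : pd k (fun _ : EuclideanSpace ℝ ι => c) y = 0 := dd_const k c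

theorem pd_inner {V : Type*} [NormedAddCommGroup V] [InnerProductSpace ℝ V]
    {σ τ : EuclideanSpace ℝ ι → V} (hσ : DifferentiableAt ℝ σ y) (hτ : DifferentiableAt ℝ τ y) :
    pd k (fun y => inner ℝ (σ y) (τ y)) y
      = inner ℝ (σ y) (dd k τ y) + inner ℝ (dd k σ y) (τ y) := by
  unfold dd pd; rw [fderiv_inner_apply ℝ hσ hτ]

end Partial

/-! ### Linear total systems in coordinates: existence and uniqueness. -/

section Frobenius

open Set Filter Topology

variable {ι κ : Type} [Fintype ι] [DecidableEq ι] [Fintype κ] [DecidableEq κ]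

theorem contDiffOn_sum_smul_const {E V α : Type*} [NormedAddCommGroup E] [NormedSpace ℝ E]
    [NormedAddCommGroup V] [NormedSpace ℝ V] [Fintype α] {c : α → E → ℝ} {Ω : Set E}
    (hc : ∀ a, ContDiffOn ℝ ∞ (c a) Ω) (T : α → V) :
    ContDiffOn ℝ ∞ (fun x => ∑ a, c a x • T a) Ω :=
  ContDiffOn.sum fun a _ => (hc a).smul contDiffOn_const

theorem fderiv_sum_smul_const {E V α : Type*} [NormedAddCommGroup E] [NormedSpace ℝ E]
    [NormedAddCommGroup V] [NormedSpace ℝ V] [Fintype α] {c : α → E → ℝ} {x : E}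
    (hc : ∀ a, DifferentiableAt ℝ (c a) x) (T : α → V) (w : E) :
    fderiv ℝ (fun x => ∑ a, c a x • T a) x w = ∑ a, fderiv ℝ (c a) x w • T a := by
  have hd : HasFDerivAt (fun x => ∑ a, c a x • T a)
      (∑ a, (fderiv ℝ (c a) x).smulRight (T a)) x :=
    HasFDerivAt.fun_sum fun a _ => (hc a).hasFDerivAt.smul_const _
  rw [hd.fderiv]
  simp [sum_apply]

/-- The elementary tensor `(u, y) ↦ uᵢ yₗ eₖ`. -/
def elemTensor (i : ι) (k l : κ) : EuclideanSpace ℝ ι →L[ℝ] (κ → ℝ) →L[ℝ] (κ → ℝ) :=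
  (EuclideanSpace.proj i : EuclideanSpace ℝ ι →L[ℝ] ℝ).smulRight
    ((ContinuousLinearMap.proj l : (κ → ℝ) →L[ℝ] ℝ).smulRight (Pi.single k 1))

theorem elemTensor_apply (i : ι) (k l : κ) (u : EuclideanSpace ℝ ι) (y : κ → ℝ) (m : κ) :
    elemTensor i k l u y m = if m = k then u i * y l else 0 := by
  simp [elemTensor, Pi.single_apply]

/-- The Frobenius theorem for `∂ᵢ yₖ = ∑ₗ C i k l yₗ`. -/
theorem exists_contDiffOn_total_system_coord {C : ι → κ → κ → EuclideanSpace ℝ ι → ℝ}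
    {Ω : Set (EuclideanSpace ℝ ι)} (hΩ : IsOpen Ω) (hC : ∀ i k l, ContDiffOn ℝ ∞ (C i k l) Ω)
    (hint : ∀ x ∈ Ω, ∀ i j k l, pd j (C i k l) x + ∑ m, C i k m x * C j m l x
      = pd i (C j k l) x + ∑ m, C j k m x * C i m l x)
    {x₀ : EuclideanSpace ℝ ι} (hx₀ : x₀ ∈ Ω) (y₀ : κ → ℝ) :
    ∃ (W : Set (EuclideanSpace ℝ ι)) (y : EuclideanSpace ℝ ι → κ → ℝ), IsOpen W ∧ x₀ ∈ W ∧ W ⊆ Ω ∧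
      (∀ k, ContDiffOn ℝ ∞ (fun x => y x k) W) ∧ y x₀ = y₀ ∧
      ∀ x ∈ W, ∀ i k, pd i (fun x => y x k) x = ∑ l, C i k l x * y x l := by
  set A : EuclideanSpace ℝ ι → EuclideanSpace ℝ ι →L[ℝ] (κ → ℝ) →L[ℝ] (κ → ℝ) :=
    fun x => ∑ a : ι × κ × κ, C a.1 a.2.1 a.2.2 x • elemTensor a.1 a.2.1 a.2.2 with hA
  have hAs : ContDiffOn ℝ ∞ A Ω :=
    contDiffOn_sum_smul_const (fun a : ι × κ × κ => hC a.1 a.2.1 a.2.2) _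
  have hTs : ∀ (d : ι → κ → κ → ℝ) (u : EuclideanSpace ℝ ι) (y : κ → ℝ) (m : κ),
      (∑ a : ι × κ × κ, d a.1 a.2.1 a.2.2 • elemTensor a.1 a.2.1 a.2.2) u y m
        = ∑ i, ∑ l, d i m l * (u i * y l) := by
    intro d u y m
    simp only [sum_apply, Finset.sum_apply, smul_apply,
      Pi.smul_apply, smul_eq_mul, elemTensor_apply, Fintype.sum_prod_type]
    refine Finset.sum_congr rfl fun i _ => ?_
    rw [Finset.sum_comm]
    refine Finset.sum_congr rfl fun l _ => ?_
    simp
  have hAap : ∀ x u y m, A x u y m = ∑ i, ∑ l, C i m l x * (u i * y l) :=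
    fun x u y m => hTs (fun i k l => C i k l x) u y m
  have hAd : ∀ x ∈ Ω, ∀ w u y m, fderiv ℝ A x w u y m
      = ∑ i, ∑ l, (∑ j, w j * pd j (C i m l) x) * (u i * y l) := by
    intro x hx w u y m
    have hd := fderiv_sum_smul_const (c := fun a : ι × κ × κ => C a.1 a.2.1 a.2.2)
      (fun a => differentiableAt_of_contDiffOn hΩ (hC a.1 a.2.1 a.2.2) hx)
      (fun a => elemTensor a.1 a.2.1 a.2.2) w
    refine (congrArg (fun L => L u y m) hd).trans ?_
    refine (hTs (fun i k l => fderiv ℝ (C i k l) x w) u y m).trans ?_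
    refine Finset.sum_congr rfl fun i _ => Finset.sum_congr rfl fun l _ => ?_
    rw [fderiv_eq_sum_dd]
    rfl
  have hint' : ∀ x ∈ Ω, ∀ u v y, fderiv ℝ A x u v y + A x v (A x u y)
      = fderiv ℝ A x v u y + A x u (A x v y) := by
    intro x hx u v y
    have e : ∀ u v : EuclideanSpace ℝ ι, ∀ m, (fderiv ℝ A x u v y + A x v (A x u y)) m
        = ∑ i, ∑ j, ∑ l, v i * u j * y l * (pd j (C i m l) x + ∑ r, C i m r x * C j r l x) := by
      intro u v m
      rw [Pi.add_apply, hAd x hx, hAap, ← Finset.sum_add_distrib]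
      refine Finset.sum_congr rfl fun i _ => ?_
      simp only [hAap, mul_add, Finset.sum_add_distrib]
      congr 1
      · rw [Finset.sum_comm]
        refine Finset.sum_congr rfl fun j _ => ?_
        rw [Finset.sum_mul]
        refine Finset.sum_congr rfl fun l _ => by ring
      · simp only [Finset.mul_sum]
        rw [Finset.sum_comm]
        refine Finset.sum_congr rfl fun j _ => ?_
        rw [Finset.sum_comm]
        refine Finset.sum_congr rfl fun l _ => ?_
        refine Finset.sum_congr rfl fun r _ => by ring
    ext m
    rw [e, e, Finset.sum_comm]
    refine Finset.sum_congr rfl fun i _ => Finset.sum_congr rfl fun j _ =>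
      Finset.sum_congr rfl fun l _ => ?_
    rw [hint x hx]
    ring
  obtain ⟨W, y, hW, hxW, hWΩ, hy, hy0, hyd⟩ :=
    exists_contDiffOn_total_system hΩ hAs hx₀ hint' y₀
  refine ⟨W, y, hW, hxW, hWΩ, fun k => (contDiffOn_pi.1 hy) k, hy0, fun x hx i k => ?_⟩
  have h1 : pd i (fun x => y x k) x = fderiv ℝ y x (EuclideanSpace.single i 1) k := by
    have := (hasFDerivAt_pi'.1 (differentiableAt_of_contDiffOn hW hy hx).hasFDerivAt) k
    unfold pd
    rw [this.fderiv]
    rfl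
  rw [h1, hyd x hx, hAap]
  simp

/-- Solutions of a linear total system on a ball are determined by the value at the centre. -/
theorem eq_zero_of_total_system {C : ι → κ → κ → EuclideanSpace ℝ ι → ℝ}
    {x₀ : EuclideanSpace ℝ ι} {r : ℝ} (hC : ∀ i k l, ContinuousOn (C i k l) (Metric.ball x₀ r))
    {y : EuclideanSpace ℝ ι → κ → ℝ}
    (hy : ∀ k, ContDiffOn ℝ ∞ (fun x => y x k) (Metric.ball x₀ r)) (hy₀ : y x₀ = 0)
    (hyd : ∀ x ∈ Metric.ball x₀ r, ∀ i k, pd i (fun x => y x k) x = ∑ l, C i k l x * y x l)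
    {x : EuclideanSpace ℝ ι} (hx : x ∈ Metric.ball x₀ r) : y x = 0 := by
  set p := x - x₀ with hp
  set c : ℝ → EuclideanSpace ℝ ι := fun s => x₀ + s • p with hc
  have hmem : ∀ s ∈ Icc (0 : ℝ) 1, c s ∈ Metric.ball x₀ r := by
    intro s hs
    rw [mem_ball_iff_norm, hc, add_sub_cancel_left, norm_smul, Real.norm_of_nonneg hs.1]
    exact (mul_le_of_le_one_left (norm_nonneg _) hs.2).trans_lt (mem_ball_iff_norm.1 hx)
  have hcd : ∀ s, HasDerivAt c p s := by
    intro s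
    simpa [hc] using (((hasDerivAt_id s).smul_const p).const_add x₀)
  -- Restricted to the ray from `x₀` to `x`, the system is a linear ordinary differential equation
  -- with bounded coefficients and zero initial value.
  have hyc : ∀ s ∈ Icc (0 : ℝ) 1, HasDerivAt (fun s => y (c s))
      (fun k => ∑ l, (∑ i, p i * C i k l (c s)) * y (c s) l) s := by
    intro s hs
    rw [hasDerivAt_pi]
    intro k
    have hd := differentiableAt_of_contDiffOn Metric.isOpen_ball (hy k) (hmem s hs)
    have h1 := hd.hasFDerivAt.comp_hasDerivAt s (hcd s)
    refine h1.congr_deriv ?_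
    rw [fderiv_eq_sum_dd]
    simp only [smul_eq_mul, ← pd_eq_dd, hyd _ (hmem s hs), Finset.mul_sum, Finset.sum_mul]
    rw [Finset.sum_comm]
    exact Finset.sum_congr rfl fun _ _ => Finset.sum_congr rfl fun _ _ => by ring
  have hcont : ∀ k l, ContinuousOn (fun s => ∑ i, p i * C i k l (c s)) (Icc 0 1) := by
    intro k l
    refine continuousOn_finsetSum _ fun i _ => continuousOn_const.mul ?_
    exact (hC i k l).comp (fun s _ => (hcd s).continuousAt.continuousWithinAt) hmem
  have hbd : ∀ k l, ∃ B, ∀ s ∈ Icc (0 : ℝ) 1, ‖∑ i, p i * C i k l (c s)‖ ≤ B := fun k l =>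
    isCompact_Icc.exists_bound_of_continuousOn (hcont k l)
  choose B hB using hbd
  have hBn : ∀ k l, 0 ≤ B k l := fun k l =>
    (norm_nonneg _).trans (hB k l 0 (left_mem_Icc.2 zero_le_one))
  have h0 := eq_zero_of_abs_deriv_le_mul_abs_self_of_eq_zero_right (K := ∑ k, ∑ l, B k l)
    (fun s hs => (hyc s hs).continuousAt.continuousWithinAt)
    (fun s hs => (hyc s (Ico_subset_Icc_self hs)).hasDerivWithinAt)
    (by simp [hc, hy₀])
    (fun s hs => by
      have hs' := Ico_subset_Icc_self hs
      rw [pi_norm_le_iff_of_nonneg (mul_nonneg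
        (Finset.sum_nonneg fun k _ => Finset.sum_nonneg fun l _ => hBn k l) (norm_nonneg _))]
      intro k
      calc ‖∑ l, (∑ i, p i * C i k l (c s)) * y (c s) l‖
          ≤ ∑ l, B k l * ‖y (c s)‖ := by
            refine (norm_sum_le _ _).trans (Finset.sum_le_sum fun l _ => ?_)
            rw [norm_mul]
            exact mul_le_mul (hB k l s hs') (norm_le_pi_norm _ l) (norm_nonneg _) (hBn k l)
        _ = (∑ l, B k l) * ‖y (c s)‖ := by rw [Finset.sum_mul]
        _ ≤ (∑ k, ∑ l, B k l) * ‖y (c s)‖ := by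
            refine mul_le_mul_of_nonneg_right ?_ (norm_nonneg _)
            exact Finset.single_le_sum (f := fun k => ∑ l, B k l)
              (fun k _ => Finset.sum_nonneg fun l _ => hBn k l) (Finset.mem_univ k))
    1 (right_mem_Icc.2 zero_le_one)
  simpa [hc, hp] using h0

end Frobenius

/-! ### Christoffel symbols and flat coordinates. -/

section FlatCoordinates

open Set Filter Topology

variable {ι : Type} [Fintype ι] [DecidableEq ι]

theorem contDiffOn_det {E : Type*} [NormedAddCommGroup E] [NormedSpace ℝ E] {Ω : Set E}
    {A : E → Matrix ι ι ℝ} (hA : ∀ i j, ContDiffOn ℝ ∞ (fun y => A y i j) Ω) :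
    ContDiffOn ℝ ∞ (fun y => (A y).det) Ω := by
  simp only [Matrix.det_apply]
  refine ContDiffOn.sum fun σ _ => ?_
  refine ContDiffOn.const_smul _ ?_
  exact contDiffOn_prod fun i _ => hA _ _

theorem contDiffOn_inv {E : Type*} [NormedAddCommGroup E] [NormedSpace ℝ E] {Ω : Set E}
    {A : E → Matrix ι ι ℝ} (hA : ∀ i j, ContDiffOn ℝ ∞ (fun y => A y i j) Ω)
    (hdet : ∀ y ∈ Ω, (A y).det ≠ 0) (i j : ι) : ContDiffOn ℝ ∞ (fun y => (A y)⁻¹ i j) Ω := by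
  have h : (fun y => (A y)⁻¹ i j) = fun y => ((A y).det)⁻¹ * (A y).adjugate i j := by
    ext y
    rw [Matrix.inv_def, Ring.inverse_eq_inv']
    simp
  rw [h]
  refine ((contDiffOn_det hA).inv hdet).mul ?_
  simp only [Matrix.adjugate_apply]
  refine contDiffOn_det fun a b => ?_
  by_cases hab : a = j
  · subst hab
    simp only [Matrix.updateRow_self]
    exact contDiffOn_const
  · simp only [Matrix.updateRow_ne hab]
    exact hA a b

variable {G : EuclideanSpace ℝ ι → Matrix ι ι ℝ} {Ω : Set (EuclideanSpace ℝ ι)}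

theorem contDiffOn_christoffel (hΩ : IsOpen Ω) (hG : ∀ i j, ContDiffOn ℝ ∞ (fun y => G y i j) Ω)
    (hdet : ∀ y ∈ Ω, (G y).det ≠ 0) (k i j : ι) : ContDiffOn ℝ ∞ (christoffel G k i j) Ω := by
  unfold christoffel
  refine contDiffOn_const.mul (ContDiffOn.sum fun l _ => (contDiffOn_inv hG hdet k l).mul ?_)
  exact ((contDiffOn_pd hΩ (hG j l) i).add (contDiffOn_pd hΩ (hG i l) j)).sub
    (contDiffOn_pd hΩ (hG i j) l)

theorem christoffel_symm {y : EuclideanSpace ℝ ι} (hsym : ∀ᶠ z in 𝓝 y, ∀ i j, G z i j = G z j i)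
    (k i j : ι) : christoffel G k i j y = christoffel G k j i y := by
  unfold christoffel
  congr 1
  refine Finset.sum_congr rfl fun l _ => ?_
  have : pd l (fun z => G z i j) y = pd l (fun z => G z j i) y := by
    unfold pd
    rw [Filter.EventuallyEq.fderiv_eq (hsym.mono fun z hz => hz i j)]
  rw [this]
  ring

theorem sum_metric_mul_christoffel {y : EuclideanSpace ℝ ι} (hdet : (G y).det ≠ 0) (m i j : ι) :
    ∑ k, G y m k * christoffel G k i j y = (1 / 2 : ℝ) *
      (pd i (fun z => G z j m) y + pd j (fun z => G z i m) y - pd m (fun z => G z i j) y) := by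
  have hu : IsUnit (G y).det := isUnit_iff_ne_zero.2 hdet
  have h : ∀ l, ∑ k, G y m k * (G y)⁻¹ k l = (1 : Matrix ι ι ℝ) m l := by
    intro l
    rw [← Matrix.mul_nonsing_inv (G y) hu, Matrix.mul_apply]
  unfold christoffel
  calc ∑ k, G y m k * ((1 / 2 : ℝ) * ∑ l, (G y)⁻¹ k l * (pd i (fun z => G z j l) y
        + pd j (fun z => G z i l) y - pd l (fun z => G z i j) y))
      = (1 / 2 : ℝ) * ∑ l, (∑ k, G y m k * (G y)⁻¹ k l) * (pd i (fun z => G z j l) y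
        + pd j (fun z => G z i l) y - pd l (fun z => G z i j) y) := by
        simp only [Finset.mul_sum, Finset.sum_mul]
        rw [Finset.sum_comm]
        exact Finset.sum_congr rfl fun _ _ => Finset.sum_congr rfl fun _ _ => by ring
    _ = _ := by
        simp only [h, Matrix.one_apply]
        simp

/-- Metric compatibility of the Levi-Civita connection. -/
theorem pd_metric {y : EuclideanSpace ℝ ι} (hsym : ∀ᶠ z in 𝓝 y, ∀ i j, G z i j = G z j i)
    (hdet : (G y).det ≠ 0) (l i j : ι) :
    pd l (fun z => G z i j) y
      = ∑ k, (christoffel G k l i y * G y k j + christoffel G k l j y * G y i k) := by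
  have hpd : ∀ a b c, pd a (fun z => G z b c) y = pd a (fun z => G z c b) y := by
    intro a b c
    unfold pd
    rw [Filter.EventuallyEq.fderiv_eq (hsym.mono fun z hz => hz b c)]
  have hs : ∀ i j, G y i j = G y j i := hsym.self_of_nhds
  have h1 := sum_metric_mul_christoffel hdet j l i
  have h2 := sum_metric_mul_christoffel hdet i l j
  have e : ∑ k, (christoffel G k l i y * G y k j + christoffel G k l j y * G y i k)
      = ∑ k, G y j k * christoffel G k l i y + ∑ k, G y i k * christoffel G k l j y := by
    rw [← Finset.sum_add_distrib]
    refine Finset.sum_congr rfl fun k _ => ?_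
    rw [hs k j]
    ring
  rw [e, h1, h2, hpd i l j, hpd j l i, hpd l j i, hpd i j l]
  ring

theorem riemannUp_eq_zero {y : EuclideanSpace ℝ ι} (hdet : (G y).det ≠ 0) {a b c : ι}
    (h : ∀ d, riemann G a b c d y = 0) (d : ι) : riemannUp G d a b c y = 0 := by
  have h1 : (G y).mulVec (fun e => riemannUp G e a b c y) = 0 := by
    ext d
    exact h d
  exact congrFun (Matrix.eq_zero_of_mulVec_eq_zero hdet h1) d

/-- The coefficients of the total system for flat coordinates: the unknowns are a function and its
partial derivatives. -/
def flatSystem (G : EuclideanSpace ℝ ι → Matrix ι ι ℝ) (i : ι) :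
    Option ι → Option ι → EuclideanSpace ℝ ι → ℝ
  | none, some k => fun _ => if k = i then 1 else 0
  | some j, some k => christoffel G k i j
  | _, none => fun _ => 0

/-- A Riemannian metric with vanishing curvature is locally the pull-back of the Euclidean one. -/
theorem exists_flat_coordinates (hΩ : IsOpen Ω)
    (hG : ∀ i j, ContDiffOn ℝ ∞ (fun y => G y i j) Ω) (hpos : ∀ y ∈ Ω, (G y).PosDef)
    (hflat : ∀ y ∈ Ω, ∀ a b c d, riemann G a b c d y = 0)
    {y₀ : EuclideanSpace ℝ ι} (hy₀ : y₀ ∈ Ω) :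
    ∃ (W : Set (EuclideanSpace ℝ ι)) (ψ : EuclideanSpace ℝ ι → EuclideanSpace ℝ ι), IsOpen W ∧
      y₀ ∈ W ∧ W ⊆ Ω ∧ ContDiffOn ℝ ∞ ψ W ∧
      ∀ y ∈ W, ∀ i j, inner ℝ (dd i ψ y) (dd j ψ y) = G y i j := by
  have hdet : ∀ y ∈ Ω, (G y).det ≠ 0 := fun y hy => (hpos y hy).det_pos.ne'
  have hs : ∀ y ∈ Ω, ∀ i j, G y i j = G y j i := by
    intro y hy i j
    have := (hpos y hy).isHermitian.apply i j
    simpa using this.symm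
  have hsym : ∀ y ∈ Ω, ∀ᶠ z in 𝓝 y, ∀ i j, G z i j = G z j i := fun y hy =>
    Filter.mem_of_superset (hΩ.mem_nhds hy) hs
  have hΓ := contDiffOn_christoffel hΩ hG hdet
  have hC : ∀ i k l, ContDiffOn ℝ ∞ (flatSystem G i k l) Ω := by
    rintro i (_ | k) (_ | l)
    exacts [contDiffOn_const, contDiffOn_const, contDiffOn_const, hΓ _ _ _]
  -- The system says that a function has vanishing covariant Hessian. Integrability for the function
  -- itself is the symmetry of the Christoffel symbols; for its differential it is the vanishing of
  -- the curvature.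
  have hint : ∀ x ∈ Ω, ∀ i j k l, pd j (flatSystem G i k l) x
        + ∑ m, flatSystem G i k m x * flatSystem G j m l x
      = pd i (flatSystem G j k l) x + ∑ m, flatSystem G j k m x * flatSystem G i m l x := by
    rintro x hx i j (_ | k) (_ | l)
    · simp [flatSystem, pd_const]
    · simp [flatSystem, Fintype.sum_option, pd_const]
      exact christoffel_symm (hsym x hx) _ _ _
    · simp [flatSystem, pd_const]
    · have h := riemannUp_eq_zero (hdet x hx) (hflat x hx i j k) l
      simp only [riemannUp, Finset.sum_sub_distrib] at h
      simp only [flatSystem, Fintype.sum_option, zero_mul, zero_add]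
      linarith
  -- The rows of `B` form an orthonormal coframe at `y₀`; they are the initial differentials of the
  -- coordinate functions.
  obtain ⟨B, hB⟩ : ∃ B : Matrix ι ι ℝ, G y₀ = star B * B := by
    open scoped MatrixOrder Matrix.Norms.L2Operator in
    exact CStarAlgebra.nonneg_iff_eq_star_mul_self.1 (hpos y₀ hy₀).posSemidef.nonneg
  have hsol := fun a : ι => exists_contDiffOn_total_system_coord hΩ hC hint hy₀
    (fun o : Option ι => o.elim 0 (fun j => B a j))
  choose W y hWo hyW hWΩ hys hy0 hyd using hsol
  have hWopen : IsOpen (⋂ a, W a) := isOpen_iInter_of_finite hWo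
  obtain ⟨r, hr, hball⟩ := Metric.isOpen_iff.1 (hWopen.inter hΩ) y₀ ⟨mem_iInter.2 hyW, hy₀⟩
  have hbW : ∀ a, Metric.ball y₀ r ⊆ W a := fun a x hx => mem_iInter.1 (hball hx).1 a
  have hbΩ : Metric.ball y₀ r ⊆ Ω := fun x hx => (hball hx).2
  have hyb : ∀ a k, ContDiffOn ℝ ∞ (fun x => y a x k) (Metric.ball y₀ r) :=
    fun a k => (hys a k).mono (hbW a)
  have hω : ∀ a, ∀ x ∈ Metric.ball y₀ r, ∀ i, pd i (fun x => y a x none) x = y a x (some i) := by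
    intro a x hx i
    rw [hyd a x (hbW a hx)]
    simp [flatSystem, Fintype.sum_option]
  have hωd : ∀ a, ∀ x ∈ Metric.ball y₀ r, ∀ i j, pd i (fun x => y a x (some j)) x
      = ∑ k, christoffel G k i j x * y a x (some k) := by
    intro a x hx i j
    rw [hyd a x (hbW a hx)]
    simp [flatSystem, Fintype.sum_option]
  -- Both `∑ₐ dyₐ ⊗ dyₐ` and the metric are parallel, so their difference `D` solves a linear total
  -- system. It vanishes at `y₀` by the choice of `B`, hence on the ball.
  set D : EuclideanSpace ℝ ι → ι × ι → ℝ :=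
    fun x p => ∑ a, y a x (some p.1) * y a x (some p.2) - G x p.1 p.2 with hD
  have hD0 : ∀ x ∈ Metric.ball y₀ r, D x = 0 := by
    intro x hx
    refine eq_zero_of_total_system (r := r) (x₀ := y₀)
      (C := fun l p q => fun x => christoffel G q.1 l p.1 x * (if q.2 = p.2 then 1 else 0)
        + christoffel G q.2 l p.2 x * (if q.1 = p.1 then 1 else 0)) ?_ ?_ ?_ ?_ hx
    · intro l p q
      exact ((((hΓ _ _ _).continuousOn.mono hbΩ).mul continuousOn_const).add
        (((hΓ _ _ _).continuousOn.mono hbΩ).mul continuousOn_const))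
    · intro p
      exact (ContDiffOn.sum fun a _ => (hyb a _).mul (hyb a _)).sub ((hG _ _).mono hbΩ)
    · ext p
      have := congrFun (congrFun hB p.1) p.2
      simp only [hD, hy0, this, Matrix.mul_apply]
      simp
    · rintro x hx l ⟨i, j⟩
      have hd : ∀ a k, DifferentiableAt ℝ (fun x => y a x k) x := fun a k =>
        differentiableAt_of_contDiffOn Metric.isOpen_ball (hyb a k) hx
      have hGd := differentiableAt_of_contDiffOn hΩ (hG i j) (hbΩ hx)
      simp only [hD]
      have hm : ∀ a, DifferentiableAt ℝ (fun x => y a x (some i) * y a x (some j)) x :=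
        fun a => (hd a _).mul (hd a _)
      rw [pd_sub l (DifferentiableAt.fun_sum fun a _ => hm a) hGd, pd_sum l _ (fun a _ => hm a),
        pd_metric (hsym x (hbΩ hx)) (hdet x (hbΩ hx))]
      simp only [fun a => pd_mul l (hd a (some i)) (hd a (some j)), hωd _ x hx,
        Fintype.sum_prod_type]
      have e1 : ∑ k, ∑ m, (christoffel G k l i x * (if m = j then 1 else 0)
          + christoffel G m l j x * (if k = i then 1 else 0)) *
          (∑ a, y a x (some k) * y a x (some m) - G x k m)
          = ∑ k, christoffel G k l i x * (∑ a, y a x (some k) * y a x (some j) - G x k j)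
          + ∑ m, christoffel G m l j x * (∑ a, y a x (some i) * y a x (some m) - G x i m) := by
        simp only [add_mul, Finset.sum_add_distrib]
        congr 1
        · refine Finset.sum_congr rfl fun k _ => ?_
          simp
        · rw [Finset.sum_comm]
          refine Finset.sum_congr rfl fun m _ => ?_
          simp
      rw [e1]
      simp only [mul_sub, Finset.sum_sub_distrib, Finset.sum_add_distrib, Finset.mul_sum,
        Finset.sum_mul]
      rw [Finset.sum_comm (γ := ι), Finset.sum_comm (γ := ι) (f := fun a k =>
        christoffel G k l i x * y a x (some k) * y a x (some j))]
      have e2 : ∀ k a, y a x (some i) * (christoffel G k l j x * y a x (some k))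
          = christoffel G k l j x * (y a x (some i) * y a x (some k)) := fun k a => by ring
      have e3 : ∀ k a, christoffel G k l i x * y a x (some k) * y a x (some j)
          = christoffel G k l i x * (y a x (some k) * y a x (some j)) := fun k a => by ring
      simp only [e2, e3]
      ring
  refine ⟨Metric.ball y₀ r, fun x => WithLp.toLp 2 (fun a => y a x none), Metric.isOpen_ball,
    Metric.mem_ball_self hr, hbΩ, ?_, ?_⟩
  · exact contDiffOn_euclidean.2 fun a => hyb a none
  · intro x hx i j
    have hdd : ∀ k a, dd k (fun x => WithLp.toLp 2 (fun a => y a x none) :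
        EuclideanSpace ℝ ι → EuclideanSpace ℝ ι) x a = y a x (some k) := by
      intro k a
      rw [← hω a x hx k]
      have hdiff : DifferentiableAt ℝ (fun x => WithLp.toLp 2 (fun a => y a x none) :
          EuclideanSpace ℝ ι → EuclideanSpace ℝ ι) x :=
        differentiableAt_of_contDiffOn Metric.isOpen_ball
          (contDiffOn_euclidean.2 fun a => hyb a none) hx
      have h1 := ((EuclideanSpace.proj a : EuclideanSpace ℝ ι →L[ℝ] ℝ).hasFDerivAt).comp x
        hdiff.hasFDerivAt
      unfold pd dd
      exact (congrArg (fun L => L (EuclideanSpace.single k 1)) h1.fderiv).symm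
    have h := congrFun (hD0 x hx) (i, j)
    simp only [hD, Pi.zero_apply, sub_eq_zero] at h
    rw [← h, PiLp.inner_apply]
    simp only [hdd]
    exact Finset.sum_congr rfl fun a _ => by simp [mul_comm]

end FlatCoordinates

/-! ### Gauss formula and Gauss equation for umbilic maps into a conformally flat space. -/

section Gauss

open Set Filter Topology

variable {ι : Type} [Fintype ι] [DecidableEq ι]
  {V : Type*} [NormedAddCommGroup V] [InnerProductSpace ℝ V]

/-- A map `σ` into a Euclidean space `V`, along which a conformal factor `q` with gradient `g` and
a field `ν` are given, such that `σ` is totally umbilic with unit normal `ν` and principal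
curvature `c` for the metric `q⁻²⟨·,·⟩`; for `ν = 0` and `c = 0` a local diffeomorphism. The
induced metric is `G`. -/
structure IsUmbilic (Ω : Set (EuclideanSpace ℝ ι)) (σ g ν : EuclideanSpace ℝ ι → V)
    (q : EuclideanSpace ℝ ι → ℝ) (c : ℝ) (G : EuclideanSpace ℝ ι → Matrix ι ι ℝ) : Prop where
  isOpen : IsOpen Ω
  smooth : ContDiffOn ℝ ∞ σ Ω
  smooth_grad : ContDiffOn ℝ ∞ g Ω
  smooth_normal : ContDiffOn ℝ ∞ ν Ω
  smooth_factor : ContDiffOn ℝ ∞ q Ω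
  factor_ne : ∀ y ∈ Ω, q y ≠ 0
  pd_factor : ∀ y ∈ Ω, ∀ i, pd i q y = inner ℝ (g y) (dd i σ y)
  metric : ∀ y ∈ Ω, ∀ i j, G y i j = inner ℝ (dd i σ y) (dd j σ y) / q y ^ 2
  det_ne : ∀ y ∈ Ω, (G y).det ≠ 0
  normal : ∀ y ∈ Ω, ∀ i, inner ℝ (ν y) (dd i σ y) = 0
  normal_unit : ∀ y ∈ Ω, c * inner ℝ (ν y) (ν y) = c * q y ^ 2
  dd_normal : ∀ y ∈ Ω, ∀ i, dd i ν y = (-c) • dd i σ y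
    + (q y)⁻¹ • (pd i q y • ν y + (inner ℝ (g y) (ν y) : ℝ) • dd i σ y)
  span : ∀ y ∈ Ω, ∀ Z, (∀ i, inner ℝ Z (dd i σ y) = 0) → inner ℝ Z (ν y) = 0 → Z = 0

namespace IsUmbilic

variable {Ω : Set (EuclideanSpace ℝ ι)} {σ g ν : EuclideanSpace ℝ ι → V}
  {q : EuclideanSpace ℝ ι → ℝ} {c : ℝ} {G : EuclideanSpace ℝ ι → Matrix ι ι ℝ}
  (H : IsUmbilic Ω σ g ν q c G)

include H

theorem pd_inner_dd {y : EuclideanSpace ℝ ι} (hy : y ∈ Ω) (l i j : ι) :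
    pd l (fun y => inner ℝ (dd i σ y) (dd j σ y)) y
      = inner ℝ (dd l (dd i σ) y) (dd j σ y) + inner ℝ (dd l (dd j σ) y) (dd i σ y) := by
  have hd : ∀ i, DifferentiableAt ℝ (dd i σ) y := fun i =>
    differentiableAt_of_contDiffOn H.isOpen (contDiffOn_dd H.isOpen H.smooth i) hy
  rw [pd_inner l (hd i) (hd j), add_comm, real_inner_comm (dd i σ y)]

theorem pd_metric_eq {y : EuclideanSpace ℝ ι} (hy : y ∈ Ω) (l i j : ι) :
    pd l (fun y => G y i j) y
      = (inner ℝ (dd l (dd i σ) y) (dd j σ y) + inner ℝ (dd l (dd j σ) y) (dd i σ y)) / q y ^ 2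
        - 2 * pd l q y * inner ℝ (dd i σ y) (dd j σ y) / q y ^ 3 := by
  have hd : ∀ i, DifferentiableAt ℝ (dd i σ) y := fun i =>
    differentiableAt_of_contDiffOn H.isOpen (contDiffOn_dd H.isOpen H.smooth i) hy
  have hq := differentiableAt_of_contDiffOn H.isOpen H.smooth_factor hy
  have hin : DifferentiableAt ℝ (fun y => (inner ℝ (dd i σ y) (dd j σ y) : ℝ)) y :=
    (hd i).inner ℝ (hd j)
  have h0 := H.factor_ne y hy
  have hEq : EqOn (fun y => G y i j * (q y * q y)) (fun y => inner ℝ (dd i σ y) (dd j σ y)) Ω := by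
    intro z hz
    have := H.factor_ne z hz
    simp only [H.metric z hz]
    field_simp
  have hGd : DifferentiableAt ℝ (fun y => G y i j) y := by
    have hev : (fun y => G y i j) =ᶠ[𝓝 y]
        fun y => (inner ℝ (dd i σ y) (dd j σ y) : ℝ) / q y ^ 2 := by
      filter_upwards [H.isOpen.mem_nhds hy] with z hz using H.metric z hz i j
    have hq2 : DifferentiableAt ℝ (fun y => q y ^ 2) y := hq.pow 2
    have hdiv : DifferentiableAt ℝ (fun y => (inner ℝ (dd i σ y) (dd j σ y) : ℝ) / q y ^ 2) y := by
      simp only [div_eq_mul_inv]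
      exact hin.mul (hq2.inv (pow_ne_zero 2 h0))
    exact hdiv.congr_of_eventuallyEq hev
  have h1 := pd_congr_of_eqOn H.isOpen hEq hy l
  have hqq : DifferentiableAt ℝ (fun y => q y * q y) y := hq.mul hq
  rw [pd_mul l hGd hqq, pd_mul l hq hq, H.pd_inner_dd hy, H.metric y hy] at h1
  rw [← h1]
  field_simp
  ring

/-- The Gauss formula. -/
theorem dd_dd {y : EuclideanSpace ℝ ι} (hy : y ∈ Ω) (i j : ι) :
    dd i (dd j σ) y = ∑ k, christoffel G k i j y • dd k σ y + (c * G y i j) • ν y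
      + (q y)⁻¹ • (pd i q y • dd j σ y + pd j q y • dd i σ y
        - (inner ℝ (dd i σ y) (dd j σ y) : ℝ) • g y) := by
  have h0 := H.factor_ne y hy
  have hd : ∀ i, DifferentiableAt ℝ (dd i σ) y := fun i =>
    differentiableAt_of_contDiffOn H.isOpen (contDiffOn_dd H.isOpen H.smooth i) hy
  have hνd := differentiableAt_of_contDiffOn H.isOpen H.smooth_normal hy
  have hcomm : ∀ i j, dd i (dd j σ) y = dd j (dd i σ) y := dd_comm H.isOpen H.smooth hy
  have hsymm : ∀ a b, (inner ℝ (dd a σ y) (dd b σ y) : ℝ) = inner ℝ (dd b σ y) (dd a σ y) :=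
    fun a b => real_inner_comm _ _
  rw [← sub_eq_zero]
  -- The two sides are compared against the tangent vectors and against `ν`. The tangential part is
  -- the Koszul formula for the induced metric; the normal part comes from differentiating `⟨ν, ∂ⱼσ⟩
  -- = 0`.
  refine H.span y hy _ (fun m => ?_) ?_
  · have hΓ := sum_metric_mul_christoffel (H.det_ne y hy) m i j
    have e1 : ∑ k, christoffel G k i j y * inner ℝ (dd k σ y) (dd m σ y)
        = q y ^ 2 * ∑ k, G y m k * christoffel G k i j y := by
      rw [Finset.mul_sum]
      refine Finset.sum_congr rfl fun k _ => ?_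
      rw [H.metric y hy, hsymm k m]
      field_simp
    simp only [inner_sub_left, inner_add_left, sum_inner, real_inner_smul_left, H.normal y hy,
      ← H.pd_factor y hy]
    rw [e1, hΓ, H.pd_metric_eq hy, H.pd_metric_eq hy, H.pd_metric_eq hy, hcomm m i, hcomm m j,
      hcomm j i, hsymm i m, hsymm j m, hsymm i j]
    field_simp
    ring
  · have h1 : EqOn (fun y => (inner ℝ (ν y) (dd j σ y) : ℝ)) (fun _ => 0) Ω :=
      fun z hz => H.normal z hz j
    have h2 := pd_congr_of_eqOn H.isOpen h1 hy i
    rw [pd_inner i hνd (hd j), pd_const, H.dd_normal y hy] at h2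
    -- Only `c |ν|² = c q²` is needed here, a form that also holds in the degenerate case `ν = 0`,
    -- `c = 0`.
    have h3 := H.normal_unit y hy
    have hn : ∀ a, (inner ℝ (dd a σ y) (ν y) : ℝ) = 0 := fun a => by
      rw [real_inner_comm]; exact H.normal y hy a
    simp only [inner_add_left, real_inner_smul_left, H.normal y hy] at h2
    simp only [inner_sub_left, inner_add_left, sum_inner, real_inner_smul_left, hn]
    rw [real_inner_comm (ν y), H.metric y hy]
    have h4 : c * (inner ℝ (dd i σ y) (dd j σ y) / q y ^ 2) * inner ℝ (ν y) (ν y)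
        = c * inner ℝ (dd i σ y) (dd j σ y) := by
      calc _ = (c * inner ℝ (ν y) (ν y)) * (inner ℝ (dd i σ y) (dd j σ y) / q y ^ 2) := by ring
        _ = _ := by rw [h3]; field_simp
    rw [h4]
    simp only [mul_zero, Finset.sum_const_zero]
    linear_combination h2

/-- The Gauss equation for a totally umbilic map into a conformally flat space. -/
theorem riemann_eq {y : EuclideanSpace ℝ ι} (hy : y ∈ Ω) (i l j m : ι) :
    riemann G i l j m y = (q y * (inner ℝ (dd i g y) (dd j σ y) * inner ℝ (dd l σ y) (dd m σ y)
        + inner ℝ (dd l g y) (dd m σ y) * inner ℝ (dd i σ y) (dd j σ y)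
        - inner ℝ (dd i g y) (dd m σ y) * inner ℝ (dd l σ y) (dd j σ y)
        - inner ℝ (dd l g y) (dd j σ y) * inner ℝ (dd i σ y) (dd m σ y))
      - inner ℝ (g y) (g y) * (inner ℝ (dd i σ y) (dd j σ y) * inner ℝ (dd l σ y) (dd m σ y)
        - inner ℝ (dd i σ y) (dd m σ y) * inner ℝ (dd l σ y) (dd j σ y))) / q y ^ 4
      + c ^ 2 * (G y i j * G y l m - G y l j * G y i m) := by
  have h0 := H.factor_ne y hy
  have hds : ∀ i, ContDiffOn ℝ ∞ (dd i σ) Ω := contDiffOn_dd H.isOpen H.smooth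
  have hd : ∀ i, DifferentiableAt ℝ (dd i σ) y := fun i =>
    differentiableAt_of_contDiffOn H.isOpen (hds i) hy
  have hνd := differentiableAt_of_contDiffOn H.isOpen H.smooth_normal hy
  have hgd := differentiableAt_of_contDiffOn H.isOpen H.smooth_grad hy
  have hqd := differentiableAt_of_contDiffOn H.isOpen H.smooth_factor hy
  have hpqd : ∀ i, DifferentiableAt ℝ (pd i q) y := fun i =>
    differentiableAt_of_contDiffOn H.isOpen (contDiffOn_pd H.isOpen H.smooth_factor i) hy
  have hGs : ∀ i j, ContDiffOn ℝ ∞ (fun y => G y i j) Ω := by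
    intro i j
    have h1 : ContDiffOn ℝ ∞ (fun y => (inner ℝ (dd i σ y) (dd j σ y) : ℝ) / q y ^ 2) Ω :=
      ((hds i).inner ℝ (hds j)).div (H.smooth_factor.pow 2)
        (fun y hy => pow_ne_zero 2 (H.factor_ne y hy))
    exact h1.congr fun z hz => H.metric z hz i j
  have hGd : ∀ i j, DifferentiableAt ℝ (fun y => G y i j) y := fun i j =>
    differentiableAt_of_contDiffOn H.isOpen (hGs i j) hy
  have hΓd : ∀ k i j, DifferentiableAt ℝ (christoffel G k i j) y := fun k i j =>
    differentiableAt_of_contDiffOn H.isOpen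
      (contDiffOn_christoffel H.isOpen hGs H.det_ne k i j) hy
  have hin : ∀ i j, DifferentiableAt ℝ (fun y => (inner ℝ (dd i σ y) (dd j σ y) : ℝ)) y :=
    fun i j => (hd i).inner ℝ (hd j)
  have hcomm : ∀ i j, dd i (dd j σ) y = dd j (dd i σ) y := dd_comm H.isOpen H.smooth hy
  have hsymm : ∀ a b, (inner ℝ (dd a σ y) (dd b σ y) : ℝ) = inner ℝ (dd b σ y) (dd a σ y) :=
    fun a b => real_inner_comm _ _
  -- The derivative of the Gauss formula.
  have hthird : ∀ l i j, inner ℝ (dd l (dd i (dd j σ)) y) (dd m σ y)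
      = ∑ k, (christoffel G k i j y * inner ℝ (dd l (dd k σ) y) (dd m σ y)
          + pd l (christoffel G k i j) y * inner ℝ (dd k σ y) (dd m σ y))
        + c * G y i j * inner ℝ (dd l ν y) (dd m σ y)
        + (q y)⁻¹ * (pd l (pd i q) y * inner ℝ (dd j σ y) (dd m σ y)
            + pd i q y * inner ℝ (dd l (dd j σ) y) (dd m σ y)
            + pd l (pd j q) y * inner ℝ (dd i σ y) (dd m σ y)
            + pd j q y * inner ℝ (dd l (dd i σ) y) (dd m σ y)
            - (inner ℝ (dd l (dd i σ) y) (dd j σ y) + inner ℝ (dd l (dd j σ) y) (dd i σ y))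
              * pd m q y
            - inner ℝ (dd i σ y) (dd j σ y) * inner ℝ (dd l g y) (dd m σ y))
        - pd l q y / q y ^ 2 * (pd i q y * inner ℝ (dd j σ y) (dd m σ y)
            + pd j q y * inner ℝ (dd i σ y) (dd m σ y)
            - inner ℝ (dd i σ y) (dd j σ y) * pd m q y) := by
    intro l i j
    have hB : DifferentiableAt ℝ (fun y => pd i q y • dd j σ y + pd j q y • dd i σ y
        - (inner ℝ (dd i σ y) (dd j σ y) : ℝ) • g y) y :=
      (((hpqd i).smul (hd j)).add ((hpqd j).smul (hd i))).sub ((hin i j).smul hgd)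
    have hqi : DifferentiableAt ℝ (fun y => (q y)⁻¹) y := hqd.inv h0
    have hpqi : pd l (fun y => (q y)⁻¹) y = - pd l q y / q y ^ 2 := by
      have h1 : HasFDerivAt (fun y => (q y)⁻¹) ((-(q y ^ 2)⁻¹) • fderiv ℝ q y) y :=
        (hasDerivAt_inv h0).comp_hasFDerivAt y hqd.hasFDerivAt
      unfold pd
      rw [h1.fderiv, smul_apply, smul_eq_mul]
      ring
    have hcG : DifferentiableAt ℝ (fun y => c * G y i j) y := (hGd i j).const_mul c
    have hΓσ : ∀ k ∈ Finset.univ, DifferentiableAt ℝ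
        (fun y => christoffel G k i j y • dd k σ y) y := fun k _ => (hΓd k i j).smul (hd k)
    have h1 : DifferentiableAt ℝ (fun y => ∑ k, christoffel G k i j y • dd k σ y) y :=
      DifferentiableAt.fun_sum hΓσ
    have h2 : DifferentiableAt ℝ (fun y => (c * G y i j) • ν y) y := hcG.smul hνd
    have h3 : DifferentiableAt ℝ (fun y => ∑ k, christoffel G k i j y • dd k σ y
      + (c * G y i j) • ν y) y := h1.add h2
    have h4 : DifferentiableAt ℝ (fun y => (q y)⁻¹ • (pd i q y • dd j σ y + pd j q y • dd i σ y
        - (inner ℝ (dd i σ y) (dd j σ y) : ℝ) • g y)) y := hqi.smul hB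
    have h5 : DifferentiableAt ℝ (fun y => pd i q y • dd j σ y) y := (hpqd i).smul (hd j)
    have h6 : DifferentiableAt ℝ (fun y => pd j q y • dd i σ y) y := (hpqd j).smul (hd i)
    have h7 : DifferentiableAt ℝ (fun y => pd i q y • dd j σ y + pd j q y • dd i σ y) y := h5.add h6
    have h8 : DifferentiableAt ℝ (fun y => (inner ℝ (dd i σ y) (dd j σ y) : ℝ) • g y) y :=
      (hin i j).smul hgd
    have hcGd : pd l (fun y => c * G y i j) y = c * pd l (fun y => G y i j) y := by
      rw [pd_mul l (differentiableAt_const c) (hGd i j), pd_const, zero_mul, add_zero]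
    rw [dd_congr_of_eqOn H.isOpen (fun z hz => H.dd_dd hz i j) hy l, dd_add l h3 h4,
      dd_add l h1 h2, dd_sum l _ hΓσ, dd_smul l hcG hνd, dd_smul l hqi hB, dd_sub l h7 h8,
      dd_add l h5 h6, dd_smul l (hpqd i) (hd j), dd_smul l (hpqd j) (hd i),
      dd_smul l (hin i j) hgd, H.pd_inner_dd hy, hpqi]
    simp only [fun k => dd_smul l (hΓd k i j) (hd k), inner_sub_left, inner_add_left, sum_inner,
      real_inner_smul_left, H.normal y hy, ← H.pd_factor y hy]
    ring
  have hfirst : ∀ i j m, inner ℝ (dd i (dd j σ) y) (dd m σ y)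
      = ∑ k, christoffel G k i j y * inner ℝ (dd k σ y) (dd m σ y)
        + (q y)⁻¹ * (pd i q y * inner ℝ (dd j σ y) (dd m σ y)
          + pd j q y * inner ℝ (dd i σ y) (dd m σ y)
          - inner ℝ (dd i σ y) (dd j σ y) * pd m q y) := by
    intro i j m
    rw [H.dd_dd hy i j]
    simp only [inner_sub_left, inner_add_left, sum_inner,
      real_inner_smul_left, H.normal y hy, ← H.pd_factor y hy]
    ring
  have hnorm : ∀ l, inner ℝ (dd l ν y) (dd m σ y) = -c * inner ℝ (dd l σ y) (dd m σ y)
      + (q y)⁻¹ * (inner ℝ (g y) (ν y) * inner ℝ (dd l σ y) (dd m σ y)) := by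
    intro l
    rw [H.dd_normal y hy]
    simp only [inner_add_left, real_inner_smul_left, H.normal y hy]
    ring
  -- The second derivatives of the factor `q` follow by differentiating `∂ᵢq = ⟨g, ∂ᵢσ⟩` and
  -- inserting the Gauss formula.
  have hpp : ∀ l i, pd l (pd i q) y = inner ℝ (dd l g y) (dd i σ y)
      + ∑ k, christoffel G k l i y * pd k q y + c * G y l i * inner ℝ (g y) (ν y)
      + (q y)⁻¹ * (2 * pd l q y * pd i q y
        - inner ℝ (dd l σ y) (dd i σ y) * inner ℝ (g y) (g y)) := by
    intro l i
    rw [pd_congr_of_eqOn H.isOpen (fun z hz => H.pd_factor z hz i) hy l, pd_inner l hgd (hd i),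
      H.dd_dd hy l i]
    simp only [inner_sub_right, inner_add_right, inner_sum, real_inner_smul_right,
      ← H.pd_factor y hy]
    ring
  -- The curvature is extracted from the symmetry of the third derivatives of `σ`, tested against
  -- `∂ₘσ`. Both sides are expanded by the derivative of the Gauss formula, and the differentiated
  -- Christoffel symbols assemble into `riemann`.
  have hsw : inner ℝ (dd l (dd i (dd j σ)) y) (dd m σ y)
      = inner ℝ (dd i (dd l (dd j σ)) y) (dd m σ y) := by
    rw [dd_comm H.isOpen (hds j) hy l i]
  have hR : q y ^ 2 * riemann G i l j m y
      = ∑ k, pd l (christoffel G k i j) y * inner ℝ (dd k σ y) (dd m σ y)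
        - ∑ k, pd i (christoffel G k l j) y * inner ℝ (dd k σ y) (dd m σ y)
        + ∑ k, christoffel G k i j y * ∑ e, christoffel G e l k y * inner ℝ (dd e σ y) (dd m σ y)
        - ∑ k, christoffel G k l j y *
          ∑ e, christoffel G e i k y * inner ℝ (dd e σ y) (dd m σ y) := by
    unfold riemann riemannUp
    have e1 : ∀ e, q y ^ 2 * G y m e = inner ℝ (dd e σ y) (dd m σ y) := by
      intro e
      rw [H.metric y hy, hsymm m e]
      field_simp
    simp only [Finset.mul_sum, ← mul_assoc, e1, mul_add, mul_sub, Finset.sum_add_distrib,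
      Finset.sum_sub_distrib]
    rw [Finset.sum_comm (f := fun e k => inner ℝ (dd e σ y) (dd m σ y) * christoffel G k i j y
        * christoffel G e l k y), Finset.sum_comm (f := fun e k => inner ℝ (dd e σ y) (dd m σ y)
        * christoffel G k l j y * christoffel G e i k y)]
    have e2 : ∀ a b : ι, ∀ x : ι, inner ℝ (dd x σ y) (dd m σ y) * pd a (christoffel G x b j) y
        = pd a (christoffel G x b j) y * inner ℝ (dd x σ y) (dd m σ y) := fun _ _ _ => mul_comm _ _
    have e3 : ∀ a b k e : ι, inner ℝ (dd e σ y) (dd m σ y) * christoffel G k a j y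
          * christoffel G e b k y
        = christoffel G k a j y * christoffel G e b k y * inner ℝ (dd e σ y) (dd m σ y) :=
      fun _ _ _ _ => by ring
    simp only [e2, e3]
    ring
  have hsum : ∀ l i j, ∑ k, (christoffel G k i j y * inner ℝ (dd l (dd k σ) y) (dd m σ y)
          + pd l (christoffel G k i j) y * inner ℝ (dd k σ y) (dd m σ y))
      = ∑ k, christoffel G k i j y * ∑ e, christoffel G e l k y * inner ℝ (dd e σ y) (dd m σ y)
        + ∑ k, pd l (christoffel G k i j) y * inner ℝ (dd k σ y) (dd m σ y)
        + (q y)⁻¹ * (pd l q y * ∑ k, christoffel G k i j y * inner ℝ (dd k σ y) (dd m σ y)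
          + inner ℝ (dd l σ y) (dd m σ y) * ∑ k, christoffel G k i j y * pd k q y
          - pd m q y * ∑ k, christoffel G k i j y * inner ℝ (dd k σ y) (dd l σ y)) := by
    intro l i j
    rw [Finset.mul_sum, Finset.mul_sum, Finset.mul_sum, ← Finset.sum_add_distrib,
      ← Finset.sum_add_distrib, ← Finset.sum_sub_distrib, Finset.mul_sum,
      ← Finset.sum_add_distrib]
    refine Finset.sum_congr rfl fun k _ => ?_
    rw [hfirst, hsymm l k]
    ring
  have hQsymm : pd l (pd i q) y = pd i (pd l q) y := dd_comm H.isOpen H.smooth_factor hy l i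
  have key := hsw
  rw [hthird l i j, hthird i l j, hsum, hsum, hnorm, hnorm, hQsymm, hcomm i l] at key
  have hR2 : riemann G i l j m y = (q y ^ 2 * riemann G i l j m y) / q y ^ 2 := by field_simp
  rw [hR2, hR]
  simp only [hfirst, hpp] at key
  simp only [H.metric y hy] at key ⊢
  rw [hsymm j l, hsymm j i] at *
  field_simp at key ⊢
  refine mul_left_cancel₀ h0 ?_
  linear_combination key - q y * pd m q y * pd j q y * hsymm i l

end IsUmbilic

end Gauss

/-! ### Curvature of metrics conformal to the Euclidean one. -/

section Conformal

open Set Filter Topology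

variable {ι : Type} [Fintype ι] [DecidableEq ι]

/-- The Euclidean gradient. -/
def grad (f : EuclideanSpace ℝ ι → ℝ) (y : EuclideanSpace ℝ ι) : EuclideanSpace ℝ ι :=
  WithLp.toLp 2 fun i => pd i f y

theorem grad_apply (f : EuclideanSpace ℝ ι → ℝ) (y : EuclideanSpace ℝ ι) (i : ι) :
    grad f y i = pd i f y := rfl

theorem inner_eq_sum (x y : EuclideanSpace ℝ ι) : inner ℝ x y = ∑ i, x i * y i := by
  rw [PiLp.inner_apply]
  exact Finset.sum_congr rfl fun a _ => by simp [mul_comm]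

theorem inner_grad (f : EuclideanSpace ℝ ι → ℝ) (y w : EuclideanSpace ℝ ι) :
    inner ℝ (grad f y) w = fderiv ℝ f y w := by
  rw [inner_eq_sum, fderiv_eq_sum_dd]
  exact Finset.sum_congr rfl fun i _ => mul_comm _ _

variable {Ω : Set (EuclideanSpace ℝ ι)}

theorem contDiffOn_grad (hΩ : IsOpen Ω) {f : EuclideanSpace ℝ ι → ℝ} (hf : ContDiffOn ℝ ∞ f Ω) :
    ContDiffOn ℝ ∞ (grad f) Ω :=
  contDiffOn_euclidean.2 fun i => contDiffOn_pd hΩ hf i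

theorem dd_apply {κ : Type} [Fintype κ] {σ : EuclideanSpace ℝ ι → EuclideanSpace ℝ κ}
    {y : EuclideanSpace ℝ ι} (hσ : DifferentiableAt ℝ σ y) (i : ι) (j : κ) :
    dd i σ y j = pd i (fun y => σ y j) y := by
  have h1 := ((EuclideanSpace.proj j : EuclideanSpace ℝ κ →L[ℝ] ℝ).hasFDerivAt).comp y
    hσ.hasFDerivAt
  unfold pd dd
  exact (congrArg (fun L => L (EuclideanSpace.single i 1)) h1.fderiv).symm

theorem dd_grad_apply (hΩ : IsOpen Ω) {f : EuclideanSpace ℝ ι → ℝ} (hf : ContDiffOn ℝ ∞ f Ω)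
    {y : EuclideanSpace ℝ ι} (hy : y ∈ Ω) (i j : ι) : dd i (grad f) y j = pd i (pd j f) y :=
  dd_apply (differentiableAt_of_contDiffOn hΩ (contDiffOn_grad hΩ hf) hy) i j

theorem dd_id (i : ι) (y : EuclideanSpace ℝ ι) :
    dd i (fun y : EuclideanSpace ℝ ι => y) y = EuclideanSpace.single i 1 := by
  unfold dd
  rw [fderiv_fun_id]
  rfl

theorem inner_single (x : EuclideanSpace ℝ ι) (i : ι) :
    inner ℝ x (EuclideanSpace.single i (1 : ℝ)) = x i := by
  rw [EuclideanSpace.inner_single_right]; simp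

theorem inner_single_single (i j : ι) : inner ℝ (EuclideanSpace.single i (1 : ℝ))
    (EuclideanSpace.single j (1 : ℝ)) = if i = j then (1 : ℝ) else 0 := by
  rw [inner_single]
  simp [eq_comm]

/-- If `dg = C dσ`, every Hessian term of the Gauss equation is a multiple of the induced metric, so
the curvature tensor is that of a space form at the point. In the constant, `2qC - |g|²` is the
ambient curvature of the tangent planes and `c²` the contribution of the principal curvatures. -/
theorem IsUmbilic.hasSectionalCurvatureAt {V : Type*} [NormedAddCommGroup V]
    [InnerProductSpace ℝ V] {σ g ν : EuclideanSpace ℝ ι → V}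
    {q : EuclideanSpace ℝ ι → ℝ} {c : ℝ} {G : EuclideanSpace ℝ ι → Matrix ι ι ℝ}
    (H : IsUmbilic Ω σ g ν q c G) {y : EuclideanSpace ℝ ι} (hy : y ∈ Ω) {C : ℝ}
    (hC : ∀ i, dd i g y = C • dd i σ y) :
    HasSectionalCurvatureAt G (2 * q y * C - inner ℝ (g y) (g y) + c ^ 2) y := by
  have h0 := H.factor_ne y hy
  have hR : ∀ i l j m, riemann G i l j m y = (2 * q y * C - inner ℝ (g y) (g y) + c ^ 2)
      * (G y i j * G y l m - G y i m * G y l j) := by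
    intro i l j m
    rw [H.riemann_eq hy]
    simp only [hC, real_inner_smul_left, H.metric y hy]
    field_simp
    ring
  have hs : ∀ i j, G y i j = G y j i := by
    intro i j
    rw [H.metric y hy, H.metric y hy, real_inner_comm]
  intro v w
  set K := 2 * q y * C - inner ℝ (g y) (g y) + c ^ 2
  have e : ∀ a b c d, riemann G a b c d y * v a * w b * v c * w d
      = K * ((G y a c * v a * v c) * (G y b d * w b * w d)
        - (G y a d * v a * w d) * (G y c b * v c * w b)) := by
    intro a b c d
    rw [hR, hs c b]
    ring
  simp only [e, ← Finset.mul_sum, Finset.sum_sub_distrib]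
  congr 2
  · rw [Finset.sum_mul]
    refine Finset.sum_congr rfl fun a _ => ?_
    rw [Finset.sum_comm, Finset.sum_mul]
    refine Finset.sum_congr rfl fun c _ => ?_
    simp only [Finset.mul_sum]
  · rw [sq, Finset.sum_mul]
    refine Finset.sum_congr rfl fun a _ => ?_
    rw [Finset.sum_mul, Finset.sum_comm]
    rw [Finset.sum_congr rfl fun c _ => Finset.sum_comm]
    rw [Finset.sum_comm]
    refine Finset.sum_congr rfl fun d _ => ?_
    simp only [Finset.mul_sum]

variable {v f : EuclideanSpace ℝ ι → ℝ} {G : EuclideanSpace ℝ ι → Matrix ι ι ℝ}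

/-- With normal `0` and `c = 0` the identity map fits the umbilic framework, so the Gauss formula
and equation yield the connection and curvature of `v⁻²⟨·,·⟩`. -/
theorem isUmbilic_id (hΩ : IsOpen Ω) (hv : ContDiffOn ℝ ∞ v Ω) (hv0 : ∀ y ∈ Ω, v y ≠ 0)
    (hG : ∀ y ∈ Ω, G y = (v y ^ 2)⁻¹ • (1 : Matrix ι ι ℝ)) :
    IsUmbilic Ω (fun y => y) (grad v) 0 v 0 G where
  isOpen := hΩ
  smooth := contDiffOn_id
  smooth_grad := contDiffOn_grad hΩ hv
  smooth_normal := contDiffOn_const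
  smooth_factor := hv
  factor_ne := hv0
  pd_factor y _ i := by rw [dd_id, inner_single, grad_apply]
  metric y hy i j := by
    rw [dd_id, dd_id, inner_single_single, hG y hy]
    simp [Matrix.one_apply, div_eq_mul_inv]
  det_ne y hy := by
    rw [hG y hy, Matrix.det_smul]
    simp [hv0 y hy]
  normal y _ i := by simp
  normal_unit y _ := by simp
  dd_normal y _ i := by
    have : dd i (0 : EuclideanSpace ℝ ι → EuclideanSpace ℝ ι) y = 0 := dd_const i 0
    rw [this]
    simp
  span y _ Z h _ := by
    ext i
    have := h i
    rw [dd_id, inner_single] at this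
    simpa using this

/-- The second derivatives of the identity map vanish, so its Gauss formula can be solved for the
Christoffel symbols. -/
theorem christoffel_conformal (hΩ : IsOpen Ω) (hv : ContDiffOn ℝ ∞ v Ω) (hv0 : ∀ y ∈ Ω, v y ≠ 0)
    (hG : ∀ y ∈ Ω, G y = (v y ^ 2)⁻¹ • (1 : Matrix ι ι ℝ)) {y : EuclideanSpace ℝ ι} (hy : y ∈ Ω)
    (k i j : ι) : christoffel G k i j y = -(v y)⁻¹ * (pd i v y * (if j = k then 1 else 0)
      + pd j v y * (if i = k then 1 else 0) - (if i = j then 1 else 0) * pd k v y) := by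
  have h := (isUmbilic_id hΩ hv hv0 hG).dd_dd hy i j
  have h1 : dd j (fun y : EuclideanSpace ℝ ι => y) = fun _ => EuclideanSpace.single j 1 := by
    ext1 z
    rw [dd_id]
  rw [h1, dd_const] at h
  have h2 := congrArg (fun w : EuclideanSpace ℝ ι => inner ℝ w (EuclideanSpace.single k (1 : ℝ))) h
  have h3 : ∀ a b : ι, (EuclideanSpace.single a (1 : ℝ)).ofLp b = if a = b then (1 : ℝ) else 0 :=
    fun a b => by rw [← inner_single, inner_single_single]
  simp only [dd_id, inner_zero_left, inner_add_left, sum_inner, real_inner_smul_left,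
    inner_sub_left, inner_single, h3, grad_apply, zero_mul] at h2
  simp only [mul_ite, mul_one, mul_zero, Finset.sum_ite_eq', Finset.mem_univ, if_true] at h2 ⊢
  linear_combination -h2

/-- This is the trace of the Gauss equation of the identity map; the inverse metric is diagonal, so
only the terms with `d = b` survive. -/
theorem ricci_conformal (hΩ : IsOpen Ω) (hv : ContDiffOn ℝ ∞ v Ω) (hv0 : ∀ y ∈ Ω, v y ≠ 0)
    (hG : ∀ y ∈ Ω, G y = (v y ^ 2)⁻¹ • (1 : Matrix ι ι ℝ)) {y : EuclideanSpace ℝ ι} (hy : y ∈ Ω)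
    (a c : ι) : ricci G a c y = (v y)⁻¹ * (((Fintype.card ι : ℝ) - 2) * pd a (pd c v) y
      + (∑ k, pd k (pd k v) y) * (if a = c then 1 else 0))
      - (v y)⁻¹ ^ 2 * ((Fintype.card ι : ℝ) - 1) * (∑ k, pd k v y ^ 2)
        * (if a = c then 1 else 0) := by
  have h0 := hv0 y hy
  have hinv : (G y)⁻¹ = (v y ^ 2) • (1 : Matrix ι ι ℝ) := by
    refine Matrix.inv_eq_left_inv ?_
    rw [hG y hy]
    simp [smul_smul, h0]
  have hR := fun b d => (isUmbilic_id hΩ hv hv0 hG).riemann_eq hy a b c d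
  have hgg : (inner ℝ (grad v y) (grad v y) : ℝ) = ∑ k, pd k v y ^ 2 := by
    rw [inner_eq_sum]
    exact Finset.sum_congr rfl fun k _ => by rw [grad_apply, sq]
  have h3 : ∀ a b : ι, (EuclideanSpace.single a (1 : ℝ)).ofLp b = if a = b then (1 : ℝ) else 0 :=
    fun a b => by rw [← inner_single, inner_single_single]
  unfold ricci
  simp only [hR, hgg, dd_id, inner_single, h3, dd_grad_apply hΩ hv hy]
  set S := ∑ k, pd k v y ^ 2
  have e : ∀ b, ∑ d, (G y)⁻¹ b d * ((v y * (pd a (pd c v) y * (if b = d then 1 else 0)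
      + pd b (pd d v) y * (if a = c then 1 else 0) - pd a (pd d v) y * (if b = c then 1 else 0)
      - pd b (pd c v) y * (if a = d then 1 else 0))
      - S * ((if a = c then 1 else 0) * (if b = d then 1 else 0)
        - (if a = d then 1 else 0) * (if b = c then 1 else 0))) / v y ^ 4
      + 0 ^ 2 * (G y a c * G y b d - G y b c * G y a d))
      = (v y)⁻¹ * (pd a (pd c v) y + pd b (pd b v) y * (if a = c then 1 else 0)
        - (if b = c then pd a (pd b v) y else 0) - if a = b then pd b (pd c v) y else 0)
      - (v y)⁻¹ ^ 2 * S * ((if a = c then 1 else 0) - if b = c then (if a = c then 1 else 0) else 0)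
       := by
    intro b
    rw [Finset.sum_eq_single b]
    · rw [hinv]
      simp only [Matrix.smul_apply, Matrix.one_apply_eq, smul_eq_mul, if_true, mul_one]
      simp only [mul_ite, mul_one, mul_zero]
      field_simp
      ring_nf
    · intro d _ hd
      rw [hinv]
      simp [Matrix.one_apply_ne hd.symm]
    · simp
  simp only [e, Finset.sum_sub_distrib, ← Finset.mul_sum, Finset.sum_add_distrib, ← Finset.sum_mul,
    Finset.sum_ite_eq, Finset.sum_ite_eq', Finset.mem_univ, if_true, Finset.sum_const,
    Finset.card_univ, nsmul_eq_mul]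
  split_ifs <;> ring

end Conformal

/-! ### Linear algebra of Kronecker-type tensor identities. -/

section Algebra

variable {ι : Type} [Fintype ι] [DecidableEq ι]

theorem eq_zero_of_kronecker_eq {τ : ι → ℝ} (hN : 2 ≤ Fintype.card ι)
    (h : ∀ i j k, (if i = j then τ k else 0) - (if i = k then τ j else 0) = 0) (k : ι) :
    τ k = 0 := by
  have : Nontrivial ι := Fintype.one_lt_card_iff_nontrivial.1 hN
  obtain ⟨i, hi⟩ := exists_ne k
  simpa [hi] using h i i k

/-- Take `k`, `i`, `j` distinct, which needs three indices. If `η k ≠ 0`, the triple `(i, i, k)`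
forces `p i ≠ 0`, then `(i, j, k)` forces `A j k = 0`, and `(j, j, k)` gives a contradiction. -/
theorem eq_zero_of_kronecker_eq_mul {η p : ι → ℝ} {A : ι → ι → ℝ} (hN : 3 ≤ Fintype.card ι)
    (h : ∀ i j k, (if i = j then η k else 0) - (if i = k then η j else 0) = p i * A j k) (k : ι) :
    η k = 0 := by
  obtain ⟨i, hi⟩ := Finset.exists_mem_notMem_of_card_lt_card (s := {k}) (t := Finset.univ)
    (by rw [Finset.card_univ, Finset.card_singleton]; omega)
  obtain ⟨j, hj⟩ := Finset.exists_mem_notMem_of_card_lt_card (s := {k, i}) (t := Finset.univ)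
    (by
      rw [Finset.card_univ]
      exact (Finset.card_le_two).trans_lt hN)
  simp only [Finset.mem_univ, Finset.mem_singleton, Finset.mem_insert, true_and, not_or] at hi hj
  have h1 := h i i k
  have h2 := h j j k
  have h3 := h i j k
  rw [if_pos rfl, if_neg hi, sub_zero] at h1
  rw [if_pos rfl, if_neg hj.1, sub_zero] at h2
  rw [if_neg (Ne.symm hj.2), if_neg hi, sub_zero] at h3
  by_contra hk
  have hp : p i ≠ 0 := fun h0 => hk (by rw [h1, h0, zero_mul])
  have ha : A j k = 0 := (mul_eq_zero.1 h3.symm).resolve_left hp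
  exact hk (by rw [h2, ha, mul_zero])

/-- A symmetric matrix `V` with `κ (Vᵢₖ pⱼ - Vᵢⱼ pₖ) = δᵢⱼ τₖ - δᵢₖ τⱼ` is a combination of the
identity and `p ⊗ p`, and `τ` is a multiple of `p`. -/
theorem eq_of_kronecker_eq_codazzi {V : ι → ι → ℝ} {p τ : ι → ℝ} {κ : ℝ}
    (hN : 3 ≤ Fintype.card ι) (hκ : κ ≠ 0) (hp : ∑ i, p i ^ 2 ≠ 0) (hV : ∀ i j, V i j = V j i)
    (h : ∀ i j k, κ * (V i k * p j - V i j * p k)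
      = (if i = j then τ k else 0) - (if i = k then τ j else 0)) :
    (∀ k, τ k = (∑ j, τ j * p j) / (∑ j, p j ^ 2) * p k) ∧
      ∀ i k, V i k = -((∑ j, τ j * p j) / (∑ j, p j ^ 2)) / κ * (if i = k then 1 else 0)
        + (Fintype.card ι * ((∑ j, τ j * p j) / (∑ j, p j ^ 2)) + κ * ∑ j, V j j)
          / (κ * ∑ j, p j ^ 2) * (p i * p k) := by
  set Q := ∑ j, p j ^ 2 with hQ
  set T := ∑ j, τ j * p j with hT
  -- Contraction of the hypothesis with `p j`.
  have h1 : ∀ i k, κ * (V i k * Q - (∑ j, V i j * p j) * p k)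
      = p i * τ k - T * (if i = k then 1 else 0) := by
    intro i k
    have e := Finset.sum_congr (s₁ := Finset.univ) rfl fun j (_ : j ∈ Finset.univ) =>
      congrArg (· * p j) (h i j k)
    simp only [sub_mul, ite_mul, zero_mul, Finset.sum_sub_distrib, Finset.sum_ite_eq,
      Finset.mem_univ, if_true] at e
    have e1 : ∑ j, κ * (V i k * p j - V i j * p k) * p j
        = κ * (V i k * Q - (∑ j, V i j * p j) * p k) := by
      rw [hQ, Finset.mul_sum, Finset.sum_mul, ← Finset.sum_sub_distrib, Finset.mul_sum]
      exact Finset.sum_congr rfl fun j _ => by ring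
    have e2 : ∑ j, (if i = k then τ j * p j else 0) = T * (if i = k then 1 else 0) := by
      split_ifs <;> simp [hT]
    rw [e1, e2] at e
    rw [e]
    ring
  -- Trace of the hypothesis over `i = j`.
  have h2 : ∀ k, κ * (∑ j, V k j * p j)
      = ((Fintype.card ι : ℝ) - 1) * τ k + κ * (∑ j, V j j) * p k := by
    intro k
    have e := Finset.sum_congr (s₁ := Finset.univ) rfl fun i (_ : i ∈ Finset.univ) => h i i k
    simp only [if_true, Finset.sum_sub_distrib, Finset.sum_ite_eq', Finset.mem_univ,
      Finset.sum_const, Finset.card_univ, nsmul_eq_mul] at e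
    rw [← Finset.mul_sum, Finset.sum_sub_distrib, ← Finset.sum_mul] at e
    have e1 : ∑ j, V k j * p j = ∑ j, V j k * p j :=
      Finset.sum_congr rfl fun j _ => by rw [hV]
    rw [e1]
    linear_combination e
  have hm : (Fintype.card ι : ℝ) - 2 ≠ 0 := by
    have : (3 : ℝ) ≤ Fintype.card ι := by exact_mod_cast hN
    linarith
  -- The antisymmetric part of `h1`, with `V p` replaced by means of `h2`, is `N - 2` times this
  -- relation, where `N` is the dimension.
  have h3 : ∀ i k, τ i * p k = τ k * p i := by
    intro i k
    have e1 := h1 i k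
    have e2 := h1 k i
    rw [hV k i] at e2
    simp only [eq_comm (a := k) (b := i)] at e2
    have e3 := h2 i
    have e4 := h2 k
    refine mul_left_cancel₀ hm ?_
    linear_combination e2 - e1 - p k * e3 + p i * e4
  have h4 : ∀ k, τ k = T / Q * p k := by
    intro k
    have e : τ k * Q = T * p k := by
      rw [hQ, hT, Finset.mul_sum, Finset.sum_mul]
      exact Finset.sum_congr rfl fun j _ => by linear_combination p j * h3 k j
    field_simp
    exact e
  refine ⟨h4, fun i k => ?_⟩
  have e1 := h1 i k
  have e2 := h2 i
  rw [h4 k] at e1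
  rw [h4 i] at e2
  field_simp at e1 e2 ⊢
  linear_combination e1 + p k * e2

end Algebra

/-! ### The quasi-Einstein equation in a conformally flat chart. -/

section FlatEquation

open Set Filter Topology

variable {ι : Type} [Fintype ι] [DecidableEq ι]

theorem pd_comm {Ω : Set (EuclideanSpace ℝ ι)} (hΩ : IsOpen Ω) {f : EuclideanSpace ℝ ι → ℝ}
    (hf : ContDiffOn ℝ ∞ f Ω) {y : EuclideanSpace ℝ ι} (hy : y ∈ Ω) (i j : ι) :
    pd i (pd j f) y = pd j (pd i f) y := dd_comm hΩ hf hy i j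

theorem pd_pd_pd_comm {Ω : Set (EuclideanSpace ℝ ι)} (hΩ : IsOpen Ω) {f : EuclideanSpace ℝ ι → ℝ}
    (hf : ContDiffOn ℝ ∞ f Ω) {y : EuclideanSpace ℝ ι} (hy : y ∈ Ω) (i j k : ι) :
    pd k (pd i (pd j f)) y = pd j (pd i (pd k f)) y := by
  rw [pd_congr_of_eqOn hΩ (fun z hz => pd_comm hΩ hf hz i j) hy k,
    pd_congr_of_eqOn hΩ (fun z hz => pd_comm hΩ hf hz i k) hy j]
  exact pd_comm hΩ (contDiffOn_pd hΩ hf i) hy k j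

/-- The quasi-Einstein equation of a conformally flat metric `v⁻²⟨·,·⟩`, up to a multiple `s` of
the identity. -/
structure IsFlatQuasiEinstein (Ω : Set (EuclideanSpace ℝ ι)) (v f s : EuclideanSpace ℝ ι → ℝ)
    (μ : ℝ) : Prop where
  isOpen : IsOpen Ω
  smooth_factor : ContDiffOn ℝ ∞ v Ω
  smooth_potential : ContDiffOn ℝ ∞ f Ω
  smooth_trace : ContDiffOn ℝ ∞ s Ω
  factor_pos : ∀ y ∈ Ω, 0 < v y
  eq : ∀ y ∈ Ω, ∀ i j, v y * pd i (pd j f) y + pd i v y * pd j f y + pd j v y * pd i f y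
    + ((Fintype.card ι : ℝ) - 2) * pd i (pd j v) y - μ * v y * pd i f y * pd j f y
      = if i = j then s y else 0

/-- The Ricci tensor and the Hessian of `v⁻²⟨·,·⟩` are inserted and the equation is multiplied by
`v`. All terms proportional to the identity, including `λ g`, are collected in `s`. -/
theorem isFlatQuasiEinstein_of_ricci {Ω : Set (EuclideanSpace ℝ ι)}
    {v f : EuclideanSpace ℝ ι → ℝ} {μ lam : ℝ} {G : EuclideanSpace ℝ ι → Matrix ι ι ℝ}
    (hΩ : IsOpen Ω) (hv : ContDiffOn ℝ ∞ v Ω) (hf : ContDiffOn ℝ ∞ f Ω)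
    (hv0 : ∀ y ∈ Ω, 0 < v y) (hG : ∀ y ∈ Ω, G y = (v y ^ 2)⁻¹ • (1 : Matrix ι ι ℝ))
    (h : ∀ y ∈ Ω, ∀ i j, ricci G i j y + hessian G f i j y - μ * (pd i f y * pd j f y)
      = lam * G y i j) :
    ∃ s, IsFlatQuasiEinstein Ω v f s μ := by
  have hvn : ∀ y ∈ Ω, v y ≠ 0 := fun y hy => (hv0 y hy).ne'
  have hpd := fun k => contDiffOn_pd hΩ hv k
  refine ⟨fun y => (lam + ((Fintype.card ι : ℝ) - 1) * ∑ k, pd k v y ^ 2) / v y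
    - ∑ k, pd k (pd k v) y + ∑ k, pd k v y * pd k f y, hΩ, hv, hf, ?_, hv0, fun y hy i j => ?_⟩
  · have h1 : ContDiffOn ℝ ∞ (fun y => ∑ k, pd k v y ^ 2) Ω :=
      ContDiffOn.sum fun k _ => (hpd k).pow 2
    have h2 : ContDiffOn ℝ ∞ (fun y => ∑ k, pd k (pd k v) y) Ω :=
      ContDiffOn.sum fun k _ => contDiffOn_pd hΩ (hpd k) k
    have h3 : ContDiffOn ℝ ∞ (fun y => ∑ k, pd k v y * pd k f y) Ω :=
      ContDiffOn.sum fun k _ => (hpd k).mul (contDiffOn_pd hΩ hf k)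
    exact (((contDiffOn_const.add (contDiffOn_const.mul h1)).div hv hvn).sub h2).add h3
  · have e := h y hy i j
    have h0 := hvn y hy
    have hh : hessian G f i j y = pd i (pd j f) y + (v y)⁻¹ * (pd i v y * pd j f y
        + pd j v y * pd i f y - (if i = j then 1 else 0) * ∑ k, pd k v y * pd k f y) := by
      unfold hessian
      have e1 : ∀ k, christoffel G k i j y * pd k f y = -(v y)⁻¹ *
          ((if j = k then pd i v y * pd k f y else 0) + (if i = k then pd j v y * pd k f y else 0)
            - (if i = j then 1 else 0) * (pd k v y * pd k f y)) := by
        intro k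
        rw [christoffel_conformal hΩ hv hvn hG hy]
        split_ifs <;> ring
      simp only [e1]
      rw [← Finset.mul_sum, Finset.sum_sub_distrib, Finset.sum_add_distrib, ← Finset.mul_sum]
      simp only [Finset.sum_ite_eq, Finset.mem_univ, if_true]
      ring
    rw [ricci_conformal hΩ hv hvn hG hy, hh, hG y hy] at e
    simp only [Matrix.smul_apply, Matrix.one_apply, smul_eq_mul] at e
    split_ifs at e ⊢ with hij
    · field_simp at e ⊢
      linear_combination e
    · field_simp at e
      refine mul_left_cancel₀ h0 ?_
      linear_combination e

namespace IsFlatQuasiEinstein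

variable {Ω : Set (EuclideanSpace ℝ ι)} {v f s : EuclideanSpace ℝ ι → ℝ} {μ : ℝ}
  (H : IsFlatQuasiEinstein Ω v f s μ)

include H

/-- The equation is differentiated in direction `k` and antisymmetrized in `j`, `k`. The third
derivatives of `v` and `f` cancel, and the second derivatives of `f` are replaced through the
equation itself, which turns the coefficient of the `∇²v ⊗ df` terms into `1 + μ (N - 2)`, with `N`
the dimension. -/
theorem codazzi {y : EuclideanSpace ℝ ι} (hy : y ∈ Ω) (i j k : ι) :
    (1 + μ * ((Fintype.card ι : ℝ) - 2)) * (pd i (pd k v) y * pd j f y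
      - pd i (pd j v) y * pd k f y)
      = (if i = j then pd k s y - μ * s y * pd k f y else 0)
        - (if i = k then pd j s y - μ * s y * pd j f y else 0) := by
  have hΩ := H.isOpen
  have hvs := H.smooth_factor
  have hfs := H.smooth_potential
  have hpv := contDiffOn_pd hΩ hvs
  have hpf := contDiffOn_pd hΩ hfs
  have dv := differentiableAt_of_contDiffOn hΩ hvs hy
  have df := differentiableAt_of_contDiffOn hΩ hfs hy
  have ds := differentiableAt_of_contDiffOn hΩ H.smooth_trace hy
  have dv1 := fun i => differentiableAt_of_contDiffOn hΩ (hpv i) hy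
  have df1 := fun i => differentiableAt_of_contDiffOn hΩ (hpf i) hy
  have dv2 := fun i j => differentiableAt_of_contDiffOn hΩ (contDiffOn_pd hΩ (hpv i) j) hy
  have df2 := fun i j => differentiableAt_of_contDiffOn hΩ (contDiffOn_pd hΩ (hpf i) j) hy
  have cv : ∀ i j, pd i (pd j v) y = pd j (pd i v) y := pd_comm hΩ hvs hy
  have cf : ∀ i j, pd i (pd j f) y = pd j (pd i f) y := pd_comm hΩ hfs hy
  have third : ∀ i j k, pd k (fun y => if i = j then s y else 0) y = v y * pd k (pd i (pd j f)) y
      + pd k v y * pd i (pd j f) y + (pd i v y * pd k (pd j f) y + pd k (pd i v) y * pd j f y)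
      + (pd j v y * pd k (pd i f) y + pd k (pd j v) y * pd i f y)
      + ((Fintype.card ι : ℝ) - 2) * pd k (pd i (pd j v)) y
      - (μ * v y * pd i f y * pd k (pd j f) y
        + (μ * v y * pd k (pd i f) y + μ * pd k v y * pd i f y) * pd j f y) := by
    intro i j k
    have hμv : DifferentiableAt ℝ (fun y => μ * v y) y := dv.const_mul μ
    have hμvf : DifferentiableAt ℝ (fun y => μ * v y * pd i f y) y := hμv.mul (df1 i)
    have h5 : DifferentiableAt ℝ (fun y => μ * v y * pd i f y * pd j f y) y := hμvf.mul (df1 j)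
    have h1 : DifferentiableAt ℝ (fun y => v y * pd i (pd j f) y) y := dv.mul (df2 j i)
    have h2 : DifferentiableAt ℝ (fun y => pd i v y * pd j f y) y := (dv1 i).mul (df1 j)
    have h3 : DifferentiableAt ℝ (fun y => pd j v y * pd i f y) y := (dv1 j).mul (df1 i)
    have h4 : DifferentiableAt ℝ (fun y => ((Fintype.card ι : ℝ) - 2) * pd i (pd j v) y) y :=
      (dv2 j i).const_mul _
    have h12 : DifferentiableAt ℝ (fun y => v y * pd i (pd j f) y + pd i v y * pd j f y) y :=
      h1.add h2
    have h123 : DifferentiableAt ℝ (fun y => v y * pd i (pd j f) y + pd i v y * pd j f y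
      + pd j v y * pd i f y) y := h12.add h3
    have h1234 : DifferentiableAt ℝ (fun y => v y * pd i (pd j f) y + pd i v y * pd j f y
      + pd j v y * pd i f y + ((Fintype.card ι : ℝ) - 2) * pd i (pd j v) y) y := h123.add h4
    have hE : EqOn (fun y => v y * pd i (pd j f) y + pd i v y * pd j f y + pd j v y * pd i f y
        + ((Fintype.card ι : ℝ) - 2) * pd i (pd j v) y - μ * v y * pd i f y * pd j f y)
        (fun y => if i = j then s y else 0) Ω := fun z hz => H.eq z hz i j
    have e := pd_congr_of_eqOn hΩ hE hy k
    rw [← e, pd_sub k h1234 h5, pd_add k h123 h4, pd_add k h12 h3, pd_add k h1 h2,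
      pd_mul k dv (df2 j i), pd_mul k (dv1 i) (df1 j), pd_mul k (dv1 j) (df1 i),
      pd_mul k (differentiableAt_const _) (dv2 j i), pd_mul k hμvf (df1 j), pd_mul k hμv (df1 i),
      pd_mul k (differentiableAt_const _) dv, pd_const, pd_const]
    ring
  have hs : ∀ i j k : ι, pd k (fun y => if i = j then s y else 0) y = if i = j then pd k s y else 0 := by
    intro i j k
    split_ifs
    · rfl
    · exact pd_const k 0
  have c3v := fun i j k => pd_pd_pd_comm hΩ hvs hy i j k
  have c3f := fun i j k => pd_pd_pd_comm hΩ hfs hy i j k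
  have t1 := third i j k
  have t2 := third i k j
  rw [hs, c3v, c3f, cf k j, cf k i, cv k i, cv k j] at t1
  rw [hs, cf j i, cv j i] at t2
  have q1 := H.eq y hy i j
  have q2 := H.eq y hy i k
  have e1 : (if i = j then pd k s y - μ * s y * pd k f y else 0)
      = (if i = j then pd k s y else 0) - μ * pd k f y * (if i = j then s y else 0) := by
    split_ifs <;> ring
  have e2 : (if i = k then pd j s y - μ * s y * pd j f y else 0)
      = (if i = k then pd j s y else 0) - μ * pd j f y * (if i = k then s y else 0) := by
    split_ifs <;> ring
  rw [e1, e2, t1, t2, ← q1, ← q2]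
  ring

end IsFlatQuasiEinstein

end FlatEquation

/-! ### The case `μ = 1 / (2 - n)`: a conformal factor with constant Hessian. -/

section Degenerate

open Set Filter Topology

variable {ι : Type} [Fintype ι] [DecidableEq ι]

theorem eq_of_pd_eq_zero {Ω : Set (EuclideanSpace ℝ ι)} (hΩ : IsOpen Ω) (hc : IsPreconnected Ω)
    {F : EuclideanSpace ℝ ι → ℝ} (hF : ContDiffOn ℝ ∞ F Ω) (h : ∀ y ∈ Ω, ∀ k, pd k F y = 0)
    {x y : EuclideanSpace ℝ ι} (hx : x ∈ Ω) (hy : y ∈ Ω) : F x = F y := by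
  refine hΩ.is_const_of_fderiv_eq_zero hc (hF.differentiableOn (by simp)) (fun z hz => ?_) hx hy
  ext w
  rw [fderiv_eq_sum_dd]
  exact Finset.sum_eq_zero fun i _ => by rw [← pd_eq_dd, h z hz, smul_zero]

theorem pd_exp_div {f : EuclideanSpace ℝ ι → ℝ} {y : EuclideanSpace ℝ ι}
    (hf : DifferentiableAt ℝ f y) (m : ℝ) (k : ι) :
    pd k (fun y => Real.exp (f y / m)) y = Real.exp (f y / m) * (pd k f y / m) := by
  have h1 : HasFDerivAt (fun y => f y / m) (m⁻¹ • fderiv ℝ f y) y := by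
    simpa [div_eq_inv_mul] using hf.hasFDerivAt.const_mul m⁻¹
  unfold pd
  rw [h1.exp.fderiv, smul_apply, smul_apply, smul_eq_mul, smul_eq_mul]
  ring

theorem contDiffOn_exp_div {Ω : Set (EuclideanSpace ℝ ι)} {f : EuclideanSpace ℝ ι → ℝ}
    (hf : ContDiffOn ℝ ∞ f Ω) (m : ℝ) : ContDiffOn ℝ ∞ (fun y => Real.exp (f y / m)) Ω :=
  (hf.div_const m).exp

/-- If `μ = 1 / (2 - N)`, the factor `v exp (f / (N - 2))` has Hessian `C • 1` and defines a metric
of constant curvature. -/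
theorem IsFlatQuasiEinstein.exists_const {Ω : Set (EuclideanSpace ℝ ι)}
    {v f s : EuclideanSpace ℝ ι → ℝ} {μ : ℝ} (H : IsFlatQuasiEinstein Ω v f s μ)
    (hN : 3 ≤ Fintype.card ι) (hμ : 1 + μ * ((Fintype.card ι : ℝ) - 2) = 0)
    (hc : IsPreconnected Ω) (hne : Ω.Nonempty) :
    ∃ C K : ℝ, ∀ y ∈ Ω,
      (∀ i j, pd i (pd j fun y => v y * Real.exp (f y / ((Fintype.card ι : ℝ) - 2))) y
        = if i = j then C else 0) ∧
      2 * (v y * Real.exp (f y / ((Fintype.card ι : ℝ) - 2))) * C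
        - ∑ k, pd k (fun y => v y * Real.exp (f y / ((Fintype.card ι : ℝ) - 2))) y ^ 2 = K := by
  have hm : (Fintype.card ι : ℝ) - 2 ≠ 0 := by
    have : (3 : ℝ) ≤ Fintype.card ι := by exact_mod_cast hN
    linarith
  have hcod := fun y (hy : y ∈ Ω) => H.codazzi hy
  have heq := H.eq
  set m := (Fintype.card ι : ℝ) - 2 with hmdef
  have hΩ := H.isOpen
  have hvs := H.smooth_factor
  have hfs := H.smooth_potential
  have hes := contDiffOn_exp_div hfs m
  have hpv := contDiffOn_pd hΩ hvs
  have hpf := contDiffOn_pd hΩ hfs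
  -- The Codazzi identity has zero left side here, which leaves `ds = μ s df`.
  have hτ : ∀ y ∈ Ω, ∀ k, pd k s y - μ * s y * pd k f y = 0 := by
    intro y hy k
    refine eq_zero_of_kronecker_eq (τ := fun k => pd k s y - μ * s y * pd k f y) (by omega)
      (fun i j k => ?_) k
    rw [← hcod y hy i j k, hμ, zero_mul]
  set z : EuclideanSpace ℝ ι → ℝ := fun y => v y * Real.exp (f y / m) with hz
  have hzs : ContDiffOn ℝ ∞ z Ω := hvs.mul hes
  have dv : ∀ y ∈ Ω, DifferentiableAt ℝ v y := fun y hy =>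
    differentiableAt_of_contDiffOn hΩ hvs hy
  have df : ∀ y ∈ Ω, DifferentiableAt ℝ f y := fun y hy =>
    differentiableAt_of_contDiffOn hΩ hfs hy
  have de : ∀ y ∈ Ω, DifferentiableAt ℝ (fun y => Real.exp (f y / m)) y := fun y hy =>
    differentiableAt_of_contDiffOn hΩ hes hy
  have hz1 : ∀ y ∈ Ω, ∀ j, pd j z y = Real.exp (f y / m) * (pd j v y + v y * (m⁻¹ * pd j f y)) := by
    intro y hy j
    rw [hz, pd_mul j (dv y hy) (de y hy), pd_exp_div (df y hy)]
    ring
  have hz2 : ∀ y ∈ Ω, ∀ i j, pd i (pd j z) y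
      = if i = j then Real.exp (f y / m) * (m⁻¹ * s y) else 0 := by
    intro y hy i j
    have d1 := differentiableAt_of_contDiffOn hΩ (hpv j) hy
    have d2 := differentiableAt_of_contDiffOn hΩ (hpf j) hy
    have d3 : DifferentiableAt ℝ (fun y => m⁻¹ * pd j f y) y := d2.const_mul _
    have d4 : DifferentiableAt ℝ (fun y => v y * (m⁻¹ * pd j f y)) y := (dv y hy).mul d3
    have d5 : DifferentiableAt ℝ (fun y => pd j v y + v y * (m⁻¹ * pd j f y)) y := d1.add d4
    rw [pd_congr_of_eqOn hΩ (fun x hx => hz1 x hx j) hy i, pd_mul i (de y hy) d5, pd_add i d1 d4,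
      pd_mul i (dv y hy) d3, pd_mul i (differentiableAt_const _) d2, pd_const,
      pd_exp_div (df y hy)]
    have e := heq y hy i j
    have hμ' : μ = -m⁻¹ := by
      field_simp
      linear_combination hμ
    rw [hμ'] at e
    have e2 : (if i = j then Real.exp (f y / m) * (m⁻¹ * s y) else 0)
        = Real.exp (f y / m) * m⁻¹ * (if i = j then s y else 0) := by split_ifs <;> ring
    rw [e2, ← e]
    field_simp
    ring
  set c : EuclideanSpace ℝ ι → ℝ := fun y => Real.exp (f y / m) * (m⁻¹ * s y) with hcdef
  have hcs : ContDiffOn ℝ ∞ c Ω := hes.mul (contDiffOn_const.mul H.smooth_trace)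
  -- Since `μ = -1/m`, the relation `ds = μ s df` says exactly that `exp(f/m) s` is constant.
  have hc0 : ∀ y ∈ Ω, ∀ k, pd k c y = 0 := by
    intro y hy k
    have d1 := differentiableAt_of_contDiffOn hΩ H.smooth_trace hy
    have d2 : DifferentiableAt ℝ (fun y => m⁻¹ * s y) y := d1.const_mul _
    rw [hcdef, pd_mul k (de y hy) d2, pd_mul k (differentiableAt_const _) d1, pd_const,
      pd_exp_div (df y hy)]
    have e := hτ y hy k
    have hμ' : μ = -m⁻¹ := by
      field_simp
      linear_combination hμ
    rw [hμ'] at e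
    have e' : pd k s y = -m⁻¹ * s y * pd k f y := by linear_combination e
    rw [e']
    ring
  obtain ⟨x₀, hx₀⟩ := hne
  have hcc : ∀ y ∈ Ω, c y = c x₀ := fun y hy => eq_of_pd_eq_zero hΩ hc hcs hc0 hy hx₀
  have hz3 : ∀ y ∈ Ω, ∀ i j, pd i (pd j z) y = if i = j then c x₀ else 0 := by
    intro y hy i j
    rw [hz2 y hy, ← hcc y hy]
  -- `F` is the curvature of `z⁻²⟨·,·⟩`. Its gradient is `2C ∇z - 2 ∇²z ∇z = 0` as the Hessian of
  -- `z` is `C • 1`.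
  set F : EuclideanSpace ℝ ι → ℝ := fun y => 2 * c x₀ * z y - ∑ k, pd k z y * pd k z y with hF
  have hpz := contDiffOn_pd hΩ hzs
  have hsum : ContDiffOn ℝ ∞ (fun y => ∑ k, pd k z y * pd k z y) Ω :=
    ContDiffOn.sum fun k _ => (hpz k).mul (hpz k)
  have hFs : ContDiffOn ℝ ∞ F Ω := (contDiffOn_const.mul hzs).sub hsum
  have hF0 : ∀ y ∈ Ω, ∀ k, pd k F y = 0 := by
    intro y hy k
    have d1 := differentiableAt_of_contDiffOn hΩ hzs hy
    have d2 := fun i => differentiableAt_of_contDiffOn hΩ (hpz i) hy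
    have d3 : DifferentiableAt ℝ (fun y => 2 * c x₀ * z y) y := d1.const_mul _
    have d4 := differentiableAt_of_contDiffOn hΩ hsum hy
    rw [hF, pd_sub k d3 d4, pd_mul k (differentiableAt_const _) d1, pd_const,
      pd_sum k (f := fun i y => pd i z y * pd i z y) _ fun i _ => (d2 i).mul (d2 i)]
    have e : ∀ i, pd k (fun y => pd i z y * pd i z y) y
        = if k = i then 2 * c x₀ * pd i z y else 0 := by
      intro i
      rw [pd_mul k (d2 i) (d2 i), hz3 y hy]
      split_ifs <;> ring
    simp only [e, Finset.sum_ite_eq, Finset.mem_univ, if_true]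
    ring
  refine ⟨c x₀, F x₀, fun y hy => ⟨hz3 y hy, ?_⟩⟩
  rw [← eq_of_pd_eq_zero hΩ hc hFs hF0 hy hx₀, hF]
  simp only [sq, hz]
  ring

end Degenerate

/-! ### The case `μ ≠ 1 / (2 - n)`: level sets of the potential. -/

section Foliation

open Set Filter Topology

variable {ι : Type} [Fintype ι] [DecidableEq ι]

/-- The metric `v⁻²⟨·,·⟩` and the function `f` without critical points are such that the level
sets of `f` are totally umbilic, and the functions `α` and `D` describing the Hessians of `v` and
`f` along the level sets are constant on them. -/
structure IsUmbilicFoliation (Ω : Set (EuclideanSpace ℝ ι))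
    (v f α D : EuclideanSpace ℝ ι → ℝ) : Prop where
  isOpen : IsOpen Ω
  smooth_factor : ContDiffOn ℝ ∞ v Ω
  smooth_potential : ContDiffOn ℝ ∞ f Ω
  smooth_left : ContDiffOn ℝ ∞ α Ω
  smooth_right : ContDiffOn ℝ ∞ D Ω
  factor_pos : ∀ y ∈ Ω, 0 < v y
  grad_ne : ∀ y ∈ Ω, grad f y ≠ 0
  hess_factor : ∀ y ∈ Ω, ∀ w, inner ℝ (grad f y) w = 0 → fderiv ℝ (grad v) y w = α y • w
  hess_potential : ∀ y ∈ Ω, ∀ w, inner ℝ (grad f y) w = 0 →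
    v y • fderiv ℝ (grad f) y w = D y • w - (inner ℝ (grad v y) w : ℝ) • grad f y
  fderiv_left : ∀ y ∈ Ω, ∀ w, inner ℝ (grad f y) w = 0 → fderiv ℝ α y w = 0
  fderiv_right : ∀ y ∈ Ω, ∀ w, inner ℝ (grad f y) w = 0 → fderiv ℝ D y w = 0

theorem fderiv_grad_apply {Ω : Set (EuclideanSpace ℝ ι)} (hΩ : IsOpen Ω)
    {f : EuclideanSpace ℝ ι → ℝ} (hf : ContDiffOn ℝ ∞ f Ω) {y : EuclideanSpace ℝ ι} (hy : y ∈ Ω)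
    (w : EuclideanSpace ℝ ι) (j : ι) :
    fderiv ℝ (grad f) y w j = ∑ i, w i * pd i (pd j f) y := by
  rw [fderiv_eq_sum_dd]
  simp only [WithLp.ofLp_sum, WithLp.ofLp_smul, Finset.sum_apply, Pi.smul_apply, smul_eq_mul]
  exact Finset.sum_congr rfl fun i _ => by rw [dd_grad_apply hΩ hf hy]

theorem fderiv_eq_zero_of_pd_eq_mul {F f : EuclideanSpace ℝ ι → ℝ} {y w : EuclideanSpace ℝ ι}
    {c : ℝ} (h : ∀ k, pd k F y = c * pd k f y) (hw : inner ℝ (grad f y) w = 0) :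
    fderiv ℝ F y w = 0 := by
  rw [fderiv_eq_sum_dd]
  rw [inner_eq_sum] at hw
  calc ∑ i, w i • dd i F y = c * ∑ i, grad f y i * w i := by
        rw [Finset.mul_sum]
        refine Finset.sum_congr rfl fun i _ => ?_
        rw [← pd_eq_dd, h, grad_apply, smul_eq_mul]
        ring
    _ = 0 := by rw [hw, mul_zero]

theorem sum_pd_sq_ne_zero {f : EuclideanSpace ℝ ι → ℝ} {y : EuclideanSpace ℝ ι}
    (h : grad f y ≠ 0) : ∑ k, pd k f y ^ 2 ≠ 0 := by
  intro h0
  refine h ?_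
  ext k
  have := (Finset.sum_eq_zero_iff_of_nonneg fun k _ => sq_nonneg (pd k f y)).1 h0 k
    (Finset.mem_univ k)
  simpa [grad_apply] using this

/-- With nonzero Codazzi factor, the algebra gives `∇²v = α • 1 + β df ⊗ df` and `ds - μ s df = θ
df`. The equation then determines `v ∇²f` as `D • 1`, with `D = s - mα`, up to terms containing
`df`; on vectors tangent to the level sets only the asserted terms are left. The differentials of
`α` and `s`, hence of `D`, are multiples of `df`. -/
theorem IsFlatQuasiEinstein.exists_isUmbilicFoliation {Ω : Set (EuclideanSpace ℝ ι)}
    {v f s : EuclideanSpace ℝ ι → ℝ} {μ : ℝ} (H : IsFlatQuasiEinstein Ω v f s μ)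
    (hN : 3 ≤ Fintype.card ι) (hμ : 1 + μ * ((Fintype.card ι : ℝ) - 2) ≠ 0)
    (hf0 : ∀ y ∈ Ω, grad f y ≠ 0) : ∃ α D, IsUmbilicFoliation Ω v f α D := by
  have hcod := fun y (hy : y ∈ Ω) => H.codazzi hy
  have heq := H.eq
  set m := (Fintype.card ι : ℝ) - 2 with hmdef
  set κ := 1 + μ * m with hκ
  have hΩ := H.isOpen
  have hvs := H.smooth_factor
  have hfs := H.smooth_potential
  have hpv := contDiffOn_pd hΩ hvs
  have hpf := contDiffOn_pd hΩ hfs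
  have hps := contDiffOn_pd hΩ H.smooth_trace
  have hQ : ∀ y ∈ Ω, ∑ k, pd k f y ^ 2 ≠ 0 := fun y hy => sum_pd_sq_ne_zero (hf0 y hy)
  set τ : ι → EuclideanSpace ℝ ι → ℝ := fun k y => pd k s y - μ * s y * pd k f y with hτ
  set θ : EuclideanSpace ℝ ι → ℝ := fun y => (∑ j, τ j y * pd j f y) / ∑ j, pd j f y ^ 2 with hθ
  set α : EuclideanSpace ℝ ι → ℝ := fun y => -θ y / κ with hα
  set β : EuclideanSpace ℝ ι → ℝ := fun y => (Fintype.card ι * θ y + κ * ∑ j, pd j (pd j v) y)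
    / (κ * ∑ j, pd j f y ^ 2) with hβ
  have hτs : ∀ k, ContDiffOn ℝ ∞ (τ k) Ω := fun k =>
    (hps k).sub ((contDiffOn_const.mul H.smooth_trace).mul (hpf k))
  have hQs : ContDiffOn ℝ ∞ (fun y => ∑ j, pd j f y ^ 2) Ω :=
    ContDiffOn.sum fun k _ => (hpf k).pow 2
  have hθs : ContDiffOn ℝ ∞ θ Ω :=
    ContDiffOn.div (ContDiffOn.sum fun k _ => (hτs k).mul (hpf k)) hQs hQ
  have hαs : ContDiffOn ℝ ∞ α Ω := hθs.neg.div_const _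
  have hΔs : ContDiffOn ℝ ∞ (fun y => ∑ j, pd j (pd j v) y) Ω :=
    ContDiffOn.sum fun k _ => contDiffOn_pd hΩ (hpv k) k
  have hβs : ContDiffOn ℝ ∞ β Ω :=
    ((contDiffOn_const.mul hθs).add (contDiffOn_const.mul hΔs)).div (contDiffOn_const.mul hQs)
      fun y hy => mul_ne_zero hμ (hQ y hy)
  have hmain : ∀ y ∈ Ω, (∀ k, τ k y = θ y * pd k f y) ∧ ∀ i k, pd i (pd k v) y
      = α y * (if i = k then 1 else 0) + β y * (pd i f y * pd k f y) := by
    intro y hy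
    exact eq_of_kronecker_eq_codazzi (V := fun i j => pd i (pd j v) y) (p := fun i => pd i f y)
      (τ := fun k => τ k y) hN hμ (hQ y hy) (fun i j => pd_comm hΩ hvs hy i j) (hcod y hy)
  have hff : ∀ y ∈ Ω, ∀ i j, v y * pd i (pd j f) y = (s y - m * α y) * (if i = j then 1 else 0)
      - pd i v y * pd j f y - pd j v y * pd i f y + (μ * v y - m * β y) * (pd i f y * pd j f y) := by
    intro y hy i j
    have e := heq y hy i j
    rw [(hmain y hy).2 i j] at e
    split_ifs at e ⊢ <;> linear_combination e
  -- The derivative of `∇²v = α • 1 + β df ⊗ df` must be symmetric in all indices. After replacing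
  -- `v ∇²f`, this becomes a Kronecker identity whose right side has the factor `∂ᵢf`, and in
  -- dimension at least three its left side must vanish.
  have hαp : ∀ y ∈ Ω, ∀ k, v y * pd k α y = β y * (s y - m * α y) * pd k f y := by
    intro y hy k
    have dα := differentiableAt_of_contDiffOn hΩ hαs hy
    have dβ := differentiableAt_of_contDiffOn hΩ hβs hy
    have df1 := fun i => differentiableAt_of_contDiffOn hΩ (hpf i) hy
    have third : ∀ i j k, pd k (pd i (pd j v)) y = pd k α y * (if i = j then 1 else 0)
        + β y * (pd i f y * pd k (pd j f) y + pd k (pd i f) y * pd j f y)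
        + pd k β y * (pd i f y * pd j f y) := by
      intro i j k
      have d1 : DifferentiableAt ℝ (fun y => α y * (if i = j then (1 : ℝ) else 0)) y :=
        dα.mul_const _
      have d2 : DifferentiableAt ℝ (fun y => pd i f y * pd j f y) y := (df1 i).mul (df1 j)
      have d3 : DifferentiableAt ℝ (fun y => β y * (pd i f y * pd j f y)) y := dβ.mul d2
      rw [pd_congr_of_eqOn hΩ (fun z hz => (hmain z hz).2 i j) hy k, pd_add k d1 d3,
        pd_mul k dα (differentiableAt_const _), pd_const, pd_mul k dβ d2, pd_mul k (df1 i) (df1 j)]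
      ring
    have key := eq_zero_of_kronecker_eq_mul
      (η := fun k => v y * pd k α y - β y * (s y - m * α y) * pd k f y) (p := fun i => pd i f y)
      (A := fun j k => v y * (pd j β y * pd k f y - pd k β y * pd j f y)
        - β y * (pd j v y * pd k f y - pd k v y * pd j f y)) hN (fun i j k => ?_) k
    · linear_combination key
    · have c := pd_pd_pd_comm hΩ hvs hy i j k
      rw [third i j k, third i k j, pd_comm hΩ hfs hy k j, pd_comm hΩ hfs hy k i,
        pd_comm hΩ hfs hy j i] at c
      have e1 := hff y hy i j
      have e2 := hff y hy i k
      have e3 : ∀ (P : Prop) [Decidable P] (x : ℝ),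
          (if P then x else 0) = x * (if P then 1 else 0) := by
        intro P _ x
        split_ifs <;> simp
      rw [e3 (i = j), e3 (i = k)]
      linear_combination v y * c - β y * pd j f y * e2 + β y * pd k f y * e1
  have hα0 : ∀ y ∈ Ω, ∀ w, inner ℝ (grad f y) w = 0 → fderiv ℝ α y w = 0 := by
    intro y hy w hw
    refine fderiv_eq_zero_of_pd_eq_mul (c := β y * (s y - m * α y) / v y) (fun k => ?_) hw
    have h0 := (H.factor_pos y hy).ne'
    field_simp
    linear_combination hαp y hy k
  have hs0 : ∀ y ∈ Ω, ∀ w, inner ℝ (grad f y) w = 0 → fderiv ℝ s y w = 0 := by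
    intro y hy w hw
    refine fderiv_eq_zero_of_pd_eq_mul (c := θ y + μ * s y) (fun k => ?_) hw
    have e := (hmain y hy).1 k
    simp only [hτ] at e
    linear_combination e
  refine ⟨α, fun y => s y - m * α y, hΩ, hvs, hfs, hαs,
    H.smooth_trace.sub (contDiffOn_const.mul hαs), H.factor_pos, hf0, fun y hy w hw => ?_,
    fun y hy w hw => ?_, hα0, fun y hy w hw => ?_⟩
  · ext j
    rw [fderiv_grad_apply hΩ hvs hy, PiLp.smul_apply, smul_eq_mul]
    rw [inner_eq_sum] at hw
    calc ∑ i, w i * pd i (pd j v) y = ∑ i, ((if i = j then α y * w i else 0)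
          + β y * pd j f y * (grad f y i * w i)) := by
          refine Finset.sum_congr rfl fun i _ => ?_
          rw [(hmain y hy).2, grad_apply]
          split_ifs <;> ring
      _ = α y * w j := by
          rw [Finset.sum_add_distrib, ← Finset.mul_sum, hw]
          simp
  · ext j
    rw [PiLp.smul_apply, fderiv_grad_apply hΩ hfs hy, PiLp.sub_apply, PiLp.smul_apply,
      PiLp.smul_apply, smul_eq_mul, smul_eq_mul, smul_eq_mul, grad_apply]
    rw [inner_eq_sum] at hw ⊢
    calc v y * ∑ i, w i * pd i (pd j f) y
        = ∑ i, ((if i = j then (s y - m * α y) * w i else 0)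
          + (-pd j v y + (μ * v y - m * β y) * pd j f y) * (grad f y i * w i)
          + (-pd j f y) * (grad v y i * w i)) := by
          rw [Finset.mul_sum]
          refine Finset.sum_congr rfl fun i _ => ?_
          have e := hff y hy i j
          rw [grad_apply, grad_apply]
          split_ifs at e ⊢ <;> linear_combination w i * e
      _ = _ := by
          rw [Finset.sum_add_distrib, Finset.sum_add_distrib, ← Finset.mul_sum, ← Finset.mul_sum,
            hw]
          simp only [Finset.sum_ite_eq', Finset.mem_univ, if_true]
          ring
  · have d1 := differentiableAt_of_contDiffOn hΩ H.smooth_trace hy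
    have d2 := differentiableAt_of_contDiffOn hΩ hαs hy
    rw [fderiv_fun_sub d1 (d2.const_mul m), fderiv_const_mul d2]
    simp [hα0 y hy w hw, hs0 y hy w hw]

end Foliation

/-! ### Parametrization of regular level sets. -/

section LevelSet

open Set Filter Topology

variable {ι κ : Type} [Fintype ι] [DecidableEq ι] [Fintype κ] [DecidableEq κ]

/-- A smooth parametrization of a level set at a regular point. -/
theorem exists_levelSet_param (hκ : Fintype.card κ + 1 = Fintype.card ι)
    {Ω : Set (EuclideanSpace ℝ ι)} (hΩ : IsOpen Ω) {f : EuclideanSpace ℝ ι → ℝ}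
    (hf : ContDiffOn ℝ ∞ f Ω) {x₀ : EuclideanSpace ℝ ι} (hx₀ : x₀ ∈ Ω) (h0 : grad f x₀ ≠ 0) :
    ∃ (σ : EuclideanSpace ℝ κ → EuclideanSpace ℝ ι) (U : Set (EuclideanSpace ℝ κ)), IsOpen U ∧
      0 ∈ U ∧ ContDiffOn ℝ ∞ σ U ∧ σ 0 = x₀ ∧ (∀ y ∈ U, σ y ∈ Ω ∧ f (σ y) = f x₀) ∧
      Function.Injective (fderiv ℝ σ 0) := by
  have hfr : Module.finrank ℝ (EuclideanSpace ℝ κ)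
      = Module.finrank ℝ (ℝ ∙ grad f x₀)ᗮ := by
    have : Fact (Module.finrank ℝ (EuclideanSpace ℝ ι) = Fintype.card κ + 1) :=
      ⟨by rw [finrank_euclideanSpace, hκ]⟩
    rw [Submodule.finrank_orthogonal_span_singleton (n := Fintype.card κ) h0, finrank_euclideanSpace]
  set J : EuclideanSpace ℝ κ →L[ℝ] EuclideanSpace ℝ ι :=
    (Submodule.subtypeL _).comp (ContinuousLinearEquiv.ofFinrankEq hfr).toContinuousLinearMap
    with hJ
  have hJ0 : ∀ Y, inner ℝ (grad f x₀) (J Y) = 0 := fun Y =>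
    (Submodule.mem_orthogonal_singleton_iff_inner_right).1
      ((ContinuousLinearEquiv.ofFinrankEq hfr) Y).2
  have hJi : Function.Injective J :=
    Subtype.val_injective.comp (ContinuousLinearEquiv.ofFinrankEq hfr).injective
  set N : EuclideanSpace ℝ ι := (‖grad f x₀‖ ^ 2)⁻¹ • grad f x₀ with hN
  have hN1 : inner ℝ (grad f x₀) N = (1 : ℝ) := by
    rw [hN, real_inner_smul_right, real_inner_self_eq_norm_sq]
    exact inv_mul_cancel₀ (pow_ne_zero 2 (norm_ne_zero_iff.2 h0))
  have hNJ : ∀ Y, inner ℝ N (J Y) = (0 : ℝ) := fun Y => by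
    rw [hN, real_inner_smul_left, hJ0, mul_zero]
  set A : ℝ × EuclideanSpace ℝ κ →L[ℝ] EuclideanSpace ℝ ι :=
    ((ContinuousLinearMap.fst ℝ ℝ _).smulRight N) + J.comp (ContinuousLinearMap.snd ℝ ℝ _) with hA
  have hAap : ∀ q, A q = q.1 • N + J q.2 := fun q => by simp [hA]
  -- `N` is scaled so that `df(N) = 1` and `J` takes values in the kernel of `df`. Hence the
  -- derivative of `F` at `0` is the identity, and the slice of the inverse over the value `f x₀`
  -- parametrizes the level set.
  set F : ℝ × EuclideanSpace ℝ κ → ℝ × EuclideanSpace ℝ κ :=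
    fun q => (f (x₀ + A q), q.2) with hF
  set Z : Set (ℝ × EuclideanSpace ℝ κ) := (fun q => x₀ + A q) ⁻¹' Ω with hZ
  have hAs : ContDiff ℝ ∞ fun q => x₀ + A q := contDiff_const.add A.contDiff
  have hZo : IsOpen Z := hΩ.preimage hAs.continuous
  have hZ0 : (0 : ℝ × EuclideanSpace ℝ κ) ∈ Z := by simp [hZ, hx₀]
  have hFs : ContDiffOn ℝ ∞ F Z :=
    (hf.comp hAs.contDiffOn fun q hq => hq).prodMk contDiff_snd.contDiffOn
  have hF' : HasFDerivAt F (ContinuousLinearEquiv.refl ℝ (ℝ × EuclideanSpace ℝ κ) :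
      ℝ × EuclideanSpace ℝ κ →L[ℝ] ℝ × EuclideanSpace ℝ κ) 0 := by
    have h1 : HasFDerivAt (fun q => x₀ + A q) A 0 := A.hasFDerivAt.const_add x₀
    have h2 : HasFDerivAt f (fderiv ℝ f x₀) (x₀ + A 0) := by
      rw [map_zero, add_zero]
      exact (differentiableAt_of_contDiffOn hΩ hf hx₀).hasFDerivAt
    refine ((h2.comp (0 : ℝ × EuclideanSpace ℝ κ) h1).prodMk hasFDerivAt_snd).congr_fderiv ?_
    ext q
    · simp [hAap, ← inner_grad, hN1]
    · simp
    · simp [hAap, ← inner_grad, hJ0]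
    · simp
  obtain ⟨Θ, hΘ0, hΘZ, hΘF, hΘs, -⟩ := exists_openPartialHomeomorph_of_contDiffOn hZo hFs hZ0
    (ContinuousLinearEquiv.refl ℝ _) hF'
  set U : Set (EuclideanSpace ℝ κ) := (fun y => (f x₀, y)) ⁻¹' Θ.target with hU
  have hF0 : F 0 = (f x₀, 0) := by simp [hF]
  have hUo : IsOpen U := Θ.open_target.preimage (by fun_prop)
  have hU0 : (0 : EuclideanSpace ℝ κ) ∈ U := by
    have := Θ.map_source hΘ0
    rw [hΘF, hF0] at this
    exact this
  have hi : ∀ y ∈ U, f (x₀ + A (Θ.symm (f x₀, y))) = f x₀ ∧ (Θ.symm (f x₀, y)).2 = y := by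
    intro y hy
    have := Θ.right_inv hy
    rw [hΘF] at this
    exact Prod.ext_iff.1 this
  have hs0 : Θ.symm (f x₀, 0) = 0 := by
    rw [← hF0, ← hΘF]
    exact Θ.left_inv hΘ0
  have hS : ContDiffOn ℝ ∞ (fun y => Θ.symm (f x₀, y)) U :=
    hΘs.comp (contDiff_const.prodMk contDiff_id).contDiffOn fun y hy => hy
  refine ⟨fun y => x₀ + A (Θ.symm (f x₀, y)), U, hUo, hU0,
    contDiffOn_const.add (A.contDiff.comp_contDiffOn hS), by simp [hs0],
    fun y hy => ⟨hΘZ (Θ.map_target hy), (hi y hy).1⟩, ?_⟩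
  have hd : HasFDerivAt (fun y => Θ.symm (f x₀, y)) (fderiv ℝ (fun y => Θ.symm (f x₀, y)) 0) 0 :=
    (differentiableAt_of_contDiffOn hUo hS hU0).hasFDerivAt
  set L := fderiv ℝ (fun y => Θ.symm (f x₀, y)) 0 with hL
  -- The second component of `F` is `y` itself, so the inverse retains `y`. With `N` orthogonal to
  -- the range of `J`, this makes the parametrization an immersion.
  have hL2 : ∀ Y, (L Y).2 = Y := by
    intro Y
    have h1 : HasFDerivAt (fun y => (Θ.symm (f x₀, y)).2)
      ((ContinuousLinearMap.snd ℝ ℝ (EuclideanSpace ℝ κ)).comp L) 0 := hd.snd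
    have h2 : (fun y => (Θ.symm (f x₀, y)).2) =ᶠ[𝓝 0] fun y => y := by
      filter_upwards [hUo.mem_nhds hU0] with y hy using (hi y hy).2
    have h3 := h1.unique ((hasFDerivAt_id (𝕜 := ℝ) (0 : EuclideanSpace ℝ κ)).congr_of_eventuallyEq h2)
    simpa using congrArg (fun T => T Y) h3
  have hd2 : HasFDerivAt (fun y => x₀ + A (Θ.symm (f x₀, y))) (A.comp L) 0 :=
    (A.hasFDerivAt.comp 0 hd).const_add x₀
  rw [hd2.fderiv]
  refine (injective_iff_map_eq_zero _).2 fun Y hY => ?_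
  have h1 : (L Y).1 • N + J Y = 0 := by
    have : A (L Y) = 0 := hY
    rwa [hAap, hL2] at this
  have h2 := congrArg (fun w => inner ℝ w (J Y)) h1
  simp only [inner_add_left, real_inner_smul_left, hNJ, mul_zero, zero_add, inner_zero_left] at h2
  exact hJi (by rw [inner_self_eq_zero.1 h2, map_zero])

end LevelSet

/-! ### Mixed derivatives and scalar linear differential equations. -/

section Calculus

open Set Filter Topology

/-- Exchange of the derivatives in the first variable and in the second. -/
theorem hasDerivAt_fderiv_snd {E V : Type*} [NormedAddCommGroup E] [NormedSpace ℝ E]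
    [NormedAddCommGroup V] [NormedSpace ℝ V] {Z : Set (ℝ × E)} (hZ : IsOpen Z) {F G : ℝ × E → V}
    (hF : ContDiffOn ℝ ∞ F Z) (hG : ∀ q ∈ Z, HasDerivAt (fun s => F (s, q.2)) (G q) q.1)
    {q : ℝ × E} (hq : q ∈ Z) (Y : E) :
    HasDerivAt (fun t => fderiv ℝ F (t, q.2) (0, Y)) (fderiv ℝ G q (0, Y)) q.1 := by
  have hline : ∀ q : ℝ × E, HasDerivAt (fun t : ℝ => (t, q.2)) ((1 : ℝ), (0 : E)) q.1 := fun q =>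
    (hasDerivAt_id q.1).prodMk (hasDerivAt_const q.1 q.2)
  have hdF : ∀ q ∈ Z, HasFDerivAt F (fderiv ℝ F q) q := fun q hq =>
    (differentiableAt_of_contDiffOn hZ hF hq).hasFDerivAt
  have hGF : ∀ q ∈ Z, G q = fderiv ℝ F q (1, 0) := by
    intro q hq
    exact (hG q hq).unique ((hdF q hq).comp_hasDerivAt q.1 (hline q))
  have hdd : HasFDerivAt (fderiv ℝ F) (fderiv ℝ (fderiv ℝ F) q) q :=
    (differentiableAt_of_contDiffOn hZ (hF.fderiv_of_isOpen hZ (by simp)) hq).hasFDerivAt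
  have hsym : IsSymmSndFDerivAt ℝ F q :=
    (hF.contDiffAt (hZ.mem_nhds hq)).isSymmSndFDerivAt (by
      simp only [minSmoothness_of_isRCLikeNormedField]
      exact WithTop.coe_le_coe.2 le_top)
  have h1 : HasDerivAt (fun t => fderiv ℝ F (t, q.2) (0, Y))
      (fderiv ℝ (fderiv ℝ F) q (1, 0) (0, Y)) q.1 := by
    have := (hdd.clm_apply (hasFDerivAt_const ((0 : ℝ), Y) q)).comp_hasDerivAt q.1 (hline q)
    exact this.congr_deriv (by simp)
  have h2 : HasFDerivAt G ((fderiv ℝ (fderiv ℝ F) q).flip (1, 0)) q := by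
    have h3 := (hdd.clm_apply (hasFDerivAt_const ((1 : ℝ), (0 : E)) q)).congr_of_eventuallyEq
      (f₁ := G) (by filter_upwards [hZ.mem_nhds hq] with z hz using hGF z hz)
    refine h3.congr_fderiv ?_
    ext <;> simp
  rw [h2.fderiv]
  refine h1.congr_deriv ?_
  exact hsym _ _

theorem hasDerivAt_integral_of_continuousOn {a b : ℝ} (h0 : (0 : ℝ) ∈ Ioo a b) {c : ℝ → ℝ}
    (hc : ContinuousOn c (Ioo a b)) {t : ℝ} (ht : t ∈ Ioo a b) :
    HasDerivAt (fun t => ∫ s in (0 : ℝ)..t, c s) (c t) t := by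
  have hsub : uIcc 0 t ⊆ Ioo a b := ordConnected_Ioo.uIcc_subset h0 ht
  exact intervalIntegral.integral_hasDerivAt_right ((hc.mono hsub).intervalIntegrable)
    (hc.stronglyMeasurableAtFilter isOpen_Ioo t ht) (hc.continuousAt (isOpen_Ioo.mem_nhds ht))

/-- Solutions of the scalar equation `u' = c u`. -/
theorem eq_mul_exp_of_hasDerivAt {a b : ℝ} (h0 : (0 : ℝ) ∈ Ioo a b) {c u : ℝ → ℝ}
    (hc : ContinuousOn c (Ioo a b)) (hu : ∀ t ∈ Ioo a b, HasDerivAt u (c t * u t) t) {t : ℝ}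
    (ht : t ∈ Ioo a b) : u t = u 0 * Real.exp (∫ s in (0 : ℝ)..t, c s) := by
  have hd : ∀ t ∈ Ioo a b, HasDerivAt (fun t => u t * Real.exp (-∫ s in (0 : ℝ)..t, c s)) 0 t := by
    intro t ht
    have h1 := (hu t ht).mul (hasDerivAt_integral_of_continuousOn h0 hc ht).neg.exp
    refine h1.congr_deriv ?_
    simp only [Pi.neg_apply]
    ring
  have h := isOpen_Ioo.is_const_of_deriv_eq_zero isPreconnected_Ioo
    (fun t ht => (hd t ht).differentiableAt.differentiableWithinAt)
    (fun t ht => (hd t ht).deriv) ht h0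
  simp only [intervalIntegral.integral_same, neg_zero, Real.exp_zero, mul_one] at h
  rw [← h, mul_assoc, ← Real.exp_add, neg_add_cancel, Real.exp_zero, mul_one]

end Calculus

/-! ### Geometry of the level sets of an umbilic foliation. -/

section UnitNormal

open Set Filter Topology

variable {ι : Type} [Fintype ι] [DecidableEq ι] {v f α D : EuclideanSpace ℝ ι → ℝ}

/-- The unit gradient field of `f` for the metric `v⁻²⟨·,·⟩`. -/
def unitGrad (v f : EuclideanSpace ℝ ι → ℝ) (y : EuclideanSpace ℝ ι) : EuclideanSpace ℝ ι :=
  (v y * ‖grad f y‖⁻¹) • grad f y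

/-- The norm of the gradient of `f` for the metric `v⁻²⟨·,·⟩`. -/
def speed (v f : EuclideanSpace ℝ ι → ℝ) (y : EuclideanSpace ℝ ι) : ℝ := v y * ‖grad f y‖

/-- The principal curvature of the level sets of `f`. -/
def bending (v f D : EuclideanSpace ℝ ι → ℝ) (y : EuclideanSpace ℝ ι) : ℝ :=
  (D y - inner ℝ (grad v y) (grad f y)) * ‖grad f y‖⁻¹

/-- The ambient sectional curvature of the planes tangent to the level sets of `f`. -/
def tangentCurvature (v α : EuclideanSpace ℝ ι → ℝ) (y : EuclideanSpace ℝ ι) : ℝ :=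
  2 * v y * α y - inner ℝ (grad v y) (grad v y)

namespace IsUmbilicFoliation

variable {Ω : Set (EuclideanSpace ℝ ι)} (H : IsUmbilicFoliation Ω v f α D)

include H

theorem smooth_norm : ContDiffOn ℝ ∞ (fun y => ‖grad f y‖) Ω :=
  (contDiffOn_grad H.isOpen H.smooth_potential).norm ℝ H.grad_ne

theorem norm_pos {y : EuclideanSpace ℝ ι} (hy : y ∈ Ω) : 0 < ‖grad f y‖ :=
  norm_pos_iff.2 (H.grad_ne y hy)

theorem smooth_inv_norm : ContDiffOn ℝ ∞ (fun y => ‖grad f y‖⁻¹) Ω :=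
  H.smooth_norm.inv fun _ hy => (H.norm_pos hy).ne'

theorem smooth_unitGrad : ContDiffOn ℝ ∞ (unitGrad v f) Ω :=
  (H.smooth_factor.mul H.smooth_inv_norm).smul (contDiffOn_grad H.isOpen H.smooth_potential)

theorem smooth_speed : ContDiffOn ℝ ∞ (speed v f) Ω := H.smooth_factor.mul H.smooth_norm

theorem smooth_bending : ContDiffOn ℝ ∞ (bending v f D) Ω :=
  (H.smooth_right.sub ((contDiffOn_grad H.isOpen H.smooth_factor).inner ℝ
    (contDiffOn_grad H.isOpen H.smooth_potential))).mul H.smooth_inv_norm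

theorem smooth_tangentCurvature : ContDiffOn ℝ ∞ (tangentCurvature v α) Ω :=
  ((contDiffOn_const.mul H.smooth_factor).mul H.smooth_left).sub
    ((contDiffOn_grad H.isOpen H.smooth_factor).inner ℝ (contDiffOn_grad H.isOpen H.smooth_factor))

theorem speed_pos {y : EuclideanSpace ℝ ι} (hy : y ∈ Ω) : 0 < speed v f y :=
  mul_pos (H.factor_pos y hy) (H.norm_pos hy)

theorem inner_unitGrad_self {y : EuclideanSpace ℝ ι} (hy : y ∈ Ω) :
    inner ℝ (unitGrad v f y) (unitGrad v f y) = v y ^ 2 := by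
  have := (H.norm_pos hy).ne'
  rw [unitGrad, real_inner_smul_left, real_inner_smul_right, real_inner_self_eq_norm_sq]
  field_simp

theorem inner_unitGrad {y w : EuclideanSpace ℝ ι} (hw : inner ℝ (grad f y) w = 0) :
    inner ℝ (unitGrad v f y) w = 0 := by
  rw [unitGrad, real_inner_smul_left, hw, mul_zero]

theorem fderiv_unitGrad_potential {y : EuclideanSpace ℝ ι} (hy : y ∈ Ω) :
    fderiv ℝ f y (unitGrad v f y) = speed v f y := by
  have := (H.norm_pos hy).ne'
  rw [← inner_grad, unitGrad, real_inner_smul_right, real_inner_self_eq_norm_sq, speed]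
  field_simp

section Tangent

variable {y w : EuclideanSpace ℝ ι} (hy : y ∈ Ω) (hw : inner ℝ (grad f y) w = 0)

include hy hw

/-- Differentiating `‖grad f‖²` along a tangent vector `w` involves only the component of `∇²f w`
along `grad f`, which `hess_potential` gives as `-⟨grad v, w⟩ grad f / v`. -/
theorem fderiv_norm_grad : fderiv ℝ (fun y => ‖grad f y‖) y w
    = -(‖grad f y‖ * (v y)⁻¹) * inner ℝ (grad v y) w := by
  have hN := (H.norm_pos hy).ne'
  have hv := (H.factor_pos y hy).ne'
  have dg := differentiableAt_of_contDiffOn H.isOpen (contDiffOn_grad H.isOpen H.smooth_potential) hy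
  have dN := differentiableAt_of_contDiffOn H.isOpen H.smooth_norm hy
  have e : (fun y => ‖grad f y‖ * ‖grad f y‖) = fun y => inner ℝ (grad f y) (grad f y) := by
    ext1 y
    rw [real_inner_self_eq_norm_mul_norm]
  have e1 := congrArg (fun F => fderiv ℝ F y w) e
  simp only [fderiv_fun_mul dN dN, fderiv_inner_apply ℝ dg dg, add_apply,
    smul_apply, smul_eq_mul] at e1
  have e2 := congrArg (fun z => inner ℝ (grad f y) z) (H.hess_potential y hy w hw)
  simp only [real_inner_smul_right, inner_sub_right, hw, real_inner_self_eq_norm_sq] at e2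
  rw [real_inner_comm (grad f y) (fderiv ℝ (grad f) y w)] at e1
  field_simp
  refine mul_left_cancel₀ hN ?_
  linear_combination v y / 2 * e1 + e2

theorem fderiv_inv_norm_grad : fderiv ℝ (fun y => ‖grad f y‖⁻¹) y w
    = (‖grad f y‖⁻¹ * (v y)⁻¹) * inner ℝ (grad v y) w := by
  have hN := (H.norm_pos hy).ne'
  have dN := differentiableAt_of_contDiffOn H.isOpen H.smooth_norm hy
  have h1 : HasFDerivAt (fun y => ‖grad f y‖⁻¹)
      ((-(‖grad f y‖ ^ 2)⁻¹) • fderiv ℝ (fun y => ‖grad f y‖) y) y :=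
    (hasDerivAt_inv hN).comp_hasFDerivAt y dN.hasFDerivAt
  rw [h1.fderiv, smul_apply, smul_eq_mul, H.fderiv_norm_grad hy hw]
  field_simp

/-- The logarithmic derivatives of `v` and of `‖grad f‖` along a level set are opposite. Constancy
of the speed is what makes the unit gradient flow preserve the level sets. -/
theorem fderiv_speed : fderiv ℝ (speed v f) y w = 0 := by
  have hv := (H.factor_pos y hy).ne'
  have dN := differentiableAt_of_contDiffOn H.isOpen H.smooth_norm hy
  have dv := differentiableAt_of_contDiffOn H.isOpen H.smooth_factor hy
  have e : speed v f = fun y => v y * ‖grad f y‖ := rfl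
  rw [e, fderiv_fun_mul dv dN]
  simp only [add_apply, smul_apply, smul_eq_mul,
    H.fderiv_norm_grad hy hw, ← inner_grad]
  field_simp
  ring

/-- This expresses umbilicity: the bracket multiplied by `(v y)⁻¹` is the difference between the
flat connection and that of `v⁻²⟨·,·⟩`, so the shape operator is `bending` times the identity. -/
theorem fderiv_unitGrad : fderiv ℝ (unitGrad v f) y w = bending v f D y • w
    + (v y)⁻¹ • ((inner ℝ (grad v y) w : ℝ) • unitGrad v f y
      + (inner ℝ (grad v y) (unitGrad v f y) : ℝ) • w) := by
  have hv := (H.factor_pos y hy).ne'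
  have hN := (H.norm_pos hy).ne'
  have dv := differentiableAt_of_contDiffOn H.isOpen H.smooth_factor hy
  have di := differentiableAt_of_contDiffOn H.isOpen H.smooth_inv_norm hy
  have dg := differentiableAt_of_contDiffOn H.isOpen (contDiffOn_grad H.isOpen H.smooth_potential) hy
  have dm : DifferentiableAt ℝ (fun y => v y * ‖grad f y‖⁻¹) y := dv.mul di
  have e : unitGrad v f = fun y => (v y * ‖grad f y‖⁻¹) • grad f y := rfl
  have e1 : fderiv ℝ (grad f) y w
      = (v y)⁻¹ • (D y • w - (inner ℝ (grad v y) w : ℝ) • grad f y) := by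
    rw [← H.hess_potential y hy w hw, smul_smul, inv_mul_cancel₀ hv, one_smul]
  rw [e, fderiv_fun_smul dm dg, fderiv_fun_mul dv di]
  simp only [add_apply, smul_apply, ContinuousLinearMap.smulRight_apply,
    smul_eq_mul, H.fderiv_inv_norm_grad hy hw, ← inner_grad, e1, real_inner_smul_right, bending]
  match_scalars <;> field_simp <;> ring

/-- Since `D` is constant along the level set and `∇²v w = α w` is orthogonal to `grad f`, the
numerator changes only through `∇²f w`. That change cancels against the derivative of `‖grad f‖⁻¹`.
-/
theorem fderiv_bending : fderiv ℝ (bending v f D) y w = 0 := by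
  have hv := (H.factor_pos y hy).ne'
  have hN := (H.norm_pos hy).ne'
  have dD := differentiableAt_of_contDiffOn H.isOpen H.smooth_right hy
  have di := differentiableAt_of_contDiffOn H.isOpen H.smooth_inv_norm hy
  have dg := differentiableAt_of_contDiffOn H.isOpen (contDiffOn_grad H.isOpen H.smooth_potential) hy
  have dh := differentiableAt_of_contDiffOn H.isOpen (contDiffOn_grad H.isOpen H.smooth_factor) hy
  have dn : DifferentiableAt ℝ (fun y => (inner ℝ (grad v y) (grad f y) : ℝ)) y := dh.inner ℝ dg
  have ds : DifferentiableAt ℝ (fun y => D y - inner ℝ (grad v y) (grad f y)) y := dD.sub dn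
  have e : bending v f D = fun y => (D y - inner ℝ (grad v y) (grad f y)) * ‖grad f y‖⁻¹ := rfl
  have e1 : fderiv ℝ (grad f) y w
      = (v y)⁻¹ • (D y • w - (inner ℝ (grad v y) w : ℝ) • grad f y) := by
    rw [← H.hess_potential y hy w hw, smul_smul, inv_mul_cancel₀ hv, one_smul]
  rw [e, fderiv_fun_mul ds di, fderiv_fun_sub dD dn]
  simp only [add_apply, smul_apply, sub_apply, smul_eq_mul, H.fderiv_inv_norm_grad hy hw,
    fderiv_inner_apply ℝ dh dg, H.fderiv_right y hy w hw, H.hess_factor y hy w hw, e1,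
    real_inner_smul_left, real_inner_smul_right, inner_sub_right, real_inner_comm (grad f y) w, hw]
  field_simp
  ring

/-- The derivative of `2vα` is `2α ⟨grad v, w⟩`, and that of `|grad v|²` is the same because `∇²v w
= α w`. -/
theorem fderiv_tangentCurvature : fderiv ℝ (tangentCurvature v α) y w = 0 := by
  have dv := differentiableAt_of_contDiffOn H.isOpen H.smooth_factor hy
  have dα := differentiableAt_of_contDiffOn H.isOpen H.smooth_left hy
  have dh := differentiableAt_of_contDiffOn H.isOpen (contDiffOn_grad H.isOpen H.smooth_factor) hy
  have dn : DifferentiableAt ℝ (fun y => (inner ℝ (grad v y) (grad v y) : ℝ)) y := dh.inner ℝ dh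
  have d2 : DifferentiableAt ℝ (fun y => 2 * v y) y := dv.const_mul 2
  have d3 : DifferentiableAt ℝ (fun y => 2 * v y * α y) y := d2.mul dα
  have e : tangentCurvature v α = fun y => 2 * v y * α y - inner ℝ (grad v y) (grad v y) := rfl
  rw [e, fderiv_fun_sub d3 dn, fderiv_fun_mul d2 dα, fderiv_const_mul dv]
  simp only [add_apply, smul_apply, sub_apply, smul_eq_mul,
    fderiv_inner_apply ℝ dh dh, H.fderiv_left y hy w hw, H.hess_factor y hy w hw, ← inner_grad,
    real_inner_smul_left, real_inner_smul_right, real_inner_comm (grad v y) w]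
  ring

end Tangent

/-- Subtracting the component of `w` along `grad f` leaves a tangent vector, on which the derivative
of the speed vanishes. The resulting proportionality to `df` closes the differential equation used
in `IsFlowBox.inner_grad_fderiv`. -/
theorem fderiv_speed_eq_mul {y : EuclideanSpace ℝ ι} (hy : y ∈ Ω) (w : EuclideanSpace ℝ ι) : fderiv ℝ (speed v f) y w
    = (fderiv ℝ (speed v f) y (grad f y) * (‖grad f y‖⁻¹ * ‖grad f y‖⁻¹)) * fderiv ℝ f y w := by
  have hN := (H.norm_pos hy).ne'
  set c : ℝ := inner ℝ (grad f y) w * (‖grad f y‖⁻¹ * ‖grad f y‖⁻¹) with hc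
  have h1 : inner ℝ (grad f y) (w - c • grad f y) = 0 := by
    rw [inner_sub_right, real_inner_smul_right, real_inner_self_eq_norm_mul_norm, hc]
    field_simp
    ring
  have h2 := H.fderiv_speed hy h1
  rw [map_sub, map_smul, smul_eq_mul] at h2
  rw [← inner_grad f]
  linear_combination h2

end IsUmbilicFoliation

end UnitNormal

/-! ### Flow box coordinates along the unit gradient. -/

section FlowBox

open Set Filter Topology

variable {ι κ : Type} [Fintype ι] [DecidableEq ι] [Fintype κ] [DecidableEq κ]
  {v f α D : EuclideanSpace ℝ ι → ℝ}

/-- Coordinates `(t, y)` such that `t` is the arc length along the unit gradient field of `f` and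
`y` parametrizes a level set of `f` at `t = 0`. -/
structure IsFlowBox (Ω : Set (EuclideanSpace ℝ ι)) (v f : EuclideanSpace ℝ ι → ℝ)
    (Θ : OpenPartialHomeomorph (ℝ × EuclideanSpace ℝ κ) (EuclideanSpace ℝ ι)) (ε : ℝ) : Prop where
  pos : 0 < ε
  source_eq : Θ.source = Ioo (-ε) ε ×ˢ Metric.ball 0 ε
  smooth : ContDiffOn ℝ ∞ Θ Θ.source
  smooth_symm : ContDiffOn ℝ ∞ Θ.symm Θ.target
  mem : ∀ q ∈ Θ.source, Θ q ∈ Ω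
  hasDerivAt : ∀ q ∈ Θ.source, HasDerivAt (fun s => Θ (s, q.2)) (unitGrad v f (Θ q)) q.1
  equiv : ∀ q ∈ Θ.source, ∃ L : (ℝ × EuclideanSpace ℝ κ) ≃L[ℝ] EuclideanSpace ℝ ι,
    HasFDerivAt Θ (L : ℝ × EuclideanSpace ℝ κ →L[ℝ] EuclideanSpace ℝ ι) q
  level : ∀ y ∈ Metric.ball (0 : EuclideanSpace ℝ κ) ε, f (Θ (0, y)) = f (Θ (0, 0))

theorem hasDerivAt_line {E : Type*} [NormedAddCommGroup E] [NormedSpace ℝ E] (q : ℝ × E) :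
    HasDerivAt (fun t : ℝ => (t, q.2)) ((1 : ℝ), (0 : E)) q.1 :=
  (hasDerivAt_id q.1).prodMk (hasDerivAt_const q.1 q.2)

theorem hasFDerivAt_slice {E : Type*} [NormedAddCommGroup E] [NormedSpace ℝ E] (t : ℝ) (y : E) :
    HasFDerivAt (fun y : E => (t, y)) (ContinuousLinearMap.inr ℝ ℝ E) y :=
  (hasFDerivAt_const t y).prodMk (hasFDerivAt_id y)

/-- The map is `(t, y) ↦ Fl (t, σ y)`, with `Fl` the unit gradient flow and `σ` a parametrized level
set. At the origin its derivative sends `(1, 0)` to the normal and `(0, Y)` injectively to tangent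
vectors, so it is injective and, by dimension, invertible. -/
theorem IsUmbilicFoliation.exists_isFlowBox {Ω : Set (EuclideanSpace ℝ ι)}
    (H : IsUmbilicFoliation Ω v f α D) (hκ : Fintype.card κ + 1 = Fintype.card ι)
    {x₀ : EuclideanSpace ℝ ι} (hx₀ : x₀ ∈ Ω) :
    ∃ (Θ : OpenPartialHomeomorph (ℝ × EuclideanSpace ℝ κ) (EuclideanSpace ℝ ι)) (ε : ℝ),
      IsFlowBox Ω v f Θ ε ∧ Θ (0, 0) = x₀ := by
  obtain ⟨σ, U, hU, h0U, hσ, hσ0, hσf, hσi⟩ :=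
    exists_levelSet_param (κ := κ) hκ H.isOpen H.smooth_potential hx₀ (H.grad_ne x₀ hx₀)
  obtain ⟨Fl, W, hW, h0W, hFl, hFl0, hFlX⟩ := exists_contDiffOn_flow H.isOpen H.smooth_unitGrad hx₀
  set j : ℝ × EuclideanSpace ℝ κ → ℝ × EuclideanSpace ℝ ι := fun q => (q.1, σ q.2) with hj
  have hjs : ContDiffOn ℝ ∞ j (univ ×ˢ U) :=
    contDiff_fst.contDiffOn.prodMk (hσ.comp contDiff_snd.contDiffOn fun q hq => hq.2)
  set Z : Set (ℝ × EuclideanSpace ℝ κ) := (univ ×ˢ U) ∩ j ⁻¹' W with hZ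
  have hZo : IsOpen Z := hjs.continuousOn.isOpen_inter_preimage (isOpen_univ.prod hU) hW
  have h0Z : ((0, 0) : ℝ × EuclideanSpace ℝ κ) ∈ Z := by
    refine ⟨⟨mem_univ _, h0U⟩, ?_⟩
    simp only [hj, mem_preimage, hσ0]
    exact h0W
  set F : ℝ × EuclideanSpace ℝ κ → EuclideanSpace ℝ ι := fun q => Fl (q.1, σ q.2) with hF
  have hFs : ContDiffOn ℝ ∞ F Z := hFl.comp (hjs.mono inter_subset_left) fun q hq => hq.2
  have hFt : ∀ q ∈ Z, HasDerivAt (fun s => F (s, q.2)) (unitGrad v f (F q)) q.1 :=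
    fun q hq => (hFlX _ hq.2).2
  have hF0 : ∀ y, ((0, y) : ℝ × EuclideanSpace ℝ κ) ∈ Z → F (0, y) = σ y := fun y hy =>
    hFl0 (σ y) hy.2
  have hd := (differentiableAt_of_contDiffOn hZo hFs h0Z).hasFDerivAt
  set A := fderiv ℝ F (0, 0) with hA
  have hA1 : A (1, 0) = unitGrad v f x₀ := by
    have h1 := hFt _ h0Z
    rw [hF0 0 h0Z, hσ0] at h1
    have h3 : HasDerivAt (fun s : ℝ => (s, (0 : EuclideanSpace ℝ κ))) ((1 : ℝ), 0) 0 :=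
      hasDerivAt_line ((0 : ℝ), (0 : EuclideanSpace ℝ κ))
    have h2 : HasDerivAt (fun s => F (s, (0 : EuclideanSpace ℝ κ))) (A (1, 0)) (0 : ℝ) :=
      HasFDerivAt.comp_hasDerivAt (l := F) (f := fun s : ℝ => (s, (0 : EuclideanSpace ℝ κ)))
        (0 : ℝ) hd h3
    exact h2.unique h1
  have hA2 : ∀ Y, A (0, Y) = fderiv ℝ σ 0 Y := by
    intro Y
    have h1 := hd.comp (0 : EuclideanSpace ℝ κ) (hasFDerivAt_slice 0 0)
    have h2 : (F ∘ fun y => (0, y)) =ᶠ[𝓝 0] σ := by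
      have : (fun y : EuclideanSpace ℝ κ => ((0 : ℝ), y)) ⁻¹' Z ∈ 𝓝 0 :=
        (hZo.preimage (by fun_prop)).mem_nhds h0Z
      filter_upwards [this] with y hy using hF0 y hy
    have h3 := (h1.congr_of_eventuallyEq h2.symm).fderiv
    rw [h3]
    rfl
  have hσt : ∀ Y, inner ℝ (grad f x₀) (fderiv ℝ σ 0 Y) = 0 := by
    intro Y
    have h1 : HasFDerivAt f (fderiv ℝ f x₀) (σ 0) := by
      rw [hσ0]
      exact (differentiableAt_of_contDiffOn H.isOpen H.smooth_potential hx₀).hasFDerivAt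
    have h2 := h1.comp (0 : EuclideanSpace ℝ κ)
      (differentiableAt_of_contDiffOn hU hσ h0U).hasFDerivAt
    have h3 : (f ∘ σ) =ᶠ[𝓝 0] fun _ => f x₀ := by
      filter_upwards [hU.mem_nhds h0U] with y hy using (hσf y hy).2
    have h4 := (h2.congr_of_eventuallyEq h3.symm).unique (hasFDerivAt_const (f x₀) 0)
    rw [inner_grad]
    simpa using congrArg (fun T => T Y) h4
  have hsplit : ∀ q : ℝ × EuclideanSpace ℝ κ, A q = q.1 • unitGrad v f x₀ + fderiv ℝ σ 0 q.2 := by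
    intro q
    have : q = q.1 • ((1 : ℝ), (0 : EuclideanSpace ℝ κ)) + (0, q.2) := by ext <;> simp
    rw [this, map_add, map_smul, hA1, hA2]
    simp
  have hAi : Function.Injective A := by
    refine (injective_iff_map_eq_zero _).2 fun q hq => ?_
    rw [hsplit] at hq
    have h1 := congrArg (fun z => inner ℝ (unitGrad v f x₀) z) hq
    simp only [inner_add_right, real_inner_smul_right, H.inner_unitGrad_self hx₀,
      H.inner_unitGrad (hσt q.2), add_zero, inner_zero_right] at h1
    have hq1 : q.1 = 0 := (mul_eq_zero.1 h1).resolve_right (pow_ne_zero 2 (H.factor_pos x₀ hx₀).ne')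
    rw [hq1, zero_smul, zero_add] at hq
    exact Prod.ext hq1 (hσi (by rw [hq, Prod.snd_zero, map_zero]))
  have hfin : Module.finrank ℝ (ℝ × EuclideanSpace ℝ κ)
      = Module.finrank ℝ (EuclideanSpace ℝ ι) := by
    rw [Module.finrank_prod, Module.finrank_self, finrank_euclideanSpace, finrank_euclideanSpace]
    omega
  set L : (ℝ × EuclideanSpace ℝ κ) ≃L[ℝ] EuclideanSpace ℝ ι :=
    (LinearEquiv.ofInjectiveOfFinrankEq (A : ℝ × EuclideanSpace ℝ κ →ₗ[ℝ] EuclideanSpace ℝ ι)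
      hAi hfin).toContinuousLinearEquiv with hL
  have hLA : (L : ℝ × EuclideanSpace ℝ κ →L[ℝ] EuclideanSpace ℝ ι) = A :=
    ContinuousLinearMap.ext fun _ => rfl
  obtain ⟨Θ, hΘ0, hΘZ, hΘF, hΘs, hΘL⟩ := exists_openPartialHomeomorph_of_contDiffOn hZo hFs h0Z L
    (by rw [hLA]; exact hd)
  obtain ⟨ε, hε, hball⟩ := Metric.isOpen_iff.1 Θ.open_source _ hΘ0
  set B : Set (ℝ × EuclideanSpace ℝ κ) := Ioo (-ε) ε ×ˢ Metric.ball 0 ε with hB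
  have hBo : IsOpen B := isOpen_Ioo.prod Metric.isOpen_ball
  have hBΘ : B ⊆ Θ.source := by
    refine Subset.trans ?_ hball
    rw [← ball_prod_same, Real.ball_eq_Ioo, zero_sub, zero_add]
  have hsrc : (Θ.restrOpen B hBo).source = B := by
    rw [OpenPartialHomeomorph.restrOpen_source]
    exact inter_eq_self_of_subset_right hBΘ
  have hap : ∀ q, (Θ.restrOpen B hBo) q = F q := fun q => hΘF q
  have hfun : ((Θ.restrOpen B hBo : OpenPartialHomeomorph _ _) :
      ℝ × EuclideanSpace ℝ κ → EuclideanSpace ℝ ι) = F := funext hap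
  have hBZ : B ⊆ Z := hBΘ.trans hΘZ
  refine ⟨Θ.restrOpen B hBo, ε, ⟨hε, hsrc, ?_, ?_, ?_, ?_, ?_, ?_⟩, ?_⟩
  · rw [hfun, hsrc]
    exact hFs.mono hBZ
  · exact hΘs.mono fun x hx => hx.1
  · intro q hq
    rw [hsrc] at hq
    rw [hap]
    exact (hFlX _ (hBZ hq).2).1
  · intro q hq
    rw [hsrc] at hq
    rw [hfun]
    exact hFt q (hBZ hq)
  · intro q hq
    rw [hsrc] at hq
    rw [hfun]
    exact hΘL q (hBΘ hq)
  · intro y hy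
    have h1 : ∀ y ∈ Metric.ball (0 : EuclideanSpace ℝ κ) ε, (0, y) ∈ Z := fun y hy =>
      hBZ ⟨⟨neg_lt_zero.2 hε, hε⟩, hy⟩
    rw [hap, hap, hF0 y (h1 y hy), hF0 0 h0Z, (hσf y (h1 y hy).1.2).2, hσ0]
  · rw [hap, hF0 0 h0Z, hσ0]

end FlowBox

/-! ### The metric in flow box coordinates. -/

section WarpedProduct

open Set Filter Topology

variable {ι κ : Type} [Fintype ι] [DecidableEq ι] [Fintype κ] [DecidableEq κ]
  {v f α D : EuclideanSpace ℝ ι → ℝ} {Ω : Set (EuclideanSpace ℝ ι)}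
  {Θ : OpenPartialHomeomorph (ℝ × EuclideanSpace ℝ κ) (EuclideanSpace ℝ ι)} {ε : ℝ}

namespace IsFlowBox

theorem hasFDerivAt (B : IsFlowBox Ω v f Θ ε) {q : ℝ × EuclideanSpace ℝ κ} (hq : q ∈ Θ.source) :
    HasFDerivAt Θ (fderiv ℝ Θ q) q :=
  (differentiableAt_of_contDiffOn Θ.open_source B.smooth hq).hasFDerivAt

theorem zero_mem (B : IsFlowBox Ω v f Θ ε) : (0 : ℝ) ∈ Ioo (-ε) ε := ⟨neg_lt_zero.2 B.pos, B.pos⟩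

theorem mk_mem (B : IsFlowBox Ω v f Θ ε) {t : ℝ} {y : EuclideanSpace ℝ κ} (ht : t ∈ Ioo (-ε) ε)
    (hy : y ∈ Metric.ball 0 ε) : (t, y) ∈ Θ.source := by
  rw [B.source_eq]
  exact ⟨ht, hy⟩

theorem fderiv_apply (B : IsFlowBox Ω v f Θ ε) {q : ℝ × EuclideanSpace ℝ κ} (hq : q ∈ Θ.source)
    (p : ℝ × EuclideanSpace ℝ κ) :
    fderiv ℝ Θ q p = p.1 • unitGrad v f (Θ q) + fderiv ℝ Θ q (0, p.2) := by
  have h1 : HasDerivAt (fun s => Θ (s, q.2)) (fderiv ℝ Θ q (1, 0)) q.1 :=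
    (B.hasFDerivAt hq).comp_hasDerivAt q.1 (hasDerivAt_line q)
  rw [(B.hasDerivAt q hq).unique h1, ← map_smul, ← map_add]
  congr 1
  ext <;> simp

theorem fderiv_slice (B : IsFlowBox Ω v f Θ ε) {t : ℝ} {y : EuclideanSpace ℝ κ}
    (hq : (t, y) ∈ Θ.source) :
    HasFDerivAt (fun y => Θ (t, y))
      ((fderiv ℝ Θ (t, y)).comp (ContinuousLinearMap.inr ℝ ℝ (EuclideanSpace ℝ κ))) y :=
  (B.hasFDerivAt hq).comp y (hasFDerivAt_slice t y)

theorem smooth_slice (B : IsFlowBox Ω v f Θ ε) {t : ℝ} (ht : t ∈ Ioo (-ε) ε) :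
    ContDiffOn ℝ ∞ (fun y => Θ (t, y)) (Metric.ball 0 ε) :=
  B.smooth.comp (contDiff_const.prodMk contDiff_id).contDiffOn fun _ hy => B.mk_mem ht hy

theorem smooth_line (B : IsFlowBox Ω v f Θ ε) {y : EuclideanSpace ℝ κ}
    (hy : y ∈ Metric.ball 0 ε) : ContDiffOn ℝ ∞ (fun t => Θ (t, y)) (Ioo (-ε) ε) :=
  B.smooth.comp (contDiff_id.prodMk contDiff_const).contDiffOn fun _ ht => B.mk_mem ht hy

variable (B : IsFlowBox Ω v f Θ ε) (H : IsUmbilicFoliation Ω v f α D)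

include B H

theorem hasDerivAt_potential {q : ℝ × EuclideanSpace ℝ κ} (hq : q ∈ Θ.source) :
    HasDerivAt (fun s => f (Θ (s, q.2))) (speed v f (Θ q)) q.1 := by
  have h1 : HasFDerivAt f (fderiv ℝ f (Θ q)) (Θ (q.1, q.2)) :=
    (differentiableAt_of_contDiffOn H.isOpen H.smooth_potential (B.mem q hq)).hasFDerivAt
  have h2 := h1.comp_hasDerivAt q.1 (B.hasDerivAt q hq)
  rwa [H.fderiv_unitGrad_potential (B.mem q hq)] at h2

/-- The maps `Θ (t, ·)` are tangent to the level sets of `f`. -/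
theorem inner_grad_fderiv {q : ℝ × EuclideanSpace ℝ κ} (hq : q ∈ Θ.source)
    (Y : EuclideanSpace ℝ κ) : inner ℝ (grad f (Θ q)) (fderiv ℝ Θ q (0, Y)) = 0 := by
  have hF : ContDiffOn ℝ ∞ (fun q => f (Θ q)) Θ.source := H.smooth_potential.comp B.smooth B.mem
  have hFd : ∀ q ∈ Θ.source, fderiv ℝ (fun q => f (Θ q)) q (0, Y)
      = fderiv ℝ f (Θ q) (fderiv ℝ Θ q (0, Y)) := by
    intro q hq
    have h1 := (differentiableAt_of_contDiffOn H.isOpen H.smooth_potential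
      (B.mem q hq)).hasFDerivAt.comp q (B.hasFDerivAt hq)
    exact congrArg (fun T => T (0, Y)) h1.fderiv
  have hGd : ∀ q ∈ Θ.source, fderiv ℝ (fun q => speed v f (Θ q)) q (0, Y)
      = fderiv ℝ (speed v f) (Θ q) (fderiv ℝ Θ q (0, Y)) := by
    intro q hq
    have h1 := (differentiableAt_of_contDiffOn H.isOpen H.smooth_speed
      (B.mem q hq)).hasFDerivAt.comp q (B.hasFDerivAt hq)
    exact congrArg (fun T => T (0, Y)) h1.fderiv
  set c : EuclideanSpace ℝ ι → ℝ := fun x =>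
    fderiv ℝ (speed v f) x (grad f x) * (‖grad f x‖⁻¹ * ‖grad f x‖⁻¹) with hc
  have hcs : ContinuousOn c Ω := by
    have h1 : ContDiffOn ℝ ∞ (fderiv ℝ (speed v f)) Ω :=
      H.smooth_speed.fderiv_of_isOpen H.isOpen (by simp)
    exact ((h1.clm_apply (contDiffOn_grad H.isOpen H.smooth_potential)).mul
      (H.smooth_inv_norm.mul H.smooth_inv_norm)).continuousOn
  have hq' := hq
  rw [B.source_eq] at hq'
  have hline : ∀ t ∈ Ioo (-ε) ε, (t, q.2) ∈ Θ.source := fun t ht => B.mk_mem ht hq'.2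
  -- For `u = ∂_Y (f ∘ Θ)`, exchanging derivatives gives `u' = ∂_Y (speed ∘ Θ) = c u`, because `d
  -- speed = c df`. At `t = 0` the image is a level set, so `u(0) = 0` and `u` vanishes throughout.
  have hode := eq_mul_exp_of_hasDerivAt (c := fun t => c (Θ (t, q.2)))
    (u := fun t => fderiv ℝ (fun q => f (Θ q)) (t, q.2) (0, Y)) B.zero_mem
    (hcs.comp (B.smooth_line hq'.2).continuousOn fun t ht => B.mem _ (hline t ht))
    (fun t ht => by
      have h1 := hasDerivAt_fderiv_snd Θ.open_source hF
        (fun q hq => B.hasDerivAt_potential H hq) (hline t ht) Y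
      refine h1.congr_deriv ?_
      rw [hGd _ (hline t ht), hFd _ (hline t ht)]
      exact H.fderiv_speed_eq_mul (B.mem _ (hline t ht)) _) hq'.1
  have hzero : fderiv ℝ (fun q => f (Θ q)) (0, q.2) (0, Y) = 0 := by
    have h0 := hline 0 B.zero_mem
    have h1 := (differentiableAt_of_contDiffOn Θ.open_source hF h0).hasFDerivAt.comp q.2
      (hasFDerivAt_slice 0 q.2)
    have h2 : ((fun q => f (Θ q)) ∘ fun y => ((0 : ℝ), y)) =ᶠ[𝓝 q.2] fun _ => f (Θ (0, 0)) := by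
      filter_upwards [Metric.isOpen_ball.mem_nhds hq'.2] with y hy using B.level y hy
    have h3 := (h1.congr_of_eventuallyEq h2.symm).unique (hasFDerivAt_const (f (Θ (0, 0))) q.2)
    simpa using congrArg (fun T => T Y) h3
  rw [inner_grad, ← hFd q hq]
  refine hode.trans ?_
  rw [hzero, zero_mul]

/-- A function that is constant along the level sets of `f` does not depend on `y`. -/
theorem eq_of_fderiv_eq_zero {g : EuclideanSpace ℝ ι → ℝ} (hg : ContDiffOn ℝ ∞ g Ω)
    (h : ∀ x ∈ Ω, ∀ w, inner ℝ (grad f x) w = 0 → fderiv ℝ g x w = 0) {t : ℝ}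
    (ht : t ∈ Ioo (-ε) ε) {y : EuclideanSpace ℝ κ} (hy : y ∈ Metric.ball 0 ε) :
    g (Θ (t, y)) = g (Θ (t, 0)) := by
  have hd : ∀ y ∈ Metric.ball (0 : EuclideanSpace ℝ κ) ε,
      HasFDerivAt (fun y => g (Θ (t, y))) (0 : EuclideanSpace ℝ κ →L[ℝ] ℝ) y := by
    intro y hy
    have hq := B.mk_mem ht hy
    have h1 := (differentiableAt_of_contDiffOn H.isOpen hg (B.mem _ hq)).hasFDerivAt.comp y
      (B.fderiv_slice hq)
    refine h1.congr_fderiv ?_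
    ext1 Y
    exact h _ (B.mem _ hq) _ (B.inner_grad_fderiv H hq Y)
  exact Metric.isOpen_ball.is_const_of_fderiv_eq_zero (convex_ball 0 ε).isPreconnected
    (fun y hy => (hd y hy).differentiableAt.differentiableWithinAt)
    (fun y hy => (hd y hy).fderiv) hy (Metric.mem_ball_self B.pos)

/-- In these coordinates the potential depends on `t` alone and is strictly increasing, with
derivative the positive speed. -/
theorem potential_eq_iff {q q' : ℝ × EuclideanSpace ℝ κ} (hq : q ∈ Θ.source)
    (hq' : q' ∈ Θ.source) : f (Θ q) = f (Θ q') ↔ q.1 = q'.1 := by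
  rw [B.source_eq] at hq hq'
  have h0 := Metric.mem_ball_self (x := (0 : EuclideanSpace ℝ κ)) B.pos
  have hred : ∀ q : ℝ × EuclideanSpace ℝ κ, q ∈ Ioo (-ε) ε ×ˢ Metric.ball 0 ε →
      f (Θ q) = f (Θ (q.1, 0)) := fun q hq =>
    B.eq_of_fderiv_eq_zero H H.smooth_potential
      (fun x _ w hw => by rw [← inner_grad, hw]) hq.1 hq.2
  have hd : ∀ t ∈ Ioo (-ε) ε, HasDerivAt (fun t => f (Θ (t, 0))) (speed v f (Θ (t, 0))) t :=
    fun t ht => B.hasDerivAt_potential H (B.mk_mem ht h0)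
  have hmono : StrictMonoOn (fun t => f (Θ (t, 0))) (Ioo (-ε) ε) := by
    refine strictMonoOn_of_deriv_pos (convex_Ioo _ _)
      (fun t ht => (hd t ht).continuousAt.continuousWithinAt) fun t ht => ?_
    rw [interior_Ioo] at ht
    rw [(hd t ht).deriv]
    exact H.speed_pos (B.mem _ (B.mk_mem ht h0))
  rw [hred q hq, hred q' hq']
  exact hmono.injOn.eq_iff hq.1 hq'.1

/-- Exchanging derivatives gives `∂ₜ ∂_Y Θ = ∂_Y (unitGrad ∘ Θ)`; as `∂_Y Θ` is tangent to the level
sets, the umbilicity formula applies. -/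
theorem hasDerivAt_fderiv {q : ℝ × EuclideanSpace ℝ κ} (hq : q ∈ Θ.source)
    (Y : EuclideanSpace ℝ κ) :
    HasDerivAt (fun t => fderiv ℝ Θ (t, q.2) (0, Y)) (bending v f D (Θ q) • fderiv ℝ Θ q (0, Y)
      + (v (Θ q))⁻¹ • ((inner ℝ (grad v (Θ q)) (fderiv ℝ Θ q (0, Y)) : ℝ) • unitGrad v f (Θ q)
        + (inner ℝ (grad v (Θ q)) (unitGrad v f (Θ q)) : ℝ) • fderiv ℝ Θ q (0, Y))) q.1 := by
  have h1 := hasDerivAt_fderiv_snd Θ.open_source B.smooth (G := fun q => unitGrad v f (Θ q))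
    B.hasDerivAt hq Y
  have h2 := (differentiableAt_of_contDiffOn H.isOpen H.smooth_unitGrad
    (B.mem q hq)).hasFDerivAt.comp q (B.hasFDerivAt hq)
  refine h1.congr_deriv ?_
  rw [← H.fderiv_unitGrad (B.mem q hq) (B.inner_grad_fderiv H hq Y)]
  exact congrArg (fun T => T (0, Y)) h2.fderiv

/-- The induced metrics on the slices `Θ (t, ·)` are proportional. -/
theorem metric_eq {q : ℝ × EuclideanSpace ℝ κ} (hq : q ∈ Θ.source) (Y Y' : EuclideanSpace ℝ κ) :
    inner ℝ (fderiv ℝ Θ q (0, Y)) (fderiv ℝ Θ q (0, Y')) / v (Θ q) ^ 2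
      = Real.exp (∫ s in (0 : ℝ)..q.1, bending v f D (Θ (s, 0))) ^ 2
        * (inner ℝ (fderiv ℝ Θ (0, q.2) (0, Y)) (fderiv ℝ Θ (0, q.2) (0, Y'))
          / v (Θ (0, q.2)) ^ 2) := by
  have hq' := hq
  rw [B.source_eq] at hq'
  have h0 := Metric.mem_ball_self (x := (0 : EuclideanSpace ℝ κ)) B.pos
  -- Differentiating `v⁻²⟨∂_Y Θ, ∂_Y' Θ⟩` in `t`, the conformal terms cancel against the derivative
  -- of `v⁻²` and the normal terms vanish by orthogonality. The remaining coefficient `2 * bending`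
  -- is constant on each slice, so it may be evaluated at `y = 0`.
  have hode := eq_mul_exp_of_hasDerivAt (c := fun t => 2 * bending v f D (Θ (t, 0)))
    (u := fun t => inner ℝ (fderiv ℝ Θ (t, q.2) (0, Y)) (fderiv ℝ Θ (t, q.2) (0, Y'))
      / v (Θ (t, q.2)) ^ 2) B.zero_mem
    (continuousOn_const.mul (H.smooth_bending.continuousOn.comp
      (B.smooth_line h0).continuousOn fun t ht => B.mem _ (B.mk_mem ht h0)))
    (fun t ht => by
      have hm := B.mk_mem ht hq'.2
      have hv := (H.factor_pos _ (B.mem _ hm)).ne'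
      have hvd : HasDerivAt (fun t => v (Θ (t, q.2)))
          (inner ℝ (grad v (Θ (t, q.2))) (unitGrad v f (Θ (t, q.2)))) t := by
        have h1 : HasFDerivAt v (fderiv ℝ v (Θ (t, q.2))) (Θ (t, q.2)) :=
          (differentiableAt_of_contDiffOn H.isOpen H.smooth_factor (B.mem _ hm)).hasFDerivAt
        rw [inner_grad]
        exact h1.comp_hasDerivAt t (B.hasDerivAt _ hm)
      have h1 := ((B.hasDerivAt_fderiv H hm Y).inner ℝ (B.hasDerivAt_fderiv H hm Y')).div
        (hvd.pow 2) (pow_ne_zero 2 hv)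
      refine h1.congr_deriv ?_
      have hX := fun Y => H.inner_unitGrad (B.inner_grad_fderiv H hm Y)
      have hX' : ∀ Y, inner ℝ (fderiv ℝ Θ (t, q.2) (0, Y)) (unitGrad v f (Θ (t, q.2))) = 0 :=
        fun Y => by rw [real_inner_comm, hX]
      have hb := B.eq_of_fderiv_eq_zero H H.smooth_bending
        (fun x hx w hw => H.fderiv_bending hx hw) ht hq'.2
      simp only [inner_add_left, inner_add_right, real_inner_smul_left, real_inner_smul_right, hX,
        hX', hb, Pi.pow_apply]
      field_simp
      ring) hq'.1
  have hexp : Real.exp (∫ s in (0 : ℝ)..q.1, 2 * bending v f D (Θ (s, 0)))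
      = Real.exp (∫ s in (0 : ℝ)..q.1, bending v f D (Θ (s, 0))) ^ 2 := by
    rw [intervalIntegral.integral_const_mul, ← Real.exp_nat_mul]
    norm_num
  rw [hexp] at hode
  exact hode.trans (mul_comm _ _)

theorem smooth_warping : ContDiffOn ℝ ∞
    (fun t => Real.exp (∫ s in (0 : ℝ)..t, bending v f D (Θ (s, 0)))) (Ioo (-ε) ε) := by
  have h0 := Metric.mem_ball_self (x := (0 : EuclideanSpace ℝ κ)) B.pos
  have hc : ContDiffOn ℝ ∞ (fun s => bending v f D (Θ (s, 0))) (Ioo (-ε) ε) :=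
    H.smooth_bending.comp (B.smooth_line h0) fun t ht => B.mem _ (B.mk_mem ht h0)
  have hd := fun t (ht : t ∈ Ioo (-ε) ε) =>
    hasDerivAt_integral_of_continuousOn B.zero_mem hc.continuousOn ht
  refine ContDiffOn.exp ((contDiffOn_infty_iff_deriv_of_isOpen isOpen_Ioo).2
    ⟨fun t ht => (hd t ht).differentiableAt.differentiableWithinAt,
      hc.congr fun t ht => (hd t ht).deriv⟩)

end IsFlowBox

end WarpedProduct

/-! ### The fibre metric and the local warped product. -/

section Fibre

open Set Filter Topology

variable {ι κ : Type} [Fintype ι] [DecidableEq ι] [Fintype κ] [DecidableEq κ]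
  {v f α D : EuclideanSpace ℝ ι → ℝ} {Ω : Set (EuclideanSpace ℝ ι)}
  {Θ : OpenPartialHomeomorph (ℝ × EuclideanSpace ℝ κ) (EuclideanSpace ℝ ι)} {ε : ℝ}

/-- The metric induced on the level set `t = 0`. -/
def fibreMetric (v : EuclideanSpace ℝ ι → ℝ)
    (Θ : OpenPartialHomeomorph (ℝ × EuclideanSpace ℝ κ) (EuclideanSpace ℝ ι))
    (y : EuclideanSpace ℝ κ) : Matrix κ κ ℝ :=
  Matrix.of fun i j => inner ℝ (dd i (fun y => Θ (0, y)) y) (dd j (fun y => Θ (0, y)) y)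
    / v (Θ (0, y)) ^ 2

namespace IsFlowBox

theorem fderiv_zero_slice (B : IsFlowBox Ω v f Θ ε) {y : EuclideanSpace ℝ κ}
    (hy : y ∈ Metric.ball 0 ε) (Y : EuclideanSpace ℝ κ) :
    fderiv ℝ (fun y => Θ (0, y)) y Y = fderiv ℝ Θ (0, y) (0, Y) :=
  congrArg (fun T => T Y) (B.fderiv_slice (B.mk_mem B.zero_mem hy)).fderiv

variable (B : IsFlowBox Ω v f Θ ε) (H : IsUmbilicFoliation Ω v f α D)

include B H

theorem sum_fibreMetric {y : EuclideanSpace ℝ κ} (hy : y ∈ Metric.ball 0 ε)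
    (Y Y' : EuclideanSpace ℝ κ) : ∑ i, ∑ j, fibreMetric v Θ y i j * Y i * Y' j
      = inner ℝ (fderiv ℝ Θ (0, y) (0, Y)) (fderiv ℝ Θ (0, y) (0, Y')) / v (Θ (0, y)) ^ 2 := by
  rw [← B.fderiv_zero_slice hy, ← B.fderiv_zero_slice hy, fderiv_eq_sum_dd, fderiv_eq_sum_dd,
    sum_inner, Finset.sum_div]
  refine Finset.sum_congr rfl fun i _ => ?_
  rw [inner_sum, Finset.sum_div]
  refine Finset.sum_congr rfl fun j _ => ?_
  rw [real_inner_smul_left, real_inner_smul_right, fibreMetric, Matrix.of_apply]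
  ring

theorem posDef_fibreMetric {y : EuclideanSpace ℝ κ} (hy : y ∈ Metric.ball 0 ε) :
    (fibreMetric v Θ y).PosDef := by
  have hm := B.mk_mem B.zero_mem hy
  refine Matrix.PosDef.of_dotProduct_mulVec_pos ?_ fun x hx => ?_
  · ext i j
    simp only [Matrix.conjTranspose_apply, fibreMetric, Matrix.of_apply, star_trivial]
    rw [real_inner_comm]
  · have e : star x ⬝ᵥ (fibreMetric v Θ y).mulVec x
        = ∑ i, ∑ j, fibreMetric v Θ y i j * (WithLp.toLp 2 x) i * (WithLp.toLp 2 x) j := by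
      simp only [dotProduct, Matrix.mulVec, star_trivial, Finset.mul_sum]
      exact Finset.sum_congr rfl fun i _ => Finset.sum_congr rfl fun j _ => by ring
    rw [e, B.sum_fibreMetric H hy]
    refine div_pos ?_ (pow_pos (H.factor_pos _ (B.mem _ hm)) 2)
    refine real_inner_self_pos.2 fun h0 => hx ?_
    obtain ⟨L, hL⟩ := B.equiv _ hm
    rw [hL.fderiv] at h0
    have h1 := L.injective (h0.trans (map_zero L).symm)
    have h2 := congrArg Prod.snd h1
    exact congrArg (fun z : EuclideanSpace ℝ κ => z.ofLp) h2

/-- The normal is the unit gradient. The constant is minus the bending by the sign convention in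
`dd_normal`, and may be taken at the origin since the bending is constant on the slice. -/
theorem isUmbilic : IsUmbilic (Metric.ball 0 ε) (fun y => Θ (0, y)) (fun y => grad v (Θ (0, y)))
    (fun y => unitGrad v f (Θ (0, y))) (fun y => v (Θ (0, y))) (-bending v f D (Θ (0, 0)))
    (fibreMetric v Θ) := by
  have hs := B.smooth_slice B.zero_mem
  have hmem : ∀ y ∈ Metric.ball (0 : EuclideanSpace ℝ κ) ε, Θ (0, y) ∈ Ω := fun y hy =>
    B.mem _ (B.mk_mem B.zero_mem hy)
  have hdd : ∀ y ∈ Metric.ball (0 : EuclideanSpace ℝ κ) ε, ∀ i,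
      dd i (fun y => Θ (0, y)) y = fderiv ℝ Θ (0, y) (0, EuclideanSpace.single i 1) :=
    fun y hy i => B.fderiv_zero_slice hy _
  have htan : ∀ y ∈ Metric.ball (0 : EuclideanSpace ℝ κ) ε, ∀ i,
      inner ℝ (grad f (Θ (0, y))) (dd i (fun y => Θ (0, y)) y) = 0 := fun y hy i => by
    rw [hdd y hy]
    exact B.inner_grad_fderiv H (B.mk_mem B.zero_mem hy) _
  have hcomp : ∀ {V : Type} [NormedAddCommGroup V] [NormedSpace ℝ V]
      (g : EuclideanSpace ℝ ι → V), ContDiffOn ℝ ∞ g Ω →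
      ∀ y ∈ Metric.ball (0 : EuclideanSpace ℝ κ) ε, ∀ i,
      dd i (fun y => g (Θ (0, y))) y = fderiv ℝ g (Θ (0, y)) (dd i (fun y => Θ (0, y)) y) := by
    intro V _ _ g hg y hy i
    have h1 := (differentiableAt_of_contDiffOn H.isOpen hg (hmem y hy)).hasFDerivAt.comp y
      (differentiableAt_of_contDiffOn Metric.isOpen_ball hs hy).hasFDerivAt
    exact congrArg (fun T => T (EuclideanSpace.single i 1)) h1.fderiv
  exact
  { isOpen := Metric.isOpen_ball
    smooth := hs
    smooth_grad := (contDiffOn_grad H.isOpen H.smooth_factor).comp hs hmem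
    smooth_normal := H.smooth_unitGrad.comp hs hmem
    smooth_factor := H.smooth_factor.comp hs hmem
    factor_ne := fun y hy => (H.factor_pos _ (hmem y hy)).ne'
    pd_factor := fun y hy i => by
      rw [inner_grad]
      exact hcomp v H.smooth_factor y hy i
    metric := fun y hy i j => rfl
    det_ne := fun y hy => (B.posDef_fibreMetric H hy).det_pos.ne'
    normal := fun y hy i => H.inner_unitGrad (htan y hy i)
    normal_unit := fun y hy => by rw [H.inner_unitGrad_self (hmem y hy)]
    dd_normal := fun y hy i => by
      rw [hcomp _ H.smooth_unitGrad y hy i, H.fderiv_unitGrad (hmem y hy) (htan y hy i), neg_neg,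
        B.eq_of_fderiv_eq_zero H H.smooth_bending (fun x hx w hw => H.fderiv_bending hx hw)
          B.zero_mem hy, pd_eq_dd, hcomp v H.smooth_factor y hy i, ← inner_grad]
    span := fun y hy Z hZ hZν => by
      have hm := B.mk_mem B.zero_mem hy
      obtain ⟨L, hL⟩ := B.equiv _ hm
      obtain ⟨p, hp⟩ := L.surjective Z
      have h1 : Z = p.1 • unitGrad v f (Θ (0, y)) + ∑ i, p.2 i • dd i (fun y => Θ (0, y)) y := by
        rw [← fderiv_eq_sum_dd, B.fderiv_zero_slice hy, ← B.fderiv_apply hm, hL.fderiv]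
        exact hp.symm
      have h2 : inner ℝ Z Z = (0 : ℝ) := by
        refine (congrArg (fun z => inner ℝ Z z) h1).trans ?_
        simp only [inner_add_right, real_inner_smul_right, inner_sum, hZν, hZ]
        simp
      exact inner_self_eq_zero.1 h2 }

/-- By the Gauss equation, the fibre curvature is the ambient curvature of the tangent planes plus
the square of the principal curvature. Both are constant along the level set. -/
theorem hasSectionalCurvatureAt_fibreMetric {y : EuclideanSpace ℝ κ}
    (hy : y ∈ Metric.ball 0 ε) : HasSectionalCurvatureAt (fibreMetric v Θ)
      (tangentCurvature v α (Θ (0, 0)) + bending v f D (Θ (0, 0)) ^ 2) y := by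
  have hmem := B.mem _ (B.mk_mem B.zero_mem hy)
  have h := (B.isUmbilic H).hasSectionalCurvatureAt hy (C := α (Θ (0, y))) fun i => ?_
  · rw [← B.eq_of_fderiv_eq_zero H H.smooth_tangentCurvature
      (fun x hx w hw => H.fderiv_tangentCurvature hx hw) B.zero_mem hy, ← neg_sq (bending _ _ _ _)]
    exact h
  · have h1 := (differentiableAt_of_contDiffOn H.isOpen (contDiffOn_grad H.isOpen H.smooth_factor)
      hmem).hasFDerivAt.comp y (B.fderiv_slice (B.mk_mem B.zero_mem hy))
    have h2 : dd i (fun y => grad v (Θ (0, y))) y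
        = fderiv ℝ (grad v) (Θ (0, y)) (fderiv ℝ Θ (0, y) (0, EuclideanSpace.single i 1)) :=
      congrArg (fun T => T (EuclideanSpace.single i 1)) h1.fderiv
    rw [h2, H.hess_factor _ hmem _ (B.inner_grad_fderiv H (B.mk_mem B.zero_mem hy) _),
      ← B.fderiv_zero_slice hy]
    rfl

/-- The `t` direction is mapped to the unit normal, which is orthogonal to the slices, so there are
no cross terms. The slice metrics are related to the one at `t = 0` by `metric_eq`. -/
theorem inner_fderiv_fderiv {q : ℝ × EuclideanSpace ℝ κ} (hq : q ∈ Θ.source)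
    (X Y : ℝ × EuclideanSpace ℝ κ) :
    inner ℝ (fderiv ℝ Θ q X) (fderiv ℝ Θ q Y) / v (Θ q) ^ 2 = X.1 * Y.1
      + Real.exp (∫ s in (0 : ℝ)..q.1, bending v f D (Θ (s, 0))) ^ 2
        * ∑ i, ∑ j, fibreMetric v Θ q.2 i j * X.2 i * Y.2 j := by
  have hq' := hq
  rw [B.source_eq] at hq'
  have hv := (H.factor_pos _ (B.mem q hq)).ne'
  have hX := fun Y => H.inner_unitGrad (B.inner_grad_fderiv H hq Y)
  have hX' : ∀ Y, inner ℝ (fderiv ℝ Θ q (0, Y)) (unitGrad v f (Θ q)) = 0 :=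
    fun Y => by rw [real_inner_comm, hX]
  rw [B.sum_fibreMetric H hq'.2, ← B.metric_eq H hq, B.fderiv_apply hq X, B.fderiv_apply hq Y]
  simp only [inner_add_left, inner_add_right, real_inner_smul_left, real_inner_smul_right, hX, hX',
    H.inner_unitGrad_self (B.mem q hq)]
  field_simp
  ring

end IsFlowBox

/-- Local form of the warped product structure, in a flat chart. -/
theorem IsUmbilicFoliation.exists_warpedProduct (H : IsUmbilicFoliation Ω v f α D)
    (hκ : Fintype.card κ + 1 = Fintype.card ι) {x₀ : EuclideanSpace ℝ ι} (hx₀ : x₀ ∈ Ω) :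
    ∃ (Θ : OpenPartialHomeomorph (ℝ × EuclideanSpace ℝ κ) (EuclideanSpace ℝ ι))
      (a b : ℝ) (V : Set (EuclideanSpace ℝ κ)) (w : ℝ → ℝ)
      (h : EuclideanSpace ℝ κ → Matrix κ κ ℝ) (K : ℝ),
      IsOpen V ∧ IsConnected V ∧ Θ.source = Ioo a b ×ˢ V ∧ x₀ ∈ Θ.target ∧ Θ.target ⊆ Ω ∧
      ContDiffOn ℝ ∞ Θ Θ.source ∧ ContDiffOn ℝ ∞ Θ.symm Θ.target ∧
      ContDiffOn ℝ ∞ w (Ioo a b) ∧ (∀ t ∈ Ioo a b, 0 < w t) ∧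
      (∀ i j, ContDiffOn ℝ ∞ (fun y => h y i j) V) ∧ (∀ y ∈ V, (h y).PosDef) ∧
      (∀ y ∈ V, HasSectionalCurvatureAt h K y) ∧
      (∀ x ∈ Θ.source, ∀ X Y : ℝ × EuclideanSpace ℝ κ,
        inner ℝ (fderiv ℝ Θ x X) (fderiv ℝ Θ x Y) / v (Θ x) ^ 2
          = X.1 * Y.1 + w x.1 ^ 2 * ∑ i, ∑ j, h x.2 i j * X.2 i * Y.2 j) ∧
      (∀ x ∈ Θ.source, ∀ x' ∈ Θ.source, f (Θ x) = f (Θ x') ↔ x.1 = x'.1) := by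
  obtain ⟨Θ, ε, B, h0⟩ := H.exists_isFlowBox hκ hx₀
  have h00 := Metric.mem_ball_self (x := (0 : EuclideanSpace ℝ κ)) B.pos
  refine ⟨Θ, -ε, ε, Metric.ball 0 ε, _, fibreMetric v Θ, _, Metric.isOpen_ball,
    ⟨⟨0, h00⟩, (convex_ball 0 ε).isPreconnected⟩,
    B.source_eq, ?_, ?_, B.smooth, B.smooth_symm, B.smooth_warping H, fun t _ => Real.exp_pos _,
    fun i j => ?_, fun y hy => B.posDef_fibreMetric H hy,
    fun y hy => B.hasSectionalCurvatureAt_fibreMetric H hy,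
    fun x hx X Y => B.inner_fderiv_fderiv H hx X Y,
    fun x hx x' hx' => B.potential_eq_iff H hx hx'⟩
  · rw [← h0]
    exact Θ.map_source (B.mk_mem B.zero_mem h00)
  · intro x hx
    rw [← Θ.right_inv hx]
    exact B.mem _ (Θ.map_target hx)
  · have U := B.isUmbilic H
    exact ((contDiffOn_dd U.isOpen U.smooth i).inner ℝ (contDiffOn_dd U.isOpen U.smooth j)).div
      (U.smooth_factor.pow 2) fun y hy => pow_ne_zero 2 (U.factor_ne y hy)

end Fibre

/-! ### The Riemannian metric of the manifold in charts. -/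

section Charts

open Set Filter Topology

variable {n : ℕ} {M : Type*} [TopologicalSpace M] [ChartedSpace (EuclideanSpace ℝ (Fin n)) M]
  [IsManifold (𝓡 n) ∞ M] {e e' : OpenPartialHomeomorph M (EuclideanSpace ℝ (Fin n))}

theorem mdifferentiableAt_symm (he : e ∈ IsManifold.maximalAtlas (𝓡 n) ∞ M)
    {y : EuclideanSpace ℝ (Fin n)} (hy : y ∈ e.target) :
    MDifferentiableAt (𝓡 n) (𝓡 n) e.symm y :=
  (contMDiffAt_symm_of_mem_maximalAtlas he hy).mdifferentiableAt (by simp)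

theorem mdifferentiableAt_chart (he : e ∈ IsManifold.maximalAtlas (𝓡 n) ∞ M) {x : M}
    (hx : x ∈ e.source) : MDifferentiableAt (𝓡 n) (𝓡 n) e x :=
  (contMDiffAt_of_mem_maximalAtlas he hx).mdifferentiableAt (by simp)

theorem mfderiv_symm_injective (he : e ∈ IsManifold.maximalAtlas (𝓡 n) ∞ M)
    {y : EuclideanSpace ℝ (Fin n)} (hy : y ∈ e.target) :
    Function.Injective (mfderiv (𝓡 n) (𝓡 n) e.symm y) := by
  have h1 := mfderiv_comp y (mdifferentiableAt_chart he (e.map_target hy))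
    (mdifferentiableAt_symm he hy)
  have h2 : (e ∘ e.symm) =ᶠ[𝓝 y] id := by
    filter_upwards [e.open_target.mem_nhds hy] with z hz using e.right_inv hz
  rw [h2.mfderiv_eq, mfderiv_id] at h1
  intro a b hab
  have h3 : ∀ c, mfderiv (𝓡 n) (𝓡 n) e (e.symm y) (mfderiv (𝓡 n) (𝓡 n) e.symm y c) = c := fun c =>
    (congrArg (fun T => T c) h1).symm
  rw [← h3 a, ← h3 b, hab]

theorem contDiffOn_comp_symm (he : e ∈ IsManifold.maximalAtlas (𝓡 n) ∞ M) {U : Set M} {F : M → ℝ}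
    (hF : ContMDiffOn (𝓡 n) 𝓘(ℝ, ℝ) ∞ F U) (h : e.source ⊆ U) :
    ContDiffOn ℝ ∞ (F ∘ e.symm) e.target :=
  contMDiffOn_iff_contDiffOn.1 (hF.comp (contMDiffOn_symm_of_mem_maximalAtlas he)
    fun _ hy => h (e.map_target hy))

/-- A transition map between two charts, and the domain where it is defined. -/
theorem contDiffOn_transition (he : e ∈ IsManifold.maximalAtlas (𝓡 n) ∞ M)
    (he' : e' ∈ IsManifold.maximalAtlas (𝓡 n) ∞ M) :
    ContDiffOn ℝ ∞ (e' ∘ e.symm) (e.target ∩ e.symm ⁻¹' e'.source) :=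
  contMDiffOn_iff_contDiffOn.1 ((contMDiffOn_of_mem_maximalAtlas he').comp
    ((contMDiffOn_symm_of_mem_maximalAtlas he).mono inter_subset_left) fun _ hy => hy.2)

theorem mfderiv_comp_symm {F : Type*} [NormedAddCommGroup F] [NormedSpace ℝ F]
    (he : e ∈ IsManifold.maximalAtlas (𝓡 n) ∞ M) {Θ : F → EuclideanSpace ℝ (Fin n)} {x : F}
    (hΘ : DifferentiableAt ℝ Θ x) (hx : Θ x ∈ e.target) (X : F) :
    mfderiv 𝓘(ℝ, F) (𝓡 n) (e.symm ∘ Θ) x X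
      = mfderiv (𝓡 n) (𝓡 n) e.symm (Θ x) (fderiv ℝ Θ x X) := by
  rw [mfderiv_comp x (mdifferentiableAt_symm he hx) hΘ.mdifferentiableAt, mfderiv_eq_fderiv]
  rfl

theorem grad_comp_symm_ne_zero (he : e ∈ IsManifold.maximalAtlas (𝓡 n) ∞ M) {f : M → ℝ} {p : M}
    (hf : MDifferentiableAt (𝓡 n) 𝓘(ℝ, ℝ) f p) (hp : p ∈ e.source)
    (h : mfderiv (𝓡 n) 𝓘(ℝ, ℝ) f p ≠ 0) : grad (f ∘ e.symm) (e p) ≠ 0 := by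
  intro h0
  refine h ?_
  have h1 : fderiv ℝ (f ∘ e.symm) (e p) = 0 := by
    ext w
    rw [← inner_grad, h0, inner_zero_left]
    rfl
  have h2 : f =ᶠ[𝓝 p] (f ∘ e.symm) ∘ e := by
    filter_upwards [e.open_source.mem_nhds hp] with x hx
    simp [e.left_inv hx]
  have h3 : DifferentiableAt ℝ (f ∘ e.symm) (e p) := by
    rw [← e.left_inv hp] at hf
    exact (hf.comp (e p) (mdifferentiableAt_symm he (e.map_source hp))).differentiableAt
  have h4 := h2.mfderiv_eq (I := 𝓡 n) (I' := 𝓘(ℝ, ℝ))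
  rw [mfderiv_comp p h3.mdifferentiableAt (mdifferentiableAt_chart he hp), mfderiv_eq_fderiv,
    h1] at h4
  rw [h4]
  ext w
  rfl

variable [Bundle.RiemannianBundle (fun x : M => TangentSpace (𝓡 n) x)]

theorem metricTensor_sum (x : M) (A : EuclideanSpace ℝ (Fin n) →L[ℝ] TangentSpace (𝓡 n) x)
    (X Y : EuclideanSpace ℝ (Fin n)) :
    metricTensor n M x (A X) (A Y) = ∑ i, ∑ j, metricTensor n M x (A (EuclideanSpace.single i 1))
      (A (EuclideanSpace.single j 1)) * X i * Y j := by
  have hX := (clm_eq_sum A X)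
  have hY := (clm_eq_sum A Y)
  rw [hX, hY]
  unfold metricTensor
  simp only [sum_inner, inner_sum, real_inner_smul_left, real_inner_smul_right]
  rw [Finset.sum_comm]
  exact Finset.sum_congr rfl fun i _ => Finset.sum_congr rfl fun j _ => by ring

theorem metricTensor_mfderiv_congr {F : Type*} [NormedAddCommGroup F] [NormedSpace ℝ F]
    {φ ψ : F → M} {y : F} (h : φ =ᶠ[𝓝 y] ψ) (X Y : F) :
    metricTensor n M (φ y) (mfderiv 𝓘(ℝ, F) (𝓡 n) φ y X) (mfderiv 𝓘(ℝ, F) (𝓡 n) φ y Y)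
      = metricTensor n M (ψ y) (mfderiv 𝓘(ℝ, F) (𝓡 n) ψ y X) (mfderiv 𝓘(ℝ, F) (𝓡 n) ψ y Y) := by
  -- The two metrics live on tangent spaces at points that are equal but not by definition. All
  -- tangent spaces are the model space, so the vectors can be held fixed while the base point is
  -- replaced.
  have aux : ∀ (x x' : M), x = x' → ∀ a b : EuclideanSpace ℝ (Fin n),
      metricTensor n M x a b = metricTensor n M x' a b := by
    rintro x _ rfl a b
    rfl
  rw [h.mfderiv_eq]
  exact aux _ _ h.eq_of_nhds _ _

theorem metricTensor_mfderiv_symm (y X Y : EuclideanSpace ℝ (Fin n)) :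
    metricTensor n M (e.symm y) (mfderiv (𝓡 n) (𝓡 n) e.symm y X) (mfderiv (𝓡 n) (𝓡 n) e.symm y Y)
      = ∑ i, ∑ j, coordMetric (metricTensor n M) e y i j * X i * Y j :=
  metricTensor_sum (e.symm y) (mfderiv (𝓡 n) (𝓡 n) e.symm y) X Y

/-- The metric pulled back by a map written in the chart `e`. -/
theorem metricTensor_mfderiv_comp {F : Type*} [NormedAddCommGroup F] [NormedSpace ℝ F]
    (he : e ∈ IsManifold.maximalAtlas (𝓡 n) ∞ M) {φ : F → M} {Θ : F → EuclideanSpace ℝ (Fin n)}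
    {x : F} (hφ : φ =ᶠ[𝓝 x] e.symm ∘ Θ) (hΘ : DifferentiableAt ℝ Θ x) (hx : Θ x ∈ e.target)
    (X Y : F) :
    metricTensor n M (φ x) (mfderiv 𝓘(ℝ, F) (𝓡 n) φ x X) (mfderiv 𝓘(ℝ, F) (𝓡 n) φ x Y)
      = ∑ i, ∑ j, coordMetric (metricTensor n M) e (Θ x) i j * fderiv ℝ Θ x X i
        * fderiv ℝ Θ x Y j := by
  rw [metricTensor_mfderiv_congr hφ, mfderiv_comp_symm he hΘ hx, mfderiv_comp_symm he hΘ hx]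
  exact metricTensor_mfderiv_symm (Θ x) _ _

theorem posDef_coordMetric (he : e ∈ IsManifold.maximalAtlas (𝓡 n) ∞ M)
    {y : EuclideanSpace ℝ (Fin n)} (hy : y ∈ e.target) :
    (coordMetric (metricTensor n M) e y).PosDef := by
  refine Matrix.PosDef.of_dotProduct_mulVec_pos ?_ fun x hx => ?_
  · ext i j
    exact real_inner_comm (F := TangentSpace (𝓡 n) (e.symm y)) _ _
  · have e1 : star x ⬝ᵥ (coordMetric (metricTensor n M) e y).mulVec x = ∑ i, ∑ j,
        coordMetric (metricTensor n M) e y i j * (WithLp.toLp 2 x) i * (WithLp.toLp 2 x) j := by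
      simp only [dotProduct, Matrix.mulVec, star_trivial, Finset.mul_sum]
      exact Finset.sum_congr rfl fun i _ => Finset.sum_congr rfl fun j _ => by ring
    rw [e1, ← metricTensor_mfderiv_symm]
    refine real_inner_self_pos.2 fun h0 => hx ?_
    have h1 := mfderiv_symm_injective he hy (h0.trans (map_zero _).symm)
    exact congrArg (fun z : EuclideanSpace ℝ (Fin n) => z.ofLp) h1

theorem coordMetric_conformalMetric (u : M → ℝ) (y : EuclideanSpace ℝ (Fin n)) :
    coordMetric (conformalMetric u (metricTensor n M)) e y
      = Real.exp (u (e.symm y)) • coordMetric (metricTensor n M) e y := by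
  ext i j
  rfl

theorem posDef_coordMetric_conformalMetric (he : e ∈ IsManifold.maximalAtlas (𝓡 n) ∞ M)
    (u : M → ℝ) {y : EuclideanSpace ℝ (Fin n)} (hy : y ∈ e.target) :
    (coordMetric (conformalMetric u (metricTensor n M)) e y).PosDef := by
  rw [coordMetric_conformalMetric]
  exact (posDef_coordMetric he hy).smul (Real.exp_pos _)

/-- Each coordinate field is the tangent map of `e.symm` applied to a constant field, hence a smooth
section along `e.symm`; the bundle metric pairs smooth sections smoothly. -/
theorem contDiffOn_coordMetric [IsContMDiffRiemannianBundle (𝓡 n) ∞ (EuclideanSpace ℝ (Fin n))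
      (fun x : M => TangentSpace (𝓡 n) x)] (he : e ∈ IsManifold.maximalAtlas (𝓡 n) ∞ M)
    (i j : Fin n) :
    ContDiffOn ℝ ∞ (fun y => coordMetric (metricTensor n M) e y i j) e.target := by
  have hT := (contMDiffOn_symm_of_mem_maximalAtlas he).contMDiffOn_tangentMapWithin (m := ∞)
    (by simp) e.open_target.uniqueMDiffOn
  have hsec : ∀ i : Fin n, ContMDiffOn (𝓡 n) ((𝓡 n).prod 𝓘(ℝ, EuclideanSpace ℝ (Fin n))) ∞
      (fun y => (⟨e.symm y, mfderiv (𝓡 n) (𝓡 n) e.symm y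
        (EuclideanSpace.single i 1 : EuclideanSpace ℝ (Fin n))⟩ :
        TangentBundle (𝓡 n) M)) e.target := by
    intro i
    have hV : ContMDiffOn 𝓘(ℝ, EuclideanSpace ℝ (Fin n)) (𝓘(ℝ, EuclideanSpace ℝ (Fin n)).tangent) ∞
        (fun y : EuclideanSpace ℝ (Fin n) => (⟨y, (EuclideanSpace.single i 1 :
          EuclideanSpace ℝ (Fin n))⟩ : TangentBundle 𝓘(ℝ, EuclideanSpace ℝ (Fin n)) _)) e.target :=
      contMDiffOn_vectorSpace_iff_contDiffOn.2 contDiffOn_const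
    refine (hT.comp hV fun y hy => hy).congr fun y hy => ?_
    simp only [Function.comp, tangentMapWithin]
    rw [mfderivWithin_of_isOpen e.open_target hy]
  exact contMDiffOn_iff_contDiffOn.1 (ContMDiffOn.inner_bundle (hsec i) (hsec j))

end Charts

/-! ### Conformally flat charts and the warped product on the manifold. -/

section FlatChart

open Set Filter Topology

theorem fderiv_injective_of_inner_eq {ι : Type} [Fintype ι] [DecidableEq ι]
    {ψ : EuclideanSpace ℝ ι → EuclideanSpace ℝ ι} {y : EuclideanSpace ℝ ι} {G : Matrix ι ι ℝ}
    (hG : G.PosDef) (h : ∀ i j, inner ℝ (dd i ψ y) (dd j ψ y) = G i j) :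
    Function.Injective (fderiv ℝ ψ y) := by
  refine (injective_iff_map_eq_zero _).2 fun p hp => ?_
  by_contra hne
  have hx : p.ofLp ≠ 0 := fun h0 => hne (by ext i; exact congrFun h0 i)
  have h1 := hG.dotProduct_mulVec_pos hx
  have h2 : star p.ofLp ⬝ᵥ G.mulVec p.ofLp = inner ℝ (fderiv ℝ ψ y p) (fderiv ℝ ψ y p) := by
    rw [fderiv_eq_sum_dd, sum_inner]
    simp only [dotProduct, Matrix.mulVec, star_trivial, inner_sum, real_inner_smul_left,
      real_inner_smul_right, h, Finset.mul_sum]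
    exact Finset.sum_congr rfl fun i _ => Finset.sum_congr rfl fun j _ => by ring
  rw [h2, hp, inner_zero_left] at h1
  exact lt_irrefl _ h1

theorem inner_fderiv_fderiv_eq_sum {ι κ : Type} [Fintype ι] [DecidableEq ι] [Fintype κ]
    {ψ : EuclideanSpace ℝ ι → EuclideanSpace ℝ κ} {y : EuclideanSpace ℝ ι} {G : Matrix ι ι ℝ}
    (h : ∀ i j, inner ℝ (dd i ψ y) (dd j ψ y) = G i j) (X Y : EuclideanSpace ℝ ι) :
    inner ℝ (fderiv ℝ ψ y X) (fderiv ℝ ψ y Y) = ∑ i, ∑ j, G i j * X i * Y j := by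
  rw [fderiv_eq_sum_dd, fderiv_eq_sum_dd, sum_inner]
  simp only [inner_sum, real_inner_smul_left, real_inner_smul_right, h]
  exact Finset.sum_congr rfl fun i _ => Finset.sum_congr rfl fun j _ => by ring

variable {n : ℕ} {M : Type*} [TopologicalSpace M] [ChartedSpace (EuclideanSpace ℝ (Fin n)) M]
  [IsManifold (𝓡 n) ∞ M] [Bundle.RiemannianBundle (fun x : M => TangentSpace (𝓡 n) x)]
  [IsContMDiffRiemannianBundle (𝓡 n) ∞ (EuclideanSpace ℝ (Fin n))
      (fun x : M => TangentSpace (𝓡 n) x)]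

/-- Around every point of a locally conformally flat manifold there is a chart in which the metric
is a multiple of the Euclidean one. -/
theorem IsLocallyConformallyFlat.exists_chart
    (h : IsLocallyConformallyFlat (metricTensor n M)) (p : M) :
    ∃ (e : OpenPartialHomeomorph M (EuclideanSpace ℝ (Fin n)))
      (v : EuclideanSpace ℝ (Fin n) → ℝ), e ∈ IsManifold.maximalAtlas (𝓡 n) ∞ M ∧ p ∈ e.source ∧
      ContDiffOn ℝ ∞ v e.target ∧ (∀ y ∈ e.target, 0 < v y) ∧
      ∀ y ∈ e.target, coordMetric (metricTensor n M) e y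
        = (v y ^ 2)⁻¹ • (1 : Matrix (Fin n) (Fin n) ℝ) := by
  obtain ⟨U, u, hU, hpU, hu, hflat⟩ := h p
  set e := chartAt (EuclideanSpace ℝ (Fin n)) p with he
  have hem : e ∈ IsManifold.maximalAtlas (𝓡 n) ∞ M := IsManifold.chart_mem_maximalAtlas p
  have hpe : p ∈ e.source := mem_chart_source _ p
  set Ω : Set (EuclideanSpace ℝ (Fin n)) := e.target ∩ e.symm ⁻¹' U with hΩ
  have hΩo : IsOpen Ω := e.symm.isOpen_inter_preimage hU
  have hpΩ : e p ∈ Ω := ⟨e.map_source hpe, by simpa [e.left_inv hpe] using hpU⟩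
  set G := coordMetric (conformalMetric u (metricTensor n M)) e with hG
  have hus : ContDiffOn ℝ ∞ (u ∘ e.symm) Ω := contMDiffOn_iff_contDiffOn.1
    (hu.comp ((contMDiffOn_symm_of_mem_maximalAtlas hem).mono inter_subset_left) fun _ hy => hy.2)
  have hGs : ∀ i j, ContDiffOn ℝ ∞ (fun y => G y i j) Ω := fun i j =>
    hus.exp.mul ((contDiffOn_coordMetric hem i j).mono inter_subset_left)
  have hGp : ∀ y ∈ Ω, (G y).PosDef := fun y hy =>
    posDef_coordMetric_conformalMetric hem u hy.1
  obtain ⟨W, ψ, hW, hpW, hWΩ, hψ, hψG⟩ := exists_flat_coordinates hΩo hGs hGp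
    (fun y hy a b c d => hflat e hem y hy.1 hy.2 a b c d) hpΩ
  set L : EuclideanSpace ℝ (Fin n) ≃L[ℝ] EuclideanSpace ℝ (Fin n) :=
    (LinearEquiv.ofInjectiveEndo
      (fderiv ℝ ψ (e p) : EuclideanSpace ℝ (Fin n) →ₗ[ℝ] EuclideanSpace ℝ (Fin n))
      (fderiv_injective_of_inner_eq (hGp _ hpΩ) (hψG _ hpW))).toContinuousLinearEquiv with hL
  have hLψ : (L : EuclideanSpace ℝ (Fin n) →L[ℝ] EuclideanSpace ℝ (Fin n)) = fderiv ℝ ψ (e p) :=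
    ContinuousLinearMap.ext fun _ => rfl
  obtain ⟨Θ, hpΘ, hΘW, hΘψ, hΘs, -⟩ := exists_openPartialHomeomorph_of_contDiffOn hW hψ hpW L
    (by rw [hLψ]; exact (differentiableAt_of_contDiffOn hW hψ hpW).hasFDerivAt)
  have hΘf : (Θ : EuclideanSpace ℝ (Fin n) → EuclideanSpace ℝ (Fin n)) = ψ := funext hΘψ
  have hsrc : ∀ x ∈ (e.trans Θ).source, x ∈ e.source ∧ e x ∈ Θ.source := fun x hx => by
    simpa using hx
  have htgt : ∀ z ∈ (e.trans Θ).target, z ∈ Θ.target ∧ Θ.symm z ∈ e.target := fun z hz => by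
    simpa using hz
  have hmem : e.trans Θ ∈ IsManifold.maximalAtlas (𝓡 n) ∞ M := by
    have h1 : ContMDiffOn (𝓡 n) (𝓡 n) ∞ Θ Θ.source := by
      rw [hΘf]
      exact contMDiffOn_iff_contDiffOn.2 (hψ.mono hΘW)
    have h2 := h1.comp ((contMDiffOn_of_mem_maximalAtlas hem).mono fun x hx => (hsrc x hx).1)
      fun x hx => (hsrc x hx).2
    have h3 := (contMDiffOn_symm_of_mem_maximalAtlas hem).comp
      ((contMDiffOn_iff_contDiffOn.2 hΘs).mono fun x hx => (htgt x hx).1)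
      fun x hx => (htgt x hx).2
    exact OpenPartialHomeomorph.mem_maximalAtlas_of_contMDiffOn _ h2 h3
  have hUe : ∀ z ∈ (e.trans Θ).target, (e.trans Θ).symm z ∈ U := fun z hz =>
    (hWΩ (hΘW (Θ.map_target (htgt z hz).1))).2
  have hus' : ContDiffOn ℝ ∞ (u ∘ (e.trans Θ).symm) (e.trans Θ).target :=
    contMDiffOn_iff_contDiffOn.1 (hu.comp (contMDiffOn_symm_of_mem_maximalAtlas hmem) hUe)
  -- In the coordinates `ψ` the metric `e^u g` is Euclidean, so `g = e^(-u)⟨·,·⟩`, which is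
  -- `v⁻²⟨·,·⟩` for `v = e^(u/2)`.
  refine ⟨e.trans Θ, fun z => Real.exp (u ((e.trans Θ).symm z) / 2), hmem, ?_, ?_,
    fun z _ => Real.exp_pos _, fun z hz => ?_⟩
  · simpa using ⟨hpe, hpΘ⟩
  · exact (hus'.div_const 2).exp
  · obtain ⟨hz1, hz2⟩ := htgt z hz
    have hy := Θ.map_target hz1
    have hd : DifferentiableAt ℝ Θ.symm z := differentiableAt_of_contDiffOn Θ.open_target hΘs hz1
    have hψd : DifferentiableAt ℝ ψ (Θ.symm z) := differentiableAt_of_contDiffOn hW hψ (hΘW hy)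
    have hid : ∀ w, fderiv ℝ ψ (Θ.symm z) (fderiv ℝ Θ.symm z w) = w := by
      intro w
      have h1 := hψd.hasFDerivAt.comp z hd.hasFDerivAt
      have h2 : ψ ∘ Θ.symm =ᶠ[𝓝 z] id := by
        filter_upwards [Θ.open_target.mem_nhds hz1] with x hx
        simp only [Function.comp, id]
        rw [← hΘf]
        exact Θ.right_inv hx
      have h3 := (h1.congr_of_eventuallyEq h2.symm).unique (hasFDerivAt_id z)
      exact congrArg (fun T => T w) h3
    have hmet : ∀ i j, coordMetric (metricTensor n M) (e.trans Θ) z i j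
        = ∑ a, ∑ b, coordMetric (metricTensor n M) e (Θ.symm z) a b
          * fderiv ℝ Θ.symm z (EuclideanSpace.single i 1) a
          * fderiv ℝ Θ.symm z (EuclideanSpace.single j 1) b := fun i j =>
      metricTensor_mfderiv_comp hem (φ := (e.trans Θ).symm) (Θ := Θ.symm)
        (Filter.EventuallyEq.rfl) hd hz2 _ _
    ext i j
    have h1 := inner_fderiv_fderiv_eq_sum (hψG _ (hΘW hy))
      (fderiv ℝ Θ.symm z (EuclideanSpace.single i 1))
      (fderiv ℝ Θ.symm z (EuclideanSpace.single j 1))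
    rw [hid, hid, inner_single_single, hG] at h1
    simp only [coordMetric_conformalMetric, Matrix.smul_apply, smul_eq_mul, mul_assoc,
      ← Finset.mul_sum] at h1
    rw [hmet i j]
    simp only [mul_assoc]
    have h2 : Real.exp (u ((e.trans Θ).symm z) / 2) ^ 2 = Real.exp (u (e.symm (Θ.symm z))) := by
      rw [← Real.exp_nat_mul]
      congr 1
      push_cast
      simp only [OpenPartialHomeomorph.trans_symm_eq_symm_trans_symm,
        OpenPartialHomeomorph.coe_trans, Function.comp]
      ring
    rw [h2, Matrix.smul_apply, Matrix.one_apply, h1, smul_eq_mul,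
      inv_mul_cancel_left₀ (Real.exp_pos _).ne']

/-- The quasi-Einstein equation in a conformally flat chart. -/
theorem exists_isFlatQuasiEinstein {f : M → ℝ} {μ lam : ℝ} (hf : ContMDiff (𝓡 n) 𝓘(ℝ, ℝ) ∞ f)
    (hqe : IsQuasiEinstein (metricTensor n M) f μ lam)
    {e : OpenPartialHomeomorph M (EuclideanSpace ℝ (Fin n))}
    (he : e ∈ IsManifold.maximalAtlas (𝓡 n) ∞ M) {v : EuclideanSpace ℝ (Fin n) → ℝ}
    (hv : ContDiffOn ℝ ∞ v e.target) (hv0 : ∀ y ∈ e.target, 0 < v y)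
    (hG : ∀ y ∈ e.target, coordMetric (metricTensor n M) e y
        = (v y ^ 2)⁻¹ • (1 : Matrix (Fin n) (Fin n) ℝ)) :
    ∃ s, IsFlatQuasiEinstein e.target v (f ∘ e.symm) s μ :=
  isFlatQuasiEinstein_of_ricci e.open_target hv
    (contDiffOn_comp_symm he hf.contMDiffOn (subset_univ _)) hv0 hG
    fun y hy i j => hqe e he y hy i j

theorem IsFlatQuasiEinstein.mono {ι : Type} [Fintype ι] [DecidableEq ι]
    {Ω Ω' : Set (EuclideanSpace ℝ ι)} {v f s : EuclideanSpace ℝ ι → ℝ} {μ : ℝ}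
    (H : IsFlatQuasiEinstein Ω v f s μ) (hΩ' : IsOpen Ω') (h : Ω' ⊆ Ω) :
    IsFlatQuasiEinstein Ω' v f s μ :=
  ⟨hΩ', H.smooth_factor.mono h, H.smooth_potential.mono h, H.smooth_trace.mono h,
    fun y hy => H.factor_pos y (h hy), fun y hy => H.eq y (h hy)⟩

theorem sum_smul_one_eq_inner_div {ι : Type} [Fintype ι] [DecidableEq ι] (c : ℝ)
    (X Y : EuclideanSpace ℝ ι) :
    ∑ i, ∑ j, (c⁻¹ • (1 : Matrix ι ι ℝ)) i j * X i * Y j = inner ℝ X Y / c := by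
  rw [inner_eq_sum, Finset.sum_div]
  refine Finset.sum_congr rfl fun i _ => ?_
  rw [Finset.sum_eq_single i]
  · simp
    ring
  · intro j _ hj
    simp [Matrix.one_apply_ne hj.symm]
  · simp

/-- In a conformally flat chart, the foliation is set up on the open set where the gradient of `f`
does not vanish. The resulting Euclidean warped product coordinates are composed with the inverse
chart. -/
theorem isLocallyWarpedProductAt_of_quasiEinstein (hn : 3 ≤ n) {f : M → ℝ} {μ lam : ℝ}
    (hf : ContMDiff (𝓡 n) 𝓘(ℝ, ℝ) ∞ f) (hqe : IsQuasiEinstein (metricTensor n M) f μ lam)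
    (hlcf : IsLocallyConformallyFlat (metricTensor n M)) (hμ : 1 + μ * ((n : ℝ) - 2) ≠ 0) {p : M}
    (hp : mfderiv (𝓡 n) 𝓘(ℝ, ℝ) f p ≠ 0) :
    IsLocallyWarpedProductAt (metricTensor n M) f p := by
  obtain ⟨e, v, he, hpe, hv, hv0, hG⟩ := hlcf.exists_chart p
  obtain ⟨s, H⟩ := exists_isFlatQuasiEinstein hf hqe he hv hv0 hG
  set Ω : Set (EuclideanSpace ℝ (Fin n)) := e.target ∩ grad (f ∘ e.symm) ⁻¹' {0}ᶜ with hΩ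
  have hΩo : IsOpen Ω :=
    (contDiffOn_grad H.isOpen H.smooth_potential).continuousOn.isOpen_inter_preimage e.open_target
      isOpen_compl_singleton
  have hpΩ : e p ∈ Ω := ⟨e.map_source hpe,
    grad_comp_symm_ne_zero he (hf.contMDiffAt.mdifferentiableAt (by simp)) hpe hp⟩
  obtain ⟨α, D, F⟩ := (H.mono hΩo inter_subset_left).exists_isUmbilicFoliation (by simpa using hn)
    (by simpa using hμ) fun y hy => hy.2
  obtain ⟨Θ, a, b, V, w, h, K, hV, hVc, hsrc, hpΘ, hΘΩ, hΘs, hΘs', hw, hw0, hh, hhp, hK, hmet,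
    hlev⟩ := F.exists_warpedProduct (κ := Fin (n - 1)) (by simp; omega) hpΩ
  have hmaps : ∀ x ∈ Θ.source, Θ x ∈ e.target := fun x hx => (hΘΩ (Θ.map_source hx)).1
  have hΦsrc : (Θ.trans e.symm).source = Θ.source := by
    rw [OpenPartialHomeomorph.trans_source]
    exact inter_eq_self_of_subset_left hmaps
  have hΦtgt : ∀ x ∈ (Θ.trans e.symm).target, x ∈ e.source ∧ e x ∈ Θ.target := fun x hx => by
    simpa using hx
  refine ⟨Θ.trans e.symm, a, b, V, w, h, K, hV, hVc, hΦsrc.trans hsrc, ?_, ?_, ?_, hw, hw0, hh, hhp,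
    hK, ?_, ?_⟩
  · simpa using ⟨hpe, hpΘ⟩
  · rw [hΦsrc]
    exact (contMDiffOn_symm_of_mem_maximalAtlas he).comp (contMDiffOn_iff_contDiffOn.2 hΘs) hmaps
  · exact (contMDiffOn_iff_contDiffOn.2 hΘs').comp ((contMDiffOn_of_mem_maximalAtlas he).mono
      fun x hx => (hΦtgt x hx).1) fun x hx => (hΦtgt x hx).2
  · intro x hx X Y
    rw [hΦsrc] at hx
    rw [← hmet x hx X Y, ← sum_smul_one_eq_inner_div, ← hG _ (hmaps x hx)]
    exact metricTensor_mfderiv_comp he (φ := Θ.trans e.symm) (Θ := Θ) Filter.EventuallyEq.rfl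
      (differentiableAt_of_contDiffOn Θ.open_source hΘs hx) (hmaps x hx) X Y
  · intro x hx x' hx'
    rw [hΦsrc] at hx hx'
    exact hlev x hx x' hx'

end FlatChart

/-! ### Constant curvature of the conformal metric. -/

section ConstantCurvature

open Set Filter Topology

theorem sum_mul_single_mul_single {ι : Type} [Fintype ι] [DecidableEq ι] (G : Matrix ι ι ℝ)
    (i j : ι) : ∑ a, ∑ b, G a b * Pi.single (M := fun _ => ℝ) i 1 a
      * Pi.single (M := fun _ => ℝ) j 1 b = G i j := by
  rw [Finset.sum_eq_single i]
  · rw [Finset.sum_eq_single j]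
    · simp
    · intro b _ hb
      simp [hb]
    · simp
  · intro a _ ha
    simp [ha]
  · simp

/-- The sectional curvature of a Riemannian metric at a point is unique in dimension `≥ 2`. -/
theorem HasSectionalCurvatureAt.unique {ι : Type} [Fintype ι] [DecidableEq ι] [Nontrivial ι]
    {G : EuclideanSpace ℝ ι → Matrix ι ι ℝ} {K K' : ℝ} {y : EuclideanSpace ℝ ι}
    (h : HasSectionalCurvatureAt G K y) (h' : HasSectionalCurvatureAt G K' y)
    (hG : (G y).PosDef) : K = K' := by
  obtain ⟨i, j, hij⟩ := exists_pair_ne ι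
  have e := (h (Pi.single i 1) (Pi.single j 1)).symm.trans (h' (Pi.single i 1) (Pi.single j 1))
  simp only [sum_mul_single_mul_single] at e
  refine mul_right_cancel₀ (b := G y i i * G y j j - G y i j ^ 2) (ne_of_gt ?_) e
  have hjj : 0 < G y j j := hG.diag_pos
  have hs : G y j i = G y i j := by simpa using hG.isHermitian.apply i j
  -- On `x = G_jj eᵢ - G_ij eⱼ` the form takes the value `G_jj (G_ii G_jj - G_ij²)`. Positive
  -- definiteness thus makes the Gram determinant positive, so it can be cancelled.
  set x : ι → ℝ := fun k => if k = i then G y j j else if k = j then -G y i j else 0 with hx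
  have hxi : x i = G y j j := by simp [hx]
  have hxj : x j = -G y i j := by simp [hx, hij.symm]
  have hx0 : ∀ k, k ≠ i → k ≠ j → x k = 0 := fun k h1 h2 => by simp [hx, h1, h2]
  have hpos := hG.dotProduct_mulVec_pos (x := x) (fun h0 => hjj.ne' (by rw [← hxi, h0]; rfl))
  have hsum : ∀ F : ι → ℝ, (∑ k, F k * x k) = F i * x i + F j * x j := by
    intro F
    refine Finset.sum_eq_add i j hij (fun k _ hk => ?_) (by simp) (by simp)
    rw [hx0 k hk.1 hk.2, mul_zero]
  have hval : star x ⬝ᵥ (G y).mulVec x = G y j j * (G y i i * G y j j - G y i j ^ 2) := by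
    simp only [dotProduct, Matrix.mulVec, star_trivial, hsum]
    rw [Finset.sum_congr rfl fun k _ => mul_comm (x k) _, hsum, hxi, hxj, hs]
    ring
  rw [hval] at hpos
  exact pos_of_mul_pos_right hpos hjj.le

variable {n : ℕ} {M : Type*} [TopologicalSpace M] [ChartedSpace (EuclideanSpace ℝ (Fin n)) M]
  [IsManifold (𝓡 n) ∞ M] [Bundle.RiemannianBundle (fun x : M => TangentSpace (𝓡 n) x)]

/-- The sectional curvature of a conformally flat metric may be computed in any chart. -/
theorem hasSectionalCurvatureAt_of_conformally_flat
    {e e' : OpenPartialHomeomorph M (EuclideanSpace ℝ (Fin n))}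
    (he : e ∈ IsManifold.maximalAtlas (𝓡 n) ∞ M) (he' : e' ∈ IsManifold.maximalAtlas (𝓡 n) ∞ M)
    {Ω : Set (EuclideanSpace ℝ (Fin n))} (hΩ : IsOpen Ω) (hΩe : Ω ⊆ e.target)
    {z : EuclideanSpace ℝ (Fin n) → ℝ} (hz : ContDiffOn ℝ ∞ z Ω) (hz0 : ∀ x ∈ Ω, z x ≠ 0)
    {u : M → ℝ} (hG : ∀ x ∈ Ω, coordMetric (conformalMetric u (metricTensor n M)) e x
        = (z x ^ 2)⁻¹ • (1 : Matrix (Fin n) (Fin n) ℝ))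
    {y : EuclideanSpace ℝ (Fin n)} (hy : y ∈ e'.target) (hye : e'.symm y ∈ e.source)
    (hyΩ : e (e'.symm y) ∈ Ω) {C : ℝ}
    (hC : ∀ i j, pd i (pd j z) (e (e'.symm y)) = if i = j then C else 0) :
    HasSectionalCurvatureAt (coordMetric (conformalMetric u (metricTensor n M)) e')
      (2 * z (e (e'.symm y)) * C - ∑ k, pd k z (e (e'.symm y)) ^ 2) y := by
  -- The transition map is umbilic with zero normal and `c = 0`, and it induces the metric of the
  -- chart `e'`. The Gauss equation gives the curvature in `e'` directly, without a transformation
  -- law for the curvature tensor.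
  set τ : EuclideanSpace ℝ (Fin n) → EuclideanSpace ℝ (Fin n) := e ∘ e'.symm with hτ
  set T : Set (EuclideanSpace ℝ (Fin n)) := e'.target ∩ e'.symm ⁻¹' e.source with hT
  have hTo : IsOpen T := e'.symm.isOpen_inter_preimage e.open_source
  have hτT : ContDiffOn ℝ ∞ τ T := contDiffOn_transition he' he
  set Ω' : Set (EuclideanSpace ℝ (Fin n)) := T ∩ τ ⁻¹' Ω with hΩ'
  have hΩo : IsOpen Ω' := hτT.continuousOn.isOpen_inter_preimage hTo hΩ
  have hτs : ContDiffOn ℝ ∞ τ Ω' := hτT.mono inter_subset_left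
  have hyΩ' : y ∈ Ω' := ⟨⟨hy, hye⟩, hyΩ⟩
  have hd : ∀ x ∈ Ω', DifferentiableAt ℝ τ x := fun x hx =>
    differentiableAt_of_contDiffOn hΩo hτs hx
  have hsurj : ∀ x ∈ Ω', ∀ Z, ∃ w, fderiv ℝ τ x w = Z := by
    intro x hx Z
    have hback : ContDiffOn ℝ ∞ (e' ∘ e.symm) (e.target ∩ e.symm ⁻¹' e'.source) :=
      contDiffOn_transition he he'
    have hτx : τ x ∈ e.target ∩ e.symm ⁻¹' e'.source := by
      refine ⟨hΩe hx.2, ?_⟩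
      simp only [hτ, mem_preimage, Function.comp, e.left_inv hx.1.2]
      exact e'.map_target hx.1.1
    have hbo : IsOpen (e.target ∩ e.symm ⁻¹' e'.source) :=
      e.symm.isOpen_inter_preimage e'.open_source
    have hinv : e' (e.symm (τ x)) = x := by
      simp only [hτ, Function.comp, e.left_inv hx.1.2, e'.right_inv hx.1.1]
    have h1 : HasFDerivAt τ (fderiv ℝ τ x) ((e' ∘ e.symm) (τ x)) := by
      rw [Function.comp, hinv]
      exact (hd x hx).hasFDerivAt
    have h2 := h1.comp (τ x) (differentiableAt_of_contDiffOn hbo hback hτx).hasFDerivAt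
    have h3 : τ ∘ (e' ∘ e.symm) =ᶠ[𝓝 (τ x)] id := by
      filter_upwards [hbo.mem_nhds hτx] with a ha
      simp only [hτ, Function.comp, id, e'.left_inv ha.2, e.right_inv ha.1]
    have h4 := (h2.congr_of_eventuallyEq h3.symm).unique (hasFDerivAt_id (τ x))
    exact ⟨_, congrArg (fun T => T Z) h4⟩
  have hmet : ∀ x ∈ Ω', ∀ i j, coordMetric (conformalMetric u (metricTensor n M)) e' x i j
      = inner ℝ (dd i τ x) (dd j τ x) / z (τ x) ^ 2 := by
    intro x hx i j
    have hev : e'.symm =ᶠ[𝓝 x] e.symm ∘ τ := by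
      filter_upwards [hTo.mem_nhds hx.1] with a ha
      simp only [hτ, Function.comp, e.left_inv ha.2]
    have h1 : coordMetric (metricTensor n M) e' x i j = _ :=
      metricTensor_mfderiv_comp he hev (hd x hx) (hΩe hx.2)
        (EuclideanSpace.single i 1) (EuclideanSpace.single j 1)
    have h2 := hG (τ x) hx.2
    rw [coordMetric_conformalMetric] at h2 ⊢
    have hpt : e.symm (τ x) = e'.symm x := hev.eq_of_nhds.symm
    rw [hpt] at h2
    rw [Matrix.smul_apply, h1, ← sum_smul_one_eq_inner_div, ← h2]
    simp only [Matrix.smul_apply, smul_eq_mul, Finset.mul_sum]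
    exact Finset.sum_congr rfl fun a _ => Finset.sum_congr rfl fun b _ => by
      unfold dd
      ring
  have hcomp : ∀ {V : Type} [NormedAddCommGroup V] [NormedSpace ℝ V]
      (g : EuclideanSpace ℝ (Fin n) → V), ContDiffOn ℝ ∞ g Ω → ∀ x ∈ Ω', ∀ i,
      dd i (fun x => g (τ x)) x = fderiv ℝ g (τ x) (dd i τ x) := by
    intro V _ _ g hg x hx i
    have h1 := (differentiableAt_of_contDiffOn hΩ hg hx.2).hasFDerivAt.comp x (hd x hx).hasFDerivAt
    exact congrArg (fun T => T (EuclideanSpace.single i 1)) h1.fderiv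
  have hgs := contDiffOn_grad hΩ hz
  have hU : IsUmbilic Ω' τ (fun x => grad z (τ x)) 0 (fun x => z (τ x)) 0
      (coordMetric (conformalMetric u (metricTensor n M)) e') :=
  { isOpen := hΩo
    smooth := hτs
    smooth_grad := hgs.comp hτs fun x hx => hx.2
    smooth_normal := contDiffOn_const
    smooth_factor := hz.comp hτs fun x hx => hx.2
    factor_ne := fun x hx => hz0 _ hx.2
    pd_factor := fun x hx i => by
      rw [inner_grad]
      exact hcomp z hz x hx i
    metric := hmet
    det_ne := fun x hx => (posDef_coordMetric_conformalMetric he' u hx.1.1).det_pos.ne'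
    normal := fun x _ i => by simp
    normal_unit := fun x _ => by simp
    dd_normal := fun x _ i => by
      have : dd i (0 : EuclideanSpace ℝ (Fin n) → EuclideanSpace ℝ (Fin n)) x = 0 := dd_const i 0
      rw [this]
      simp
    span := fun x hx Z hZ _ => by
      obtain ⟨w, hw⟩ := hsurj x hx Z
      refine inner_self_eq_zero (𝕜 := ℝ).1 ?_
      refine (congrArg (fun a => inner ℝ Z a) (hw.symm.trans (fderiv_eq_sum_dd τ x w))).trans ?_
      simp only [inner_sum, real_inner_smul_right, hZ]
      simp }
  have hgg : (inner ℝ (grad z (τ y)) (grad z (τ y)) : ℝ) = ∑ k, pd k z (τ y) ^ 2 := by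
    rw [inner_eq_sum]
    exact Finset.sum_congr rfl fun k _ => by rw [grad_apply, sq]
  have key := hU.hasSectionalCurvatureAt hyΩ' (C := C) fun i => ?_
  · rw [hgg, zero_pow two_ne_zero, add_zero] at key
    exact key
  · rw [hcomp _ hgs y hyΩ' i]
    ext j
    rw [fderiv_grad_apply hΩ hz (show τ y ∈ Ω from hyΩ), PiLp.smul_apply, smul_eq_mul]
    have : ∀ k, pd k (pd j z) (τ y) = if k = j then C else 0 := fun k => hC k j
    simp only [this, mul_ite, mul_zero, Finset.sum_ite_eq', Finset.mem_univ, if_true]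
    ring

variable [IsContMDiffRiemannianBundle (𝓡 n) ∞ (EuclideanSpace ℝ (Fin n))
  (fun x : M => TangentSpace (𝓡 n) x)]

/-- In a conformally flat chart `exp(-2f/(n-2)) g = z⁻²⟨·,·⟩` with `z = v exp(f/(n-2))`, so the
curvature is constant near each point. Although `v` depends on the chart, the conformal factor does
not, and the constants can be compared on overlaps. -/
theorem exists_hasConstantCurvature_of_quasiEinstein [ConnectedSpace M] (hn : 3 ≤ n) {f : M → ℝ}
    {μ lam : ℝ} (hf : ContMDiff (𝓡 n) 𝓘(ℝ, ℝ) ∞ f)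
    (hqe : IsQuasiEinstein (metricTensor n M) f μ lam)
    (hlcf : IsLocallyConformallyFlat (metricTensor n M)) (hμ : 1 + μ * ((n : ℝ) - 2) = 0) :
    ∃ K, HasConstantCurvature
      (conformalMetric (fun x => -2 / ((n : ℝ) - 2) * f x) (metricTensor n M)) K := by
  have hnt : Nontrivial (Fin n) := Fin.nontrivial_iff_two_le.2 (by omega)
  set u : M → ℝ := fun x => -2 / ((n : ℝ) - 2) * f x with hu
  set g := conformalMetric u (metricTensor n M) with hg
  have hloc : ∀ p : M, ∃ (K : ℝ) (N : Set M), IsOpen N ∧ p ∈ N ∧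
      ∀ e ∈ IsManifold.maximalAtlas (𝓡 n) ∞ M, ∀ y ∈ e.target, e.symm y ∈ N →
        HasSectionalCurvatureAt (coordMetric g e) K y := by
    intro p
    obtain ⟨e, v, he, hpe, hv, hv0, hG⟩ := hlcf.exists_chart p
    obtain ⟨s, H⟩ := exists_isFlatQuasiEinstein hf hqe he hv hv0 hG
    obtain ⟨r, hr, hball⟩ := Metric.isOpen_iff.1 e.open_target _ (e.map_source hpe)
    have HB := H.mono Metric.isOpen_ball hball
    obtain ⟨C, K, hCK⟩ := HB.exists_const (by simpa using hn) (by simpa using hμ)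
      (convex_ball _ r).isPreconnected ⟨_, Metric.mem_ball_self hr⟩
    simp only [Fintype.card_fin] at hCK
    set z : EuclideanSpace ℝ (Fin n) → ℝ :=
      fun y => v y * Real.exp ((f ∘ e.symm) y / ((n : ℝ) - 2)) with hz
    have hzs : ContDiffOn ℝ ∞ z (Metric.ball (e p) r) :=
      HB.smooth_factor.mul (contDiffOn_exp_div HB.smooth_potential _)
    have hGz : ∀ x ∈ Metric.ball (e p) r, coordMetric g e x
        = (z x ^ 2)⁻¹ • (1 : Matrix (Fin n) (Fin n) ℝ) := by
      intro x hx
      rw [hg, coordMetric_conformalMetric, hG x (hball hx), smul_smul]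
      congr 1
      have h1 : Real.exp (u (e.symm x))
          = (Real.exp ((f ∘ e.symm) x / ((n : ℝ) - 2)) ^ 2)⁻¹ := by
        rw [← Real.exp_nat_mul, ← Real.exp_neg, hu]
        congr 1
        simp only [Function.comp]
        push_cast
        ring
      rw [h1, hz, mul_pow, mul_inv, mul_comm]
    refine ⟨K, e.source ∩ e ⁻¹' Metric.ball (e p) r, e.isOpen_inter_preimage Metric.isOpen_ball,
      ⟨hpe, Metric.mem_ball_self hr⟩, fun e' he' y hy hyN => ?_⟩
    have h1 := hasSectionalCurvatureAt_of_conformally_flat he he' Metric.isOpen_ball hball hzs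
      (fun x hx => mul_ne_zero (hv0 x (hball hx)).ne' (Real.exp_pos _).ne') hGz hy hyN.1 hyN.2
      (hCK _ hyN.2).1
    rwa [(hCK _ hyN.2).2] at h1
  choose K N hNo hpN hK using hloc
  -- If `q` lies in the neighbourhood of `p`, both constants are the curvature at `q` in the same
  -- chart, so they agree by uniqueness. Connectedness then gives a single constant.
  have hlc : IsLocallyConstant K := by
    refine (IsLocallyConstant.iff_exists_open K).2 fun p => ⟨N p, hNo p, hpN p, fun q hq => ?_⟩
    set e := chartAt (EuclideanSpace ℝ (Fin n)) q with he
    have hem : e ∈ IsManifold.maximalAtlas (𝓡 n) ∞ M := IsManifold.chart_mem_maximalAtlas q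
    have hqe' : q ∈ e.source := mem_chart_source _ q
    have hqt := e.map_source hqe'
    exact (hK q e hem (e q) hqt (by rw [e.left_inv hqe']; exact hpN q)).unique
      (hK p e hem (e q) hqt (by rw [e.left_inv hqe']; exact hq))
      (posDef_coordMetric_conformalMetric hem u hqt)
  obtain ⟨p₀⟩ : Nonempty M := inferInstance
  refine ⟨K p₀, fun e he y hy => ?_⟩
  rw [hlc.apply_eq_of_preconnectedSpace p₀ (e.symm y)]
  exact hK (e.symm y) e he y hy (hpN _)

end ConstantCurvature

end QuasiEinstein

end

theorem theorem1p1 (n : ℕ) (hn : 3 ≤ n)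
    {M : Type*} [EMetricSpace M] [ChartedSpace (EuclideanSpace ℝ (Fin n)) M]
    [IsManifold (𝓡 n) ∞ M]
    [Bundle.RiemannianBundle (fun x : M => TangentSpace (𝓡 n) x)]
    [IsContMDiffRiemannianBundle (𝓡 n) ∞ (EuclideanSpace ℝ (Fin n))
      (fun x : M => TangentSpace (𝓡 n) x)]
    [IsRiemannianManifold (𝓡 n) M]
    [CompleteSpace M] [ConnectedSpace M]
    (f : M → ℝ) (hf : ContMDiff (𝓡 n) 𝓘(ℝ, ℝ) ∞ f) (μ lam : ℝ)
    (hqe : QuasiEinstein.IsQuasiEinstein (QuasiEinstein.metricTensor n M) f μ lam)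
    (hlcf : QuasiEinstein.IsLocallyConformallyFlat (QuasiEinstein.metricTensor n M)) :
    (μ = 1 / (2 - (n : ℝ)) →
      ∃ u : M → ℝ, ContMDiff (𝓡 n) 𝓘(ℝ, ℝ) ∞ u ∧
        ∃ K : ℝ, QuasiEinstein.HasConstantCurvature
          (QuasiEinstein.conformalMetric u (QuasiEinstein.metricTensor n M)) K) ∧
    (μ ≠ 1 / (2 - (n : ℝ)) →
      ∀ p : M, mfderiv (𝓡 n) 𝓘(ℝ, ℝ) f p ≠ 0 →
        QuasiEinstein.IsLocallyWarpedProductAt (QuasiEinstein.metricTensor n M) f p) := by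
  have hn' : (2 : ℝ) - n ≠ 0 := by
    have : (3 : ℝ) ≤ n := by exact_mod_cast hn
    linarith
  -- The dichotomy of the statement is the vanishing or not of the Codazzi factor.
  have hμ : μ = 1 / (2 - (n : ℝ)) ↔ 1 + μ * ((n : ℝ) - 2) = 0 := by
    rw [eq_div_iff hn']
    constructor <;> intro h <;> linear_combination -h
  refine ⟨fun h => ⟨fun x => -2 / ((n : ℝ) - 2) * f x, contMDiff_const.mul hf,
    QuasiEinstein.exists_hasConstantCurvature_of_quasiEinstein hn hf hqe hlcf (hμ.1 h)⟩,
    fun h p hp => ?_⟩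
  exact QuasiEinstein.isLocallyWarpedProductAt_of_quasiEinstein hn hf hqe hlcf
    (fun h0 => h (hμ.2 h0)) hp
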